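/- A \emph{pure orbifold} is a normal (Hausdorff) complex analytic space $X$ having only quotient singularities: every $a\in X$ has a \emph{local uniformization} $(U,\tilde U/G,\varphi)$, i.e. an open neighbourhood $U$ of $a$, a finite subgroup $G\subset GL(n,\mathbb C)$ in which every $g\ne 1$ has a fixed space of codimension at least $2$, a $G$-stable open neighbourhood $\tilde U$ of $0$ in $\mathbb C^n$, and an isomorphism $\varphi:\tilde U/G\to U$ (where $\tilde U/G$ carries the sheaf of $G$-invariant holomorphic functions) with $\varphi(0)=a$. Let $X^*\subset X$ be the smooth locus, and for $b\in X^*$ put $\pi_1^{orb}(X,b):=\pi_1(X^*,b)$. A (connected) \emph{orbifold covering} of $X$ is a holomorphic map $r:X'\to X$ from a connected pure orbifold $X'$ such that: (1) the restriction $r^*:X''\to X^*$ of $r$, with $X'':=r^{-1}(X^*)$, is a (surjective) étale covering; (2) for every $a\in X$, every local uniformization $(U,\tilde U/G,\varphi)$ of $X$ at $a$ with $\tilde U$ simply connected, and every connected component $U''$ of $r^{-1}(U\cap X^*)$, there are $a'\in r^{-1}(a)$, a subgroup $G'\subset G$ and a local uniformization $(U',\tilde U/G',\varphi')$ of $X'$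 at $a'$ such that $U''=U'\cap X''$ and $\varphi^{-1}\circ r\circ\varphi':\tilde U/G'\to\tilde U/G$ is the natural quotient map. An isomorphism of orbifold coverings is a biholomorphic map commuting with the projections to $X$. To an orbifold covering $r:X'\to X$ with a base point $b'\in r^{-1}(b)$ one associates the subgroup $r^*_*\,\pi_1(X'',b')$ of $\pi_1^{orb}(X,b)$. \textbf{Proposition.} Let $X$ be a connected pure orbifold and $b\in X^*$. Then $(r:X'\to X,\ b')\mapsto r^*_*\,\pi_1(X'',b')$ induces a bijection from the set of isomorphism classes of connected orbifold coverings of $X$ with a base point over $b$ (isomorphisms preserving base points) onto the set of subgroups of $\pi_1^{orb}(X,b)$. Forgetting base points, the conjugacy class of $r^*_*\,\pi_1(X'',b')$ does not depend on the choice of $b'\in r^{-1}(b)$, and one obtains a bijection from the set of isomorphism classes of connected orbifold coverings of $X$ onto the set of conjugacy classes of subgroups of $\pi_1^{orb}(X,b)$. -/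

import Mathlib

open Topology

universe u v w

/-- A subsheaf of the sheaf of complex-valued functions on `X`, given by its germs:
`HolAt f x` means that the germ of `f` at `x` lies in the stalk at `x`. The sections over an open
set `U` are the functions `f` with `HolAt f x` for all `x ∈ U`. On a complex space (all those used
here are reduced) this is the structure sheaf, the sheaf of holomorphic functions. -/
class StructureSheaf (X : Type u) [TopologicalSpace X] where
  HolAt : (X → ℂ) → X → Prop
  congr : ∀ {f g : X → ℂ} {x : X}, f =ᶠ[𝓝 x] g → HolAt f x → HolAt g x
  eventually : ∀ {f : X → ℂ} {x : X}, HolAt f x → ∀ᶠ y in 𝓝 x, HolAt f y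

/-- A holomorphic map: a continuous map that pulls back holomorphic germs to holomorphic germs,
i.e. a morphism of spaces with a structure sheaf of functions. -/
structure IsHolomorphicMap {X : Type u} {Y : Type v} [TopologicalSpace X] [StructureSheaf X]
    [TopologicalSpace Y] [StructureSheaf Y] (r : X → Y) : Prop where
  continuous : Continuous r
  pullback : ∀ (x : X) (f : Y → ℂ),
    StructureSheaf.HolAt f (r x) → StructureSheaf.HolAt (f ∘ r) x

/-- A finite subgroup of `GL(n, ℂ)` such that the fixed space of every `g ≠ 1` in it has
codimension at least two. -/
structure IsSmallGroup {n : ℕ} (G : Subgroup (GL (Fin n) ℂ)) : Prop where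
  finite : Finite G
  codim_fixed : ∀ g ∈ G, g ≠ 1 →
    Module.finrank ℂ (LinearMap.ker (Matrix.toLin' ((g : Matrix (Fin n) (Fin n) ℂ) - 1))) + 2 ≤ n

/-- A local uniformization `(U, D / G, φ)` of `X` at `a`. Here `D ⊆ ℂⁿ` is an open `G`-stable
neighbourhood of `0`, and `φ` is an isomorphism of the quotient `D / G`, with the sheaf of
`G`-invariant holomorphic functions, onto an open set `U ⊆ X`, with `φ(0) = a`. It is recorded as
the composite `q : D → D / G → U` (only the values of `q` on `D` matter):
`φ` is a homeomorphism onto the open set `U = q '' D` iff `q` is continuous and open on `D` with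
the `G`-orbits as its fibres, and the isomorphism of sheaves says that a function on `U` is
holomorphic iff its composite with `q` is. -/
structure IsLocalUniformization {X : Type u} [TopologicalSpace X] [StructureSheaf X] {n : ℕ}
    (G : Subgroup (GL (Fin n) ℂ)) (D : Set (Fin n → ℂ)) (q : (Fin n → ℂ) → X) (a : X) :
    Prop where
  small : IsSmallGroup G
  isOpen : IsOpen D
  zero_mem : (0 : Fin n → ℂ) ∈ D
  stable : ∀ g ∈ G, ∀ z ∈ D, (g : Matrix (Fin n) (Fin n) ℂ).mulVec z ∈ D
  continuousOn : ContinuousOn q D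
  isOpen_image : ∀ V ⊆ D, IsOpen V → IsOpen (q '' V)
  fibre : ∀ z ∈ D, ∀ w ∈ D,
    (q z = q w ↔ ∃ g ∈ G, (g : Matrix (Fin n) (Fin n) ℂ).mulVec z = w)
  sheaf : ∀ z ∈ D, ∀ f : X → ℂ, StructureSheaf.HolAt f (q z) ↔ AnalyticAt ℂ (f ∘ q) z
  map_zero : q 0 = a

/-- A pure orbifold: a normal complex space with only quotient singularities, that is, a Hausdorff
space with a structure sheaf of functions that has a local uniformization at each of its points
(the quotients `D / G` are normal complex spaces). -/
structure IsPureOrbifold (X : Type u) [TopologicalSpace X] [StructureSheaf X] : Prop where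
  t2 : T2Space X
  exists_uniformization : ∀ a : X, ∃ (n : ℕ) (G : Subgroup (GL (Fin n) ℂ))
    (D : Set (Fin n → ℂ)) (q : (Fin n → ℂ) → X), IsLocalUniformization G D q a

/-- The smooth locus `X*`: the points with a neighbourhood isomorphic to an open subset of some
`ℂⁿ` (a local uniformization with trivial group). -/
def smoothLocus (X : Type u) [TopologicalSpace X] [StructureSheaf X] : Set X :=
  {a | ∃ (n : ℕ) (D : Set (Fin n → ℂ)) (q : (Fin n → ℂ) → X),
    IsLocalUniformization (⊥ : Subgroup (GL (Fin n) ℂ)) D q a}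

/-- The orbifold fundamental group `π₁ᵒʳᵇ(X, b) = π₁(X*, b)`. -/
abbrev OrbifoldFundamentalGroup (X : Type u) [TopologicalSpace X] [StructureSheaf X]
    (b : smoothLocus X) : Type u :=
  FundamentalGroup (smoothLocus X) b

/-- `r : Y → X` is a (connected) orbifold covering.
* `isCoveringMap`, `surjective`, `etale`: the restriction `r* : r⁻¹(X*) → X*` is an étale covering:
  a surjective topological covering that is locally biholomorphic (`r*` being a local
  homeomorphism, this says that a germ `f` at `r y` is holomorphic as soon as `f ∘ r` is).
* `components`: for every local uniformization `(U, D / G, φ)` of `X` at a point `a`, with `D`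
  simply connected, every connected component of `r⁻¹(U ∩ X*)` is `U' ∩ r⁻¹(X*)` for some local
  uniformization `(U', D / G', φ')` of `Y` at a point `a'` over `a`, with `G' ≤ G`, in which `r` is
  the natural quotient map `D / G' → D / G`. -/
structure IsOrbifoldCovering {Y : Type v} {X : Type u} [TopologicalSpace Y] [StructureSheaf Y]
    [TopologicalSpace X] [StructureSheaf X] (r : Y → X) : Prop where
  isPureOrbifold : IsPureOrbifold Y
  connected : ConnectedSpace Y
  holomorphic : IsHolomorphicMap r
  isCoveringMap : IsCoveringMap ((smoothLocus X).restrictPreimage r)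
  surjective : Function.Surjective ((smoothLocus X).restrictPreimage r)
  etale : ∀ y : Y, r y ∈ smoothLocus X → ∀ f : X → ℂ,
    StructureSheaf.HolAt (f ∘ r) y → StructureSheaf.HolAt f (r y)
  components : ∀ (a : X) (n : ℕ) (G : Subgroup (GL (Fin n) ℂ)) (D : Set (Fin n → ℂ))
    (q : (Fin n → ℂ) → X), IsLocalUniformization G D q a → SimplyConnectedSpace D →
    ∀ y ∈ r ⁻¹' (q '' D ∩ smoothLocus X),
      ∃ (a' : Y) (G' : Subgroup (GL (Fin n) ℂ)) (q' : (Fin n → ℂ) → Y),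
        r a' = a ∧ G' ≤ G ∧ IsLocalUniformization G' D q' a' ∧
        q' '' D ∩ r ⁻¹' smoothLocus X = connectedComponentIn (r ⁻¹' (q '' D ∩ smoothLocus X)) y ∧
        ∀ z ∈ D, r (q' z) = q z

/-- An orbifold covering of `X`, bundled. -/
structure OrbifoldCovering (X : Type u) [TopologicalSpace X] [StructureSheaf X] :
    Type (u + 1) where
  space : Type u
  [top : TopologicalSpace space]
  [sheaf : StructureSheaf space]
  proj : space → X
  isCovering : IsOrbifoldCovering proj

attribute [instance] OrbifoldCovering.top OrbifoldCovering.sheaf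

/-- An isomorphism of orbifold coverings: a biholomorphic map over `X`. -/
structure OrbifoldCovering.Iso {X : Type u} [TopologicalSpace X] [StructureSheaf X]
    (C C' : OrbifoldCovering X) where
  toHomeomorph : C.space ≃ₜ C'.space
  holomorphic : IsHolomorphicMap toHomeomorph
  holomorphic_symm : IsHolomorphicMap toHomeomorph.symm
  proj_comp : ∀ y, C'.proj (toHomeomorph y) = C.proj y

/-- An orbifold covering of `X` with a base point over `b ∈ X*`. -/
structure PointedOrbifoldCovering (X : Type u) [TopologicalSpace X] [StructureSheaf X]
    (b : smoothLocus X) extends OrbifoldCovering X where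
  point : space
  proj_point : proj point = b

section

variable {X : Type u} [TopologicalSpace X] [StructureSheaf X]

theorem IsHolomorphicMap.id : IsHolomorphicMap (fun x : X => x) :=
  ⟨continuous_id, fun _ _ h => h⟩

theorem IsHolomorphicMap.comp {Y : Type v} {Z : Type w} [TopologicalSpace Y] [StructureSheaf Y]
    [TopologicalSpace Z] [StructureSheaf Z] {s : Y → Z} {r : X → Y} (hs : IsHolomorphicMap s)
    (hr : IsHolomorphicMap r) : IsHolomorphicMap (s ∘ r) :=
  ⟨hs.continuous.comp hr.continuous,
    fun x f h => hr.pullback x (f ∘ s) (hs.pullback (r x) f h)⟩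

namespace OrbifoldCovering

def Iso.refl (C : OrbifoldCovering X) : Iso C C :=
  ⟨Homeomorph.refl _, IsHolomorphicMap.id, IsHolomorphicMap.id, fun _ => rfl⟩

def Iso.symm {C C' : OrbifoldCovering X} (e : Iso C C') : Iso C' C :=
  ⟨e.toHomeomorph.symm, e.holomorphic_symm, e.holomorphic, fun y => by
    rw [← e.proj_comp, Homeomorph.apply_symm_apply]⟩

def Iso.trans {C C' C'' : OrbifoldCovering X} (e : Iso C C') (e' : Iso C' C'') : Iso C C'' :=
  ⟨e.toHomeomorph.trans e'.toHomeomorph, e'.holomorphic.comp e.holomorphic,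
    e.holomorphic_symm.comp e'.holomorphic_symm, fun y => by
    rw [Homeomorph.trans_apply, e'.proj_comp, e.proj_comp]⟩

/-- Being isomorphic, for orbifold coverings. -/
instance isoSetoid : Setoid (OrbifoldCovering X) where
  r C C' := Nonempty (Iso C C')
  iseqv := ⟨fun C => ⟨Iso.refl C⟩, fun ⟨e⟩ => ⟨e.symm⟩, fun ⟨e⟩ ⟨e'⟩ => ⟨e.trans e'⟩⟩

/-- The restriction `r* : r⁻¹(X*) → X*` of an orbifold covering, as a continuous map. -/
def restr (C : OrbifoldCovering X) : C(C.proj ⁻¹' smoothLocus X, smoothLocus X) :=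
  ⟨(smoothLocus X).restrictPreimage C.proj,
    C.isCovering.holomorphic.continuous.restrictPreimage⟩

theorem Iso.proj_mem {C C' : OrbifoldCovering X} (e : Iso C C') (y : C.space)
    (hy : C.proj y ∈ smoothLocus X) : C'.proj (e.toHomeomorph y) ∈ smoothLocus X := by
  rwa [e.proj_comp]

/-- The map `r₁⁻¹(X*) → r₂⁻¹(X*)` induced by an isomorphism. -/
def Iso.restr {C C' : OrbifoldCovering X} (e : Iso C C') :
    C(C.proj ⁻¹' smoothLocus X, C'.proj ⁻¹' smoothLocus X) :=
  ⟨fun y => ⟨e.toHomeomorph y.1, e.proj_mem y.1 y.2⟩,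
    (e.toHomeomorph.continuous.comp continuous_subtype_val).subtype_mk _⟩

end OrbifoldCovering

namespace PointedOrbifoldCovering

variable {b : smoothLocus X}

/-- Being isomorphic, for orbifold coverings with a base point over `b`: there is an isomorphism
of coverings that maps base point to base point. -/
instance isoSetoid : Setoid (PointedOrbifoldCovering X b) where
  r P P' := ∃ e : OrbifoldCovering.Iso P.toOrbifoldCovering P'.toOrbifoldCovering,
    e.toHomeomorph P.point = P'.point
  iseqv := ⟨fun _ => ⟨OrbifoldCovering.Iso.refl _, rfl⟩,
    fun ⟨e, he⟩ => ⟨e.symm, (Homeomorph.symm_apply_eq _).2 he.symm⟩,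
    fun ⟨e, he⟩ ⟨e', he'⟩ => ⟨e.trans e', (congrArg e'.toHomeomorph he).trans he'⟩⟩

/-- The base point, as a point of `r⁻¹(X*)`. -/
def smoothPoint (P : PointedOrbifoldCovering X b) : P.proj ⁻¹' smoothLocus X :=
  ⟨P.point, by rw [Set.mem_preimage, P.proj_point]; exact b.2⟩

theorem restr_smoothPoint (P : PointedOrbifoldCovering X b) :
    P.toOrbifoldCovering.restr P.smoothPoint = b :=
  Subtype.ext P.proj_point

/-- The subgroup defined by the restriction of an orbifold covering over `X*`: the image of
`π₁(r⁻¹(X*), b')` in `π₁(X*, b)`. -/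
noncomputable def subgroup (P : PointedOrbifoldCovering X b) : Subgroup (OrbifoldFundamentalGroup X b) :=
  (FundamentalGroup.mapOfEq P.toOrbifoldCovering.restr P.restr_smoothPoint).range

theorem subgroup_le_of_iso {P P' : PointedOrbifoldCovering X b} (h : P ≈ P') :
    P.subgroup ≤ P'.subgroup := by
  obtain ⟨e, he⟩ := h
  rintro _ ⟨p, rfl⟩
  have hpt : e.restr P.smoothPoint = P'.smoothPoint := Subtype.ext he
  refine ⟨FundamentalGroup.mapOfEq e.restr hpt p, ?_⟩
  simp only [FundamentalGroup.mapOfEq_apply]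
  induction p using Path.Homotopic.Quotient.ind with
  | mk γ =>
    refine congrArg Path.Homotopic.Quotient.mk (Path.ext (funext fun t => ?_))
    exact Subtype.ext (e.proj_comp _)

theorem subgroup_eq_of_iso {P P' : PointedOrbifoldCovering X b} (h : P ≈ P') :
    P.subgroup = P'.subgroup :=
  le_antisymm (subgroup_le_of_iso h) (subgroup_le_of_iso (Setoid.symm h))

end PointedOrbifoldCovering

end

/-- Isomorphism classes of connected orbifold coverings of `X`. -/
abbrev OrbifoldCoveringClass (X : Type u) [TopologicalSpace X] [StructureSheaf X] :
    Type (u + 1) :=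
  Quotient (OrbifoldCovering.isoSetoid (X := X))

/-- Isomorphism classes of connected orbifold coverings of `X` with a base point over `b`. -/
abbrev PointedOrbifoldCoveringClass (X : Type u) [TopologicalSpace X] [StructureSheaf X]
    (b : smoothLocus X) : Type (u + 1) :=
  Quotient (PointedOrbifoldCovering.isoSetoid (X := X) (b := b))

/-- The natural map from isomorphism classes of pointed connected orbifold coverings to subgroups
of the orbifold fundamental group. -/
noncomputable def PointedOrbifoldCoveringClass.subgroup {X : Type u} [TopologicalSpace X] [StructureSheaf X]
    {b : smoothLocus X} :
    PointedOrbifoldCoveringClass X b → Subgroup (OrbifoldFundamentalGroup X b) :=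
  Quotient.lift PointedOrbifoldCovering.subgroup
    fun _ _ h => PointedOrbifoldCovering.subgroup_eq_of_iso h

/-- Two subgroups are equivalent when they are conjugate. -/
def conjugateSetoid (π : Type u) [Group π] : Setoid (Subgroup π) where
  r H K := ∃ g : π, H.map (MulAut.conj g).toMonoidHom = K
  iseqv := by
    refine ⟨fun H => ⟨1, ?_⟩, ?_, ?_⟩
    · ext x; simp
    · rintro H _ ⟨g, rfl⟩
      refine ⟨g⁻¹, ?_⟩
      ext x; simp [Subgroup.mem_map, mul_assoc]
    · rintro H _ _ ⟨g, rfl⟩ ⟨h, rfl⟩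
      refine ⟨h * g, ?_⟩
      ext x; simp [Subgroup.mem_map, mul_assoc]

/-! Everything reduces to covering theory over the manifold X*, because fixed spaces of complex
codimension at least two are invisible both to homotopies and to continuous functions that are
holomorphic elsewhere. Let D be the simply connected domain of a local uniformization q and D₀ the
part of D on which G acts freely. Then D₀ is still simply connected
(`IsSmallGroup.simplyConnectedSpace_inter_freeLocus`): a homotopy is replaced by a triangulated grid
in general position, whose triangles miss the fixed spaces since these have real codimension at
least four. Hence q : D₀ → X* lifts to every covering of X*.

Existence. A subgroup gives a connected covering E → X* (`GoodCover.exists_covering`), which is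
completed over X as in Fox's theory of spreads: a point over x is a compatible choice of components
of the preimages of the neighbourhoods of x (`FoxPoint`). A lift l : D₀ → E extends to D
(`IsLift.exists_isFoxChart`), and the extension identifies D/G' with an open set of the completion,
where G' consists of the g in G with l ∘ g = l (`IsFoxChart.exists_map_eq`, `IsFoxChart.fibre`).
These charts define the structure sheaf; independence of the chart is a Riemann extension theorem,
which rests on Osgood's lemma (`IsFoxChart.analyticAt_of_foxHolAt`).

Uniqueness. In any orbifold covering r : Y → X the set r⁻¹(X*) is dense and connected, because in a
chart of Y the points to be discarded lie in the zero set of an analytic function pulled back from X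
(`IsOrbifoldCovering.exists_nhds_isPreconnected`). So morphisms are determined over X*; there they
exist by the lifting criterion as soon as the subgroups are contained in each other, and they extend
because both coverings are uniformized by the same D (`IsOrbifoldCovering.exists_extension`). Moving
the base point in the fibre conjugates the subgroup, and every conjugate arises.

Only the inclusion q(D₀) ⊆ X* is used, never equality. Smooth points that are not known to lie in
q(D₀) are dealt with by density and connectedness. -/

/-- A subset of a preconnected set is preconnected if it is dense and locally preconnected in it. -/
theorem isPreconnected_of_dense_of_locally {M : Type*} [TopologicalSpace M] {s f : Set M}
    (hs : IsPreconnected s) (hfs : f ⊆ s) (hd : s ⊆ closure f)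
    (hloc : ∀ x ∈ s, ∃ N ∈ 𝓝 x, IsPreconnected (N ∩ f)) : IsPreconnected f := by
  intro u v hu hv hfuv hfu hfv
  by_contra hne
  have hcl : s ⊆ closure (f ∩ u) ∪ closure (f ∩ v) := by
    rw [← closure_union, ← Set.inter_union_distrib_left, Set.inter_eq_left.2 hfuv]
    exact hd
  obtain ⟨x, hxs, hxu, hxv⟩ := isPreconnected_closed_iff.1 hs _ _ isClosed_closure
    isClosed_closure hcl
    (hfu.mono fun x hx => ⟨hfs hx.1, subset_closure hx⟩)
    (hfv.mono fun x hx => ⟨hfs hx.1, subset_closure hx⟩)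
  obtain ⟨N, hN, hNp⟩ := hloc x hxs
  obtain ⟨a, haN, haf, hau⟩ := mem_closure_iff_nhds.1 hxu N hN
  obtain ⟨c, hcN, hcf, hcv⟩ := mem_closure_iff_nhds.1 hxv N hN
  obtain ⟨d, hd, hduv⟩ := hNp u v hu hv (Set.inter_subset_right.trans hfuv) ⟨a, ⟨haN, haf⟩, hau⟩
    ⟨c, ⟨hcN, hcf⟩, hcv⟩
  exact hne ⟨d, hd.2, hduv⟩

/-! ### General position with respect to complex subspaces. -/

section GenericPoints

theorem Submodule.dense_iInter_compl {𝕜 E ι : Type*} [NontriviallyNormedField 𝕜] [CompleteSpace 𝕜]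
    [NormedAddCommGroup E] [NormedSpace 𝕜 E] [FiniteDimensional 𝕜 E] [Finite ι]
    {p : ι → Submodule 𝕜 E} (hp : ∀ i, p i ≠ ⊤) : Dense (⋂ i, ((p i : Set E))ᶜ) := by
  have : CompleteSpace E := FiniteDimensional.complete 𝕜 E
  refine dense_iInter_of_isOpen (fun i => ?_) fun i => ?_
  · exact (p i).closed_of_finiteDimensional.isOpen_compl
  · rw [← interior_eq_empty_iff_dense_compl]
    by_contra h
    exact hp i ((p i).eq_top_of_nonempty_interior' (Set.nonempty_iff_ne_empty.2 h))

variable {E : Type*} [NormedAddCommGroup E] [NormedSpace ℂ E] [FiniteDimensional ℂ E]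
  {ι : Type*} [Finite ι] {A : ι → Submodule ℂ E}

theorem Submodule.finrank_real_sup_span_le (W : Submodule ℂ E) {κ : Type*} (t : Finset κ)
    (v : κ → E) :
    Module.finrank ℝ ↥(W.restrictScalars ℝ ⊔ Submodule.span ℝ (v '' t)) ≤
      2 * Module.finrank ℂ W + t.card := by
  classical
  have : FiniteDimensional ℝ E := FiniteDimensional.complexToReal E
  have h1 := Submodule.finrank_add_le_finrank_add_finrank (W.restrictScalars ℝ)
    (Submodule.span ℝ (v '' t))
  have h2 : Module.finrank ℝ (W.restrictScalars ℝ) = 2 * Module.finrank ℂ W :=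
    finrank_real_of_complex W
  have h3 : Module.finrank ℝ (Submodule.span ℝ (v '' t)) ≤ t.card := by
    have := finrank_span_finset_le_card (R := ℝ) (t.image v)
    rw [Finset.coe_image] at this
    exact this.trans Finset.card_image_le
  omega

/-- Real dimension count. Complex codimension two is real codimension four, which leaves room for
three real vectors; complex codimension one leaves room for one. -/
theorem Submodule.real_sup_span_ne_top {W : Submodule ℂ E} {κ : Type*} {t : Finset κ}
    (v : κ → E) (h : 2 * Module.finrank ℂ W + t.card < 2 * Module.finrank ℂ E) :
    W.restrictScalars ℝ ⊔ Submodule.span ℝ (v '' t) ≠ ⊤ := by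
  intro htop
  have h1 := W.finrank_real_sup_span_le t v
  rw [htop, finrank_top, finrank_real_of_complex] at h1
  omega

/-- Points can be chosen in given open sets in general position with respect to finitely many
complex subspaces of codimension at least two. -/
theorem exists_generic_points (hA : ∀ i, Module.finrank ℂ (A i) + 2 ≤ Module.finrank ℂ E)
    {κ : Type*} (s : Finset κ) (O : κ → Set E) (hO : ∀ k, IsOpen (O k))
    (hne : ∀ k, (O k).Nonempty) :
    ∃ v : κ → E, (∀ k, v k ∈ O k) ∧ ∀ t ⊆ s, t.card ≤ 3 → ∀ w : κ → ℝ,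
      (∃ k ∈ t, w k ≠ 0) → ∀ i, ∑ k ∈ t, w k • v k ∉ A i := by
  classical
  have : FiniteDimensional ℝ E := FiniteDimensional.complexToReal E
  induction s using Finset.induction_on with
  | empty =>
    choose v hv using hne
    refine ⟨v, hv, fun t ht _ w ⟨k, hk, _⟩ => ?_⟩
    exact absurd (ht hk) (by simp)
  | insert a s ha ih =>
    obtain ⟨v, hvO, hv⟩ := ih
    let T := {t : Finset κ // t ∈ s.powerset.filter fun t => t.card ≤ 3}
    -- The new point must avoid the real span of each `A i` together with any three or fewer earlier
    -- points. These are finitely many proper real subspaces, so a point of `O a` avoids them all.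
    have hT : ∀ (q : ι × T), (A q.1).restrictScalars ℝ ⊔
        Submodule.span ℝ (v '' (q.2.1 : Set κ)) ≠ ⊤ := by
      rintro ⟨i, t, ht⟩
      refine Submodule.real_sup_span_ne_top v ?_
      have h1 := hA i
      have h2 := (Finset.mem_filter.1 ht).2
      dsimp only
      omega
    have : Finite T := inferInstanceAs (Finite (s.powerset.filter fun t => t.card ≤ 3))
    obtain ⟨c, hcO, hc⟩ := (Submodule.dense_iInter_compl hT).exists_mem_open (hO a) (hne a)
    rw [Set.mem_iInter] at hcO
    refine ⟨Function.update v a c, fun k => ?_, fun t ht htc w ⟨k, hk, hwk⟩ i hmem => ?_⟩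
    · by_cases h : k = a
      · subst h; simpa using hc
      · simpa [h] using hvO k
    · have hsum : ∀ t' ⊆ s, ∑ k ∈ t', w k • Function.update v a c k = ∑ k ∈ t', w k • v k := by
        intro t' ht'
        refine Finset.sum_congr rfl fun k hk => ?_
        rw [Function.update_of_ne]
        rintro rfl
        exact ha (ht' hk)
      by_cases hat : a ∈ t
      · have hts : t.erase a ⊆ s := Finset.subset_insert_iff.1 ht
        have hcard : (t.erase a).card ≤ 3 := (Finset.card_erase_le).trans htc
        rw [← Finset.add_sum_erase t _ hat, hsum _ hts, Function.update_self] at hmem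
        by_cases hwa : w a = 0
        · rw [hwa, zero_smul, zero_add] at hmem
          refine hv _ hts hcard w ⟨k, Finset.mem_erase.2 ⟨?_, hk⟩, hwk⟩ i hmem
          rintro rfl
          exact hwk hwa
        · refine hcO (i, ⟨t.erase a, Finset.mem_filter.2 ⟨Finset.mem_powerset.2 hts, hcard⟩⟩) ?_
          -- If the combination lay in `A i`, solving for the new point, whose coefficient is
          -- nonzero, would put it in one of the avoided spans.
          have h1 : w a • c ∈ (A i).restrictScalars ℝ ⊔
              Submodule.span ℝ (v '' (t.erase a : Finset κ)) := by
            rw [← add_sub_cancel_right (w a • c) (∑ k ∈ t.erase a, w k • v k)]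
            refine Submodule.sub_mem _ (Submodule.mem_sup_left hmem) (Submodule.mem_sup_right ?_)
            exact Submodule.sum_mem _ fun k hk =>
              Submodule.smul_mem _ _ (Submodule.subset_span ⟨k, hk, rfl⟩)
          exact (Submodule.smul_mem_iff _ hwa).1 h1
      · have hts : t ⊆ s := (Finset.subset_insert_iff_of_notMem hat).1 ht
        rw [hsum _ hts] at hmem
        exact hv t hts htc w ⟨k, hk, hwk⟩ i hmem

/-- The complement of a finite union of subspaces. -/
def complSubspaces (A : ι → Submodule ℂ E) : Set E := {z | ∀ i, z ∉ A i}

theorem isOpen_complSubspaces : IsOpen (complSubspaces A) := by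
  have : complSubspaces A = ⋂ i, ((A i : Set E))ᶜ := by ext; simp [complSubspaces]
  rw [this]
  exact isOpen_iInter_of_finite fun i => (A i).closed_of_finiteDimensional.isOpen_compl

theorem dense_complSubspaces (hA : ∀ i, A i ≠ ⊤) : Dense (complSubspaces A) := by
  have : complSubspaces A = ⋂ i, ((A i : Set E))ᶜ := by ext; simp [complSubspaces]
  rw [this]
  exact Submodule.dense_iInter_compl hA

/-- A point of the segment in `A i` other than `a` could be solved for `c`, which would lie in the
real span of `A i` and `a`. -/
theorem segment_subset_complSubspaces {E ι : Type*} [NormedAddCommGroup E] [NormedSpace ℂ E]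
    {A : ι → Submodule ℂ E} {a c : E} (ha : a ∈ complSubspaces A)
    (hc : ∀ i, c ∉ (A i).restrictScalars ℝ ⊔ Submodule.span ℝ {a}) :
    segment ℝ a c ⊆ complSubspaces A := by
  rintro _ ⟨x, y, hx, hy, hxy, rfl⟩ i hi
  by_cases hy0 : y = 0
  · obtain rfl : x = 1 := by linarith
    subst hy0
    exact ha i (by simpa using hi)
  · refine hc i ((Submodule.smul_mem_iff _ hy0).1 ?_)
    rw [← add_sub_cancel_left (x • a) (y • c)]
    exact Submodule.sub_mem _ (Submodule.mem_sup_left hi) (Submodule.mem_sup_right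
      (Submodule.smul_mem _ _ (Submodule.mem_span_singleton_self a)))

/-- Two points are joined by two segments through a third point chosen generically. A proper complex
subspace has real codimension at least two, so it remains proper after adding the real line through
either point. -/
theorem isPreconnected_convex_inter_complSubspaces (hA : ∀ i, A i ≠ ⊤) {V : Set E}
    (hV : IsOpen V) (hVc : Convex ℝ V) : IsPreconnected (V ∩ complSubspaces A) := by
  have : FiniteDimensional ℝ E := FiniteDimensional.complexToReal E
  refine isPreconnected_of_forall_pair fun a ha b hb => ?_
  have key : ∀ q : ι × Bool, (A q.1).restrictScalars ℝ ⊔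
      Submodule.span ℝ {if q.2 then a else b} ≠ ⊤ := by
    rintro ⟨i, q⟩
    have := Submodule.real_sup_span_ne_top (W := A i) (t := ({()} : Finset Unit))
      (fun _ => if q then a else b) (by
        have := Submodule.finrank_lt (hA i)
        simp only [Finset.card_singleton]
        omega)
    simpa using this
  obtain ⟨c, hc, hcV⟩ := (Submodule.dense_iInter_compl key).exists_mem_open hV ⟨a, ha.1⟩
  rw [Set.mem_iInter] at hc
  refine ⟨segment ℝ a c ∪ segment ℝ b c, Set.union_subset ?_ ?_,
    Or.inl (left_mem_segment ℝ a c), Or.inr (left_mem_segment ℝ b c), ?_⟩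
  · exact Set.subset_inter (hVc.segment_subset ha.1 hcV)
      (segment_subset_complSubspaces ha.2 fun i => by simpa using hc (i, true))
  · exact Set.subset_inter (hVc.segment_subset hb.1 hcV)
      (segment_subset_complSubspaces hb.2 fun i => by simpa using hc (i, false))
  · exact (convex_segment a c).isPreconnected.union c (right_mem_segment ℝ a c)
      (right_mem_segment ℝ b c) (convex_segment b c).isPreconnected

theorem subset_closure_inter_complSubspaces (hA : ∀ i, A i ≠ ⊤) {D : Set E} (hD : IsOpen D) :
    D ⊆ closure (D ∩ complSubspaces A) :=
  (dense_complSubspaces hA).open_subset_closure_inter hD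

/-- The convex case, applied to balls, gives local connectedness relative to `D`; density of the
complement passes from there to all of `D`. -/
theorem isPreconnected_inter_complSubspaces (hA : ∀ i, A i ≠ ⊤) {D : Set E}
    (hD : IsOpen D) (hDc : IsPreconnected D) : IsPreconnected (D ∩ complSubspaces A) := by
  refine isPreconnected_of_dense_of_locally hDc Set.inter_subset_left
    (subset_closure_inter_complSubspaces hA hD) fun x hx => ?_
  obtain ⟨ε, hε, hb⟩ := Metric.isOpen_iff.1 hD x hx
  refine ⟨Metric.ball x ε, Metric.ball_mem_nhds x hε, ?_⟩
  rw [← Set.inter_assoc, Set.inter_eq_left.2 hb]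
  exact isPreconnected_convex_inter_complSubspaces hA Metric.isOpen_ball (convex_ball x ε)

end GenericPoints

/-! ### Products of path classes along the rows of a grid. -/

section Ladder

open Path.Homotopic

variable {Y : Type*} [TopologicalSpace Y]

/-- The product of a sequence of composable path classes. -/
noncomputable def chainClass {u : ℕ → Y} (e : ∀ i, Path.Homotopic.Quotient (u i) (u (i + 1))) :
    ∀ n, Path.Homotopic.Quotient (u 0) (u n)
  | 0 => .refl _
  | n + 1 => (chainClass e n).trans (e n)

/-- Commuting squares placed side by side give a commuting rectangle. This moves a path class from
one row of a grid to the next. -/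
theorem chainClass_ladder {u v : ℕ → Y} (e : ∀ i, Path.Homotopic.Quotient (u i) (u (i + 1)))
    (e' : ∀ i, Path.Homotopic.Quotient (v i) (v (i + 1)))
    (f : ∀ i, Path.Homotopic.Quotient (u i) (v i)) (n : ℕ)
    (h : ∀ i < n, (e i).trans (f (i + 1)) = (f i).trans (e' i)) :
    (chainClass e n).trans (f n) = (f 0).trans (chainClass e' n) := by
  induction n with
  | zero => simp [chainClass]
  | succ n ih =>
    rw [chainClass, chainClass, Quotient.trans_assoc, h n n.lt_succ_self, ← Quotient.trans_assoc,
      ih fun i hi => h i (hi.trans n.lt_succ_self), Quotient.trans_assoc]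

theorem chainClass_subpath {a b : Y} (γ : Path a b) (t : ℕ → unitInterval) (n : ℕ) :
    chainClass (u := fun i => γ (t i)) (fun i => .mk (γ.subpath (t i) (t (i + 1)))) n =
      .mk (γ.subpath (t 0) (t n)) := by
  induction n with
  | zero => rw [chainClass, Path.subpath_self, Quotient.mk_refl]
  | succ n ih =>
    rw [chainClass, ih, ← Quotient.mk_trans]
    exact Quotient.eq.2 ⟨Path.Homotopy.subpathTransSubpath γ _ _ _⟩

end Ladder

/-! ### Straight segments in a subset of a normed space. -/

section Segments

variable {E : Type*} [NormedAddCommGroup E] [NormedSpace ℝ E] {S : Set E}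

/-- Two paths in `S` with the same ends that lie in a convex subset of `S` are homotopic. -/
theorem Path.homotopic_of_convex {C : Set E} (hC : Convex ℝ C) (hCS : C ⊆ S) {a b : S}
    (γ γ' : Path a b) (h : ∀ t, (γ t : E) ∈ C) (h' : ∀ t, (γ' t : E) ∈ C) : γ.Homotopic γ' := by
  refine ⟨⟨⟨⟨fun p => ⟨AffineMap.lineMap (γ p.2 : E) (γ' p.2 : E) (p.1 : ℝ),
    hCS (hC.lineMap_mem (h _) (h' _) p.1.2)⟩, ?_⟩, ?_, ?_⟩, ?_⟩⟩
  · refine Continuous.subtype_mk ?_ _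
    simp only [AffineMap.lineMap_apply]
    fun_prop
  · intro t; simp
  · intro t; simp
  · rintro s t (rfl | rfl) <;> simp

/-- The class of the segment from `a` to `b`, if it lies in `S`, and of any path otherwise. -/
noncomputable def segmentClass [PathConnectedSpace S] (a b : S) :
    Path.Homotopic.Quotient a b :=
  open Classical in
  if h : segment ℝ (a : E) b ⊆ S then
    .mk ⟨⟨fun t => ⟨AffineMap.lineMap (a : E) (b : E) (t : ℝ),
        h (segment_eq_image_lineMap ℝ (a : E) b ▸ ⟨t, t.2, rfl⟩)⟩, by
          refine Continuous.subtype_mk ?_ _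
          simp only [AffineMap.lineMap_apply]
          fun_prop⟩, by simp, by simp⟩
  else .mk (PathConnectedSpace.somePath a b)

/-- Straight-line homotopy inside the convex set, which in particular contains the segment, so that
the default value in the definition does not occur. -/
theorem segmentClass_eq_mk [PathConnectedSpace S] {a b : S} {C : Set E} (hC : Convex ℝ C)
    (hCS : C ⊆ S) (γ : Path a b) (h : ∀ t, (γ t : E) ∈ C) : segmentClass a b = .mk γ := by
  have ha : (a : E) ∈ C := by simpa using h 0
  have hb : (b : E) ∈ C := by simpa using h 1
  have hs : segment ℝ (a : E) b ⊆ S := (hC.segment_subset ha hb).trans hCS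
  rw [segmentClass, dif_pos hs]
  exact Path.Homotopic.Quotient.eq.2
    (Path.homotopic_of_convex hC hCS _ _ (fun t => hC.lineMap_mem ha hb t.2) h)

theorem segmentClass_trans [PathConnectedSpace S] {a b c : S} {C : Set E} (hC : Convex ℝ C)
    (hCS : C ⊆ S) (ha : (a : E) ∈ C) (hb : (b : E) ∈ C) (hc : (c : E) ∈ C) :
    (segmentClass a b).trans (segmentClass b c) = segmentClass a c := by
  have key : ∀ x y : S, (x : E) ∈ C → (y : E) ∈ C → ∃ γ : Path x y, ∀ t, (γ t : E) ∈ C := by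
    intro x y hx hy
    refine ⟨⟨⟨fun t => ⟨AffineMap.lineMap (x : E) (y : E) (t : ℝ),
        hCS (hC.lineMap_mem hx hy t.2)⟩, by
          refine Continuous.subtype_mk ?_ _
          simp only [AffineMap.lineMap_apply]
          fun_prop⟩, by simp, by simp⟩, fun t => hC.lineMap_mem hx hy t.2⟩
  obtain ⟨γ, hγ⟩ := key a b ha hb
  obtain ⟨γ', hγ'⟩ := key b c hb hc
  rw [segmentClass_eq_mk hC hCS γ hγ, segmentClass_eq_mk hC hCS γ' hγ', 
    ← Path.Homotopic.Quotient.mk_trans, segmentClass_eq_mk hC hCS (γ.trans γ')]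
  intro t
  rw [Path.trans_apply]
  split_ifs
  exacts [hγ _, hγ' _]

theorem segmentClass_square [PathConnectedSpace S] {a b c d : S} {C : Set E} (hC : Convex ℝ C)
    (hCS : C ⊆ S) (ha : (a : E) ∈ C) (hb : (b : E) ∈ C) (hc : (c : E) ∈ C) (hd : (d : E) ∈ C) :
    (segmentClass a b).trans (segmentClass b d) = (segmentClass a c).trans (segmentClass c d) := by
  rw [segmentClass_trans hC hCS ha hb hd, segmentClass_trans hC hCS ha hc hd]

end Segments

/-! ### Removing subspaces of codimension two preserves simple connectedness. -/

section SimplyConnected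

variable {E : Type*} [NormedAddCommGroup E] [NormedSpace ℂ E] {ι : Type*}
  {A : ι → Submodule ℂ E}

theorem ne_top_of_finrank_add_two_le (hA : ∀ i, Module.finrank ℂ (A i) + 2 ≤ Module.finrank ℂ E)
    (i : ι) : A i ≠ ⊤ := by
  intro h
  have := hA i
  rw [h, finrank_top] at this
  omega

/-- The barycentric coordinates of a point of the triangle form a nonzero real combination of three
points, which general position keeps outside every `A i`. -/
theorem convexHull_triple_subset_complSubspaces {κ : Type*} [DecidableEq κ] {s : Finset κ}
    {v : κ → E} (hv : ∀ t ⊆ s, t.card ≤ 3 → ∀ w : κ → ℝ,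
      (∃ k ∈ t, w k ≠ 0) → ∀ i, ∑ k ∈ t, w k • v k ∉ A i) {a b c : κ} (ha : a ∈ s) (hb : b ∈ s)
    (hc : c ∈ s) (hab : a ≠ b) (hac : a ≠ c) (hbc : b ≠ c) :
    convexHull ℝ {v a, v b, v c} ⊆ complSubspaces A := by
  intro x hx i hxi
  rw [convexHull_insert (by simp)] at hx
  rw [convexHull_pair, mem_convexJoin] at hx
  obtain ⟨_, rfl, y, ⟨p, q, hp, hq, hpq, rfl⟩, r, u, hr, hu, hru, rfl⟩ := hx
  let w : κ → ℝ := fun k => if k = a then r else if k = b then u * p else u * q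
  have hsum : ∑ k ∈ {a, b, c}, w k • v k = r • v a + u • (p • v b + q • v c) := by
    rw [Finset.sum_insert (by simp [hab, hac]), Finset.sum_pair hbc]
    simp only [w, if_true, if_neg hab.symm, if_neg hac.symm, if_neg hbc.symm, smul_add, mul_smul]
  refine hv {a, b, c} ?_ Finset.card_le_three w ?_ i (hsum ▸ hxi)
  · intro k hk
    simp only [Finset.mem_insert, Finset.mem_singleton] at hk
    rcases hk with rfl | rfl | rfl <;> assumption
  · by_contra! h
    have h1 := h a (by simp)
    have h2 := h b (by simp)
    have h3 := h c (by simp)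
    simp only [w, if_true, if_neg hab.symm, if_neg hac.symm, if_neg hbc.symm] at h1 h2 h3
    have : u * p + u * q = 0 := by rw [h2, h3, add_zero]
    rw [← mul_add, hpq, mul_one] at this
    linarith

variable [FiniteDimensional ℂ E] [Finite ι]

theorem pathConnectedSpace_inter_complSubspaces (hA : ∀ i, A i ≠ ⊤) {D : Set E} (hD : IsOpen D)
    (hDc : IsConnected D) : PathConnectedSpace ↥(D ∩ complSubspaces A) := by
  have : LocallyPathConnectedSpace ↥(D ∩ complSubspaces A) :=
    (hD.inter isOpen_complSubspaces).locallyPathConnectedSpace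
  have : ConnectedSpace ↥(D ∩ complSubspaces A) := by
    refine isConnected_iff_connectedSpace.1 ⟨?_,
      isPreconnected_inter_complSubspaces hA hD hDc.isPreconnected⟩
    obtain ⟨x, hx, hxD⟩ := (dense_complSubspaces hA).exists_mem_open hD hDc.nonempty
    exact ⟨x, hxD, hx⟩
  exact PathConnectedSpace.of_locallyPathConnectedSpace

/-- Paths that avoid finitely many complex subspaces of codimension at least two are homotopic in
the complement of these as soon as they are homotopic. -/
theorem homotopic_in_complSubspaces (hA : ∀ i, Module.finrank ℂ (A i) + 2 ≤ Module.finrank ℂ E)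
    {D : Set E} (hD : IsOpen D) (hDc : IsConnected D) {x₀ x₁ : ↥(D ∩ complSubspaces A)}
    (γ₀ γ₁ : Path x₀ x₁) (F : C(unitInterval × unitInterval, E)) (hF : ∀ p, F p ∈ D)
    (h0 : ∀ t, F (0, t) = γ₀ t) (h1 : ∀ t, F (1, t) = γ₁ t) (hx₀ : ∀ s, F (s, 0) = x₀)
    (hx₁ : ∀ s, F (s, 1) = x₁) : γ₀.Homotopic γ₁ := by
  classical
  have hA' := ne_top_of_finrank_add_two_le hA
  have hpc := pathConnectedSpace_inter_complSubspaces hA' hD hDc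
  have hS : IsOpen (D ∩ complSubspaces A) := hD.inter isOpen_complSubspaces
  obtain ⟨δ, hδ, hδD⟩ := (isCompact_range F.continuous).exists_thickening_subset_open hD
    (Set.range_subset_iff.2 hF)
  obtain ⟨δ', hδ', hδS⟩ := ((isCompact_range (continuous_subtype_val.comp γ₀.continuous)).union
    (isCompact_range (continuous_subtype_val.comp γ₁.continuous))).exists_thickening_subset_open hS
    (Set.union_subset (Set.range_subset_iff.2 fun t => (γ₀ t).2)
      (Set.range_subset_iff.2 fun t => (γ₁ t).2))
  -- Grid vertices are chosen within ε of their image under `F`, and each cell is mapped into an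
  -- ε-ball, so the vertices of a cell lie in a 2ε-ball. Along the two boundary paths, a ball of
  -- radius 3ε about a point of the path contains this 2ε-ball.
  set ε := min δ δ' / 3 with hεdef
  have hε : 0 < ε := by positivity
  have hballD : ∀ p, Metric.ball (F p) (2 * ε) ⊆ D := fun p =>
    ((Metric.ball_subset_ball (by linarith [min_le_left δ δ'])).trans
      (Metric.ball_subset_thickening (Set.mem_range_self p) δ)).trans hδD
  have hballS : ∀ y : E, y ∈ Set.range (Subtype.val ∘ γ₀) ∪ Set.range (Subtype.val ∘ γ₁) →
      Metric.ball y (3 * ε) ⊆ D ∩ complSubspaces A := fun y hy =>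
    ((Metric.ball_subset_ball (by linarith [min_le_right δ δ'])).trans
      (Metric.ball_subset_thickening hy δ')).trans hδS
  obtain ⟨t, ht0, htm, ⟨n, htn⟩, hcell⟩ :=
    exists_monotone_Icc_subset_open_cover_unitInterval_prod_self
      (c := fun p : unitInterval × unitInterval => F ⁻¹' Metric.ball (F p) ε)
      (fun p => Metric.isOpen_ball.preimage F.continuous)
      (fun p _ => Set.mem_iUnion.2 ⟨p, Metric.mem_ball_self hε⟩)
  -- The subdivision is constant from `n` on. Indices are truncated at `n` so that the vertices are
  -- defined for all naturals while general position is needed for finitely many only.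
  have htmin : ∀ j, t (min j n) = t j := fun j => by
    rcases le_total j n with h | h
    · rw [min_eq_left h]
    · rw [min_eq_right h, htn n le_rfl, htn j h]
  obtain ⟨v, hvO, hv⟩ := exists_generic_points hA (Finset.range (n + 1) ×ˢ Finset.range (n + 1))
    (fun k : ℕ × ℕ => Metric.ball (F (t k.1, t k.2)) ε) (fun _ => Metric.isOpen_ball)
    (fun k => ⟨_, Metric.mem_ball_self hε⟩)
  have hmem : ∀ {j i}, j ≤ n → i ≤ n →
      ((j, i) : ℕ × ℕ) ∈ Finset.range (n + 1) ×ˢ Finset.range (n + 1) := fun hj hi => by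
    simp only [Finset.mem_product, Finset.mem_range]
    omega
  have hvS : ∀ j i, v (min j n, min i n) ∈ D ∩ complSubspaces A := by
    refine fun j i => ⟨hballD _ (Metric.ball_subset_ball (by linarith) (hvO _)), fun l hl => ?_⟩
    refine hv {(min j n, min i n)} (Finset.singleton_subset_iff.2
      (hmem (min_le_right _ _) (min_le_right _ _))) (by simp) (fun _ => 1) (by simp) l ?_
    simpa using hl
  let P : ℕ → ℕ → ↥(D ∩ complSubspaces A) := fun j i => ⟨v (min j n, min i n), hvS j i⟩
  have hP : ∀ j i, dist (P j i : E) (F (t j, t i)) < ε := fun j i => by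
    have := hvO (min j n, min i n)
    simpa only [htmin, Metric.mem_ball] using this
  have hPv : ∀ {j i}, j ≤ n → i ≤ n → (P j i : E) = v (j, i) := fun hj hi => by
    simp only [P, min_eq_left hj, min_eq_left hi]
  have near : ∀ {j i : ℕ} {c y : E}, dist (F (t j, t i)) c < ε → (P j i : E) ∈ Metric.ball c (2 * ε) :=
    fun {j i c y} h => by
      rw [Metric.mem_ball]
      linarith [dist_triangle (P j i : E) (F (t j, t i)) c, hP j i]
  have hsq : ∀ j < n, ∀ i < n,
      (segmentClass (P j i) (P j (i + 1))).trans (segmentClass (P j (i + 1)) (P (j + 1) (i + 1))) =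
      (segmentClass (P j i) (P (j + 1) i)).trans
        (segmentClass (P (j + 1) i) (P (j + 1) (i + 1))) := by
    intro j hj i hi
    obtain ⟨p, hp⟩ := hcell j i
    have hF' : ∀ {j' i'}, (j' = j ∨ j' = j + 1) → (i' = i ∨ i' = i + 1) →
        (P j' i' : E) ∈ Metric.ball (F p) (2 * ε) := fun {j' i'} hj' hi' => by
      refine near (y := 0) (hp ⟨?_, ?_⟩)
      · rcases hj' with rfl | rfl
        exacts [⟨le_rfl, htm (Nat.le_succ _)⟩, ⟨htm (Nat.le_succ _), le_rfl⟩]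
      · rcases hi' with rfl | rfl
        exacts [⟨le_rfl, htm (Nat.le_succ _)⟩, ⟨htm (Nat.le_succ _), le_rfl⟩]
    -- Each cell is cut along its diagonal. Both triangles lie in `D` by the choice of ε and avoid
    -- the subspaces by general position, so either way round the cell is the class of the diagonal.
    have tri : ∀ {j₁ i₁ : ℕ}, (j₁ = j ∧ i₁ = i + 1 ∨ j₁ = j + 1 ∧ i₁ = i) →
        (segmentClass (P j i) (P j₁ i₁)).trans (segmentClass (P j₁ i₁) (P (j + 1) (i + 1))) =
        segmentClass (P j i) (P (j + 1) (i + 1)) := by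
      intro j₁ i₁ hji
      refine segmentClass_trans (convex_convexHull ℝ
        {(P j i : E), (P j₁ i₁ : E), (P (j + 1) (i + 1) : E)}) (Set.subset_inter ?_ ?_)
        (subset_convexHull _ _ (by simp)) (subset_convexHull _ _ (by simp))
        (subset_convexHull _ _ (by simp))
      · refine (convexHull_min ?_ (convex_ball _ _)).trans (hballD p)
        rintro _ (rfl | rfl | rfl)
        · exact hF' (by simp) (by simp)
        · exact hF' (by omega) (by omega)
        · exact hF' (by simp) (by simp)
      · rw [hPv hj.le hi.le, hPv (by omega) (by omega), hPv hj hi]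
        refine convexHull_triple_subset_complSubspaces hv (hmem hj.le hi.le)
          (hmem (by omega) (by omega)) (hmem hj hi) ?_ ?_ ?_ <;>
        · simp only [ne_eq, Prod.mk.injEq]
          omega
    rw [tri (by simp), tri (by simp)]
  -- Comparison of a boundary path with the polygonal row of vertices next to it. All the squares
  -- involved lie in balls contained in the complement.
  have hrow : ∀ (k : unitInterval) (j : ℕ) (γ : Path x₀ x₁), t j = k → (∀ s, F (k, s) = γ s) →
      (∀ s, (γ s : E) ∈ Set.range (Subtype.val ∘ γ₀) ∪ Set.range (Subtype.val ∘ γ₁)) →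
      (Path.Homotopic.Quotient.mk (γ.subpath (t 0) (t n))).trans
        (segmentClass (γ (t n)) (P j n)) = (segmentClass (γ (t 0)) (P j 0)).trans
          (chainClass (u := P j) (fun i => segmentClass (P j i) (P j (i + 1))) n) := by
    rintro _ j γ rfl hγ hγS
    rw [← chainClass_subpath γ t n]
    refine chainClass_ladder _ _ (fun i => segmentClass (γ (t i)) (P j i)) n fun i _ => ?_
    obtain ⟨p, hp⟩ := hcell j i
    have hin : ∀ s ∈ Set.Icc (t i) (t (i + 1)), dist (γ s : E) (F p) < ε := fun s hs => by
      rw [← hγ s]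
      exact hp (Set.mk_mem_prod ⟨le_rfl, htm (Nat.le_succ _)⟩ hs)
    have hl : t i ∈ Set.Icc (t i) (t (i + 1)) := ⟨le_rfl, htm (Nat.le_succ _)⟩
    have hr : t (i + 1) ∈ Set.Icc (t i) (t (i + 1)) := ⟨htm (Nat.le_succ _), le_rfl⟩
    have hC : Metric.ball (F p) (2 * ε) ⊆ D ∩ complSubspaces A := by
      refine subset_trans (fun y hy => ?_) (hballS _ (hγS (t i)))
      rw [Metric.mem_ball] at hy ⊢
      linarith [dist_triangle_right y (γ (t i) : E) (F p), hin _ hl]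
    have hball : ∀ s ∈ Set.Icc (t i) (t (i + 1)), (γ s : E) ∈ Metric.ball (F p) (2 * ε) :=
      fun s hs => Metric.ball_subset_ball (by linarith) (hin s hs)
    rw [← segmentClass_eq_mk (convex_ball (F p) (2 * ε)) hC (γ.subpath (t i) (t (i + 1)))]
    · refine segmentClass_square (convex_ball (F p) (2 * ε)) hC (hball _ hl) (hball _ hr) ?_ ?_
      · exact near (y := 0) (by rw [hγ]; exact hin _ hl)
      · exact near (y := 0) (by rw [hγ]; exact hin _ hr)
    · intro s
      have : γ.subpath (t i) (t (i + 1)) s ∈ Set.range (γ.subpath (t i) (t (i + 1))) := ⟨s, rfl⟩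
      rw [Path.range_subpath_of_le _ _ _ (htm (Nat.le_succ _))] at this
      obtain ⟨s', hs', hs''⟩ := this
      rw [← hs'']
      exact hball _ hs'
  -- On the two sides where `F` is constant, the vertices stay in a ball about the common end point
  -- that lies in the complement, so the segments from that point form a fan of contractible
  -- triangles.
  have hcol : ∀ (k : unitInterval) (i : ℕ) (x : ↥(D ∩ complSubspaces A)), t i = k →
      (∀ s, F (s, k) = x) →
      (x : E) ∈ Set.range (Subtype.val ∘ γ₀) ∪ Set.range (Subtype.val ∘ γ₁) → ∀ j,
      (segmentClass x (P j i)).trans (segmentClass (P j i) (P (j + 1) i)) =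
        segmentClass x (P (j + 1) i) := by
    rintro _ i x rfl hx hxS j
    refine segmentClass_trans (convex_ball (x : E) (3 * ε)) (hballS _ hxS)
      (Metric.mem_ball_self (by positivity)) ?_ ?_
    · have := hP j i
      rw [hx] at this
      exact Metric.ball_subset_ball (by linarith) this
    · have := hP (j + 1) i
      rw [hx] at this
      exact Metric.ball_subset_ball (by linarith) this
  have hγ₀S : ∀ s, (γ₀ s : E) ∈ Set.range (Subtype.val ∘ γ₀) ∪ Set.range (Subtype.val ∘ γ₁) :=
    fun s => Or.inl ⟨s, rfl⟩
  have hγ₁S : ∀ s, (γ₁ s : E) ∈ Set.range (Subtype.val ∘ γ₀) ∪ Set.range (Subtype.val ∘ γ₁) :=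
    fun s => Or.inr ⟨s, rfl⟩
  have hc0 := hcol 0 0 x₀ ht0 hx₀ (by simpa using hγ₀S 0)
  have hc1 := hcol 1 n x₁ (htn n le_rfl) hx₁ (by simpa using hγ₀S 1)
  have hr0 := hrow 0 0 γ₀ ht0 h0 hγ₀S
  have hr1 := hrow 1 n γ₁ (htn n le_rfl) h1 hγ₁S
  -- The ends of the subpath over the whole interval equal `x₀` and `x₁` only propositionally; this
  -- removes the resulting casts.
  have hends : ∀ (γ : Path x₀ x₁) (j : ℕ) (τ₀ τ₁ : unitInterval), τ₀ = 0 → τ₁ = 1 →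
      ∀ {a b : ↥(D ∩ complSubspaces A)} (R : Path.Homotopic.Quotient a b),
      ((Path.Homotopic.Quotient.mk (γ.subpath τ₀ τ₁)).trans (segmentClass (γ τ₁) b) =
        (segmentClass (γ τ₀) a).trans R ↔
      (Path.Homotopic.Quotient.mk γ).trans (segmentClass x₁ b) = (segmentClass x₀ a).trans R) := by
    rintro γ j _ _ rfl rfl a b R
    rw [Path.subpath_zero_one]
    have e0 := γ.source
    have e1 := γ.target
    have aux : ∀ {y₀ y₁ : ↥(D ∩ complSubspaces A)} (e0 : y₀ = x₀) (e1 : y₁ = x₁),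
        ((Path.Homotopic.Quotient.mk (γ.cast e0 e1)).trans (segmentClass y₁ b) =
          (segmentClass y₀ a).trans R ↔
        (Path.Homotopic.Quotient.mk γ).trans (segmentClass x₁ b) =
          (segmentClass x₀ a).trans R) := by
      rintro _ _ rfl rfl
      exact Iff.rfl
    exact aux e0 e1
  rw [hends γ₀ 0 _ _ ht0 (htn n le_rfl)] at hr0
  rw [hends γ₁ n _ _ ht0 (htn n le_rfl)] at hr1
  have hall : ∀ j ≤ n, (Path.Homotopic.Quotient.mk γ₀).trans (segmentClass x₁ (P j n)) =
      (segmentClass x₀ (P j 0)).trans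
        (chainClass (u := P j) (fun i => segmentClass (P j i) (P j (i + 1))) n) := by
    intro j hj
    induction j with
    | zero => exact hr0
    | succ j ih =>
      have hlad := chainClass_ladder (u := P j) (v := P (j + 1))
        (fun i => segmentClass (P j i) (P j (i + 1)))
        (fun i => segmentClass (P (j + 1) i) (P (j + 1) (i + 1)))
        (fun i => segmentClass (P j i) (P (j + 1) i)) n (hsq j hj)
      rw [← hc1 j, ← Path.Homotopic.Quotient.trans_assoc, ih (by omega),
        Path.Homotopic.Quotient.trans_assoc, hlad, ← Path.Homotopic.Quotient.trans_assoc, hc0 j]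
  -- Sweeping through all rows gives equality after composition with one and the same last segment,
  -- which is then cancelled.
  have hfin := (hall n le_rfl).trans hr1.symm
  have := congrArg (fun q => q.trans (segmentClass x₁ (P n n)).symm) hfin
  simp only [Path.Homotopic.Quotient.trans_assoc, Path.Homotopic.Quotient.trans_symm,
    Path.Homotopic.Quotient.trans_refl] at this
  exact Path.Homotopic.Quotient.eq.1 this

theorem simplyConnectedSpace_inter_complSubspaces
    (hA : ∀ i, Module.finrank ℂ (A i) + 2 ≤ Module.finrank ℂ E) {D : Set E} (hD : IsOpen D)
    (hDc : SimplyConnectedSpace D) : SimplyConnectedSpace ↥(D ∩ complSubspaces A) := by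
  have hconn : IsConnected D := isConnected_iff_connectedSpace.2 inferInstance
  rw [simply_connected_iff_paths_homotopic']
  refine ⟨pathConnectedSpace_inter_complSubspaces (ne_top_of_finrank_add_two_le hA) hD hconn,
    fun {x y} γ₀ γ₁ => ?_⟩
  let j : C(↥(D ∩ complSubspaces A), D) :=
    ⟨Set.inclusion Set.inter_subset_left, continuous_inclusion _⟩
  obtain ⟨H⟩ := SimplyConnectedSpace.paths_homotopic (γ₀.map j.continuous) (γ₁.map j.continuous)
  refine homotopic_in_complSubspaces hA hD hconn γ₀ γ₁
    ((⟨Subtype.val, continuous_subtype_val⟩ : C(D, E)).comp H.toContinuousMap)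
    (fun p => (H p).2) ?_ ?_ ?_ ?_
  · intro t; simp [j]
  · intro t; simp [j]
  · intro s; simp [j]
  · intro s; simp [j]

end SimplyConnected

/-! ### Cauchy's formula on polydiscs and Osgood's lemma. -/

section Osgood

open MeasureTheory Real

/-- Integration of continuous functions on a compact set against a continuous weight. -/
noncomputable def weightedIntegralCLM {m : ℕ} (K : Set (Fin m → ℝ)) (hK : IsCompact K)
    (h : C(K, ℂ)) : C(K, ℂ) →L[ℂ] ℂ :=
  haveI : CompactSpace K := isCompact_iff_compactSpace.1 hK
  let μ : Measure K := (volume : Measure (Fin m → ℝ)).comap Subtype.val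
  haveI : IsFiniteMeasure μ :=
    ⟨by
      rw [(MeasurableEmbedding.subtype_coe hK.measurableSet).comap_apply, Set.image_univ,
        Subtype.range_coe]
      exact hK.measure_lt_top⟩
  have hint : ∀ φ : C(K, ℂ), Integrable (fun x : K => h x * φ x) μ := fun φ =>
    Integrable.of_bound (Continuous.aestronglyMeasurable (by fun_prop)) (‖h * φ‖)
      (Filter.Eventually.of_forall fun x => (h * φ).norm_coe_le_norm x)
  LinearMap.mkContinuous
    { toFun := fun φ => ∫ x : K, h x * φ x ∂μ
      map_add' := fun φ ψ => by
        rw [← integral_add (hint φ) (hint ψ)]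
        simp [mul_add]
      map_smul' := fun a φ => by
        rw [RingHom.id_apply, smul_eq_mul, ← integral_const_mul]
        simp [mul_left_comm] }
    (‖h‖ * μ.real Set.univ) fun φ => by
      refine (norm_integral_le_of_norm_le_const (C := ‖h‖ * ‖φ‖) (Filter.Eventually.of_forall
        fun x => ?_)).trans (le_of_eq (by ring))
      rw [norm_mul]
      exact mul_le_mul (h.norm_coe_le_norm x) (φ.norm_coe_le_norm x) (norm_nonneg _)
        (norm_nonneg _)

theorem weightedIntegralCLM_apply {m : ℕ} (K : Set (Fin m → ℝ)) (hK : IsCompact K)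
    (h φ : C(K, ℂ)) : weightedIntegralCLM K hK h φ =
      ∫ x : K, h x * φ x ∂(volume : Measure (Fin m → ℝ)).comap Subtype.val := rfl

variable {n : ℕ}

theorem torusMap_mem_closedBall (c : Fin n → ℂ) {R : ℝ} (hR : 0 ≤ R) (θ : Fin n → ℝ) :
    torusMap c (fun _ => R) θ ∈ Metric.closedBall c R := by
  rw [mem_closedBall_iff_norm, pi_norm_le_iff_of_nonneg hR]
  intro i
  simp [torusMap, Complex.norm_exp_ofReal_mul_I, abs_of_nonneg hR]

theorem torusMap_sub_ne_zero (c z : Fin n → ℂ) {R : ℝ} (hz : z ∈ Metric.ball c R)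
    (θ : Fin n → ℝ) (i : Fin n) : torusMap c (fun _ => R) θ i - z i ≠ 0 := by
  intro h
  have hR : 0 < R := Metric.pos_of_mem_ball hz
  have h1 : ‖z i - c i‖ < R := by
    rw [mem_ball_iff_norm] at hz
    exact (norm_le_pi_norm (z - c) i).trans_lt hz
  rw [← sub_eq_zero.1 h] at h1
  simp [torusMap, Complex.norm_exp_ofReal_mul_I, abs_of_pos hR] at h1

theorem continuous_torusMap (c : Fin n → ℂ) (R : ℝ) : Continuous (torusMap c fun _ => R) := by
  unfold torusMap
  fun_prop

theorem torusIntegrable_cauchy {c z : Fin n → ℂ} {R : ℝ} (hz : z ∈ Metric.ball c R)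
    {f : (Fin n → ℂ) → ℂ} (hf : ContinuousOn f (Metric.closedBall c R)) :
    TorusIntegrable (fun x => (∏ i, (x i - z i)⁻¹) * f x) c (fun _ => R) := by
  have hR : 0 < R := Metric.pos_of_mem_ball hz
  refine Continuous.integrableOn_Icc ?_
  refine Continuous.mul (continuous_finsetProd _ fun i _ => Continuous.inv₀ ?_
    fun θ => torusMap_sub_ne_zero c z hz θ i) ?_
  · have := continuous_torusMap c R
    fun_prop
  · exact hf.comp_continuous (continuous_torusMap c R) (torusMap_mem_closedBall c hR.le)

/-- Cauchy's integral formula on a polydisc, for continuous functions that are holomorphic in each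
variable up to countably many points. -/
theorem torusIntegral_cauchy {c z : Fin n → ℂ} {R : ℝ} (hz : z ∈ Metric.ball c R)
    {f : (Fin n → ℂ) → ℂ} (hf : ContinuousOn f (Metric.closedBall c R))
    (hd : ∀ x ∈ Metric.closedBall c R, ∀ i, ∃ S : Set ℂ, S.Countable ∧
      ∀ ζ ∈ Metric.ball (c i) R \ S, DifferentiableAt ℂ (fun ζ => f (Function.update x i ζ)) ζ) :
    torusIntegral (fun x => (∏ i, (x i - z i)⁻¹) * f x) c (fun _ => R) =
      (2 * π * Complex.I : ℂ) ^ n * f z := by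
  induction n with
  | zero =>
    rw [torusIntegral_dim0]
    simp [Subsingleton.elim c z]
  | succ n ih =>
    have hR : 0 < R := Metric.pos_of_mem_ball hz
    have hcons : ∀ {x : ℂ} {y : Fin n → ℂ}, x ∈ Metric.closedBall (c 0) R →
        y ∈ Metric.closedBall (c ∘ Fin.succ) R →
        (Fin.cons x y : Fin (n + 1) → ℂ) ∈ Metric.closedBall c R := by
      intro x y hx hy
      rw [Metric.mem_closedBall, dist_pi_le_iff hR.le] at hy ⊢
      refine Fin.cases hx fun i => ?_
      simpa using hy i
    have hz0 : z 0 ∈ Metric.ball (c 0) R := (dist_le_pi_dist z c 0).trans_lt hz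
    have hzt : z ∘ Fin.succ ∈ Metric.ball (c ∘ Fin.succ) R := by
      rw [Metric.mem_ball, dist_pi_lt_iff hR] at hz ⊢
      exact fun i => hz i.succ
    rw [torusIntegral_succ (torusIntegrable_cauchy hz hf)]
    -- By induction the integral over the last `n` circles evaluates `f` at the last `n` coordinates
    -- of `z`; a one-variable Cauchy integral remains.
    have hinner : ∀ x ∈ Metric.sphere (c 0) R,
        torusIntegral (fun y => (∏ i, ((Fin.cons x y : Fin (n + 1) → ℂ) i - z i)⁻¹) *
          f (Fin.cons x y)) (c ∘ Fin.succ) ((fun _ => R) ∘ Fin.succ) =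
        (x - z 0)⁻¹ • ((2 * π * Complex.I : ℂ) ^ n * f (Fin.cons x (z ∘ Fin.succ))) := by
      intro x hx
      have hx' := Metric.sphere_subset_closedBall hx
      have hI := ih (c := c ∘ Fin.succ) (z := z ∘ Fin.succ) hzt
        (f := fun y => f (Fin.cons x y))
        (hf.comp (Continuous.continuousOn (by fun_prop)) fun y hy => hcons hx' hy)
        (fun y hy i => by
          obtain ⟨S, hS, hS'⟩ := hd _ (hcons hx' hy) i.succ
          refine ⟨S, hS, fun ζ hζ => ?_⟩
          simpa only [Fin.cons_update] using hS' ζ hζ)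
      rw [← hI, smul_eq_mul, ← torusIntegral_const_mul]
      congr 1
      ext y
      rw [Fin.prod_univ_succ]
      simp [mul_assoc]
    rw [circleIntegral.integral_congr hR.le hinner]
    obtain ⟨S, hS, hS'⟩ := hd z (Metric.ball_subset_closedBall hz) 0
    have hupd : ∀ x, Function.update z 0 x = (Fin.cons x (z ∘ Fin.succ) : Fin (n + 1) → ℂ) := by
      intro x
      ext i
      refine Fin.cases ?_ (fun i => ?_) i <;> simp
    have h1 := Complex.circleIntegral_sub_inv_smul_of_differentiable_on_off_countable
      (f := fun x => (2 * π * Complex.I : ℂ) ^ n * f (Fin.cons x (z ∘ Fin.succ))) hS hz0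
      (continuousOn_const.mul (hf.comp (Continuous.continuousOn (by fun_prop)) fun x hx =>
        hcons hx (Metric.ball_subset_closedBall hzt)))
      (fun x hx => by
        have := hS' x hx
        simp only [hupd] at this
        exact this.const_mul _)
    rw [h1]
    have : (Fin.cons (z 0) (z ∘ Fin.succ) : Fin (n + 1) → ℂ) = z := Fin.cons_self_tail z
    rw [this, smul_eq_mul]
    ring

/-- The Cauchy kernel, as a function of `z`, is an analytic map into the Banach algebra of
continuous functions on the parameter cube, since inversion is analytic at units. Integration
against `f` is a continuous linear functional on that algebra, so no differentiation under the
integral sign is needed. -/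
theorem analyticAt_torusIntegral {c : Fin n → ℂ} {R : ℝ} (hR : 0 < R) {f : (Fin n → ℂ) → ℂ}
    (hf : ContinuousOn f (Metric.closedBall c R)) : AnalyticAt ℂ
      (fun z => torusIntegral (fun x => (∏ i, (x i - z i)⁻¹) * f x) c (fun _ => R)) c := by
  let K : Set (Fin n → ℝ) := Set.Icc 0 fun _ => 2 * π
  have hK : IsCompact K := isCompact_Icc
  have : CompactSpace K := isCompact_iff_compactSpace.1 hK
  have hfc : Continuous fun θ => f (torusMap c (fun _ => R) θ) :=
    hf.comp_continuous (continuous_torusMap c R) (torusMap_mem_closedBall c hR.le)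
  have htm := continuous_torusMap c R
  let h : C(K, ℂ) := ⟨fun θ => (∏ i, (R : ℂ) * Complex.exp ((θ : Fin n → ℝ) i * Complex.I) *
    Complex.I) * f (torusMap c (fun _ => R) θ), by
      refine Continuous.mul (continuous_finsetProd _ fun i _ => ?_) (hfc.comp continuous_subtype_val)
      have : Continuous fun θ : K => (θ : Fin n → ℝ) i :=
        (continuous_apply i).comp continuous_subtype_val
      exact (continuous_const.mul (Complex.continuous_exp.comp
        ((Complex.continuous_ofReal.comp this).mul continuous_const))).mul continuous_const⟩
  let T : Fin n → C(K, ℂ) := fun i => ⟨fun θ => torusMap c (fun _ => R) θ i, by fun_prop⟩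
  let Ψ : (Fin n → ℂ) → C(K, ℂ) := fun z => ∏ i, Ring.inverse (T i - algebraMap ℂ C(K, ℂ) (z i))
  have hunit : ∀ z ∈ Metric.ball c R, ∀ i, IsUnit (T i - algebraMap ℂ C(K, ℂ) (z i)) := by
    intro z hz i
    rw [ContinuousMap.isUnit_iff_forall_ne_zero]
    intro θ
    exact torusMap_sub_ne_zero c z hz θ i
  have hΨ : AnalyticAt ℂ Ψ c := by
    refine Finset.analyticAt_fun_prod _ fun i _ => ?_
    obtain ⟨u, hu⟩ := hunit c (Metric.mem_ball_self hR) i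
    refine AnalyticAt.comp (g := Ring.inverse) (f := fun z : Fin n → ℂ =>
      T i - algebraMap ℂ C(K, ℂ) (z i)) ?_ ?_
    · rw [← hu]
      exact analyticAt_inverse u
    · refine analyticAt_const.sub ?_
      exact ((Algebra.linearMap ℂ C(K, ℂ)).toContinuousLinearMap.comp
        (ContinuousLinearMap.proj i)).analyticAt c
  have hinv : ∀ z ∈ Metric.ball c R, ∀ θ : K, Ψ z θ =
      ∏ i, (torusMap c (fun _ => R) θ i - z i)⁻¹ := by
    intro z hz θ
    rw [ContinuousMap.coe_prod, Finset.prod_apply]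
    refine Finset.prod_congr rfl fun i _ => ?_
    have := congrArg (fun g : C(K, ℂ) => g θ) (Ring.inverse_mul_cancel _ (hunit z hz i))
    exact eq_inv_of_mul_eq_one_left this
  refine ((weightedIntegralCLM K hK h).analyticAt _ |>.comp hΨ).congr ?_
  filter_upwards [Metric.ball_mem_nhds c hR] with z hz
  rw [Function.comp_apply, weightedIntegralCLM_apply, torusIntegral,
    ← integral_subtype_comap measurableSet_Icc]
  refine integral_congr_ae (Filter.Eventually.of_forall fun θ => ?_)
  simp only [hinv z hz, h, ContinuousMap.coe_mk, smul_eq_mul]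
  ring

/-- **Osgood's lemma**, with exceptional points. -/
theorem analyticAt_of_separately_off_countable {c : Fin n → ℂ} {R : ℝ} (hR : 0 < R)
    {f : (Fin n → ℂ) → ℂ} (hf : ContinuousOn f (Metric.closedBall c R))
    (hd : ∀ x ∈ Metric.closedBall c R, ∀ i, ∃ S : Set ℂ, S.Countable ∧
      ∀ ζ ∈ Metric.ball (c i) R \ S, DifferentiableAt ℂ (fun ζ => f (Function.update x i ζ)) ζ) :
    AnalyticAt ℂ f c := by
  refine ((analyticAt_const (v := ((2 * π * Complex.I : ℂ) ^ n)⁻¹)).mul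
    (analyticAt_torusIntegral hR hf)).congr ?_
  filter_upwards [Metric.ball_mem_nhds c hR] with z hz
  rw [Pi.mul_apply, torusIntegral_cauchy hz hf hd, inv_mul_cancel_left₀]
  exact pow_ne_zero _ Complex.two_pi_I_ne_zero

end Osgood

/-! ### Riemann extension across subspaces. -/

section RiemannExtension

variable {n : ℕ} {ι : Type*} [Finite ι] {A : ι → Submodule ℂ (Fin n → ℂ)}

/-- The complement of finitely many proper subspaces is dense, hence spans, and a basis can be
extracted from it. In such coordinates every coordinate line meets each `A i` in at most one point,
as the off-countable form of Osgood's lemma requires. -/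
theorem exists_basis_notMem (hA : ∀ i, A i ≠ ⊤) :
    ∃ b : Module.Basis (Fin n) ℂ (Fin n → ℂ), ∀ j i, b j ∉ A i := by
  have hspan : ⊤ ≤ Submodule.span ℂ (complSubspaces A) := by
    have h1 : Dense (Submodule.span ℂ (complSubspaces A) : Set (Fin n → ℂ)) :=
      (dense_complSubspaces hA).mono Submodule.subset_span
    intro x _
    have := h1 x
    rwa [(Submodule.closed_of_finiteDimensional _).closure_eq] at this
  let b₀ := Module.Basis.ofSpan hspan
  have := Module.Finite.finite_basis b₀
  have := Fintype.ofFinite ((linearIndepOn_empty ℂ id).extend (Set.empty_subset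
    (complSubspaces A)))
  have hcard := (Module.finrank_eq_card_basis b₀).symm
  rw [Module.finrank_fin_fun] at hcard
  refine ⟨b₀.reindex (Fintype.equivFinOfCardEq hcard), fun j i => ?_⟩
  rw [Module.Basis.reindex_apply]
  exact Module.Basis.ofSpan_subset hspan (Set.mem_range_self _) i

/-- **Riemann extension theorem** for continuous functions that are holomorphic off finitely many
proper subspaces. -/
theorem analyticAt_of_analyticAt_complSubspaces (hA : ∀ i, A i ≠ ⊤) {V : Set (Fin n → ℂ)}
    (hV : IsOpen V) {F : (Fin n → ℂ) → ℂ} (hc : ContinuousOn F V)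
    (ha : ∀ z ∈ V ∩ complSubspaces A, AnalyticAt ℂ F z) {z : Fin n → ℂ} (hz : z ∈ V) :
    AnalyticAt ℂ F z := by
  obtain ⟨b, hb⟩ := exists_basis_notMem hA
  let e : (Fin n → ℂ) ≃L[ℂ] (Fin n → ℂ) := b.equivFun.symm.toContinuousLinearEquiv
  have he : ∀ x, e x = ∑ i, x i • b i := fun x => b.equivFun_symm_apply x
  have hupd : ∀ x i ζ, e (Function.update x i ζ) = e (Function.update x i 0) + ζ • b i := by
    intro x i ζ
    have : Function.update x i ζ = Function.update x i 0 + ζ • Pi.single i 1 := by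
      ext j
      by_cases hj : j = i
      · subst hj; simp
      · simp [hj]
    rw [this, map_add, map_smul]
    congr 2
    rw [he, Finset.sum_eq_single i] <;> simp +contextual
  have hVe : IsOpen (e ⁻¹' V) := hV.preimage e.continuous
  obtain ⟨R, hR, hRV⟩ := Metric.nhds_basis_closedBall.mem_iff.1
    (hVe.mem_nhds (x := e.symm z) (by simpa using hz))
  have hG : AnalyticAt ℂ (F ∘ e) (e.symm z) := by
    refine analyticAt_of_separately_off_countable hR
      (hc.comp e.continuous.continuousOn hRV) fun x hx i => ?_
    -- Two distinct points of the line in one `A k` would have a nonzero multiple of `b i` as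
    -- difference, so there is at most one exceptional parameter for each `k`.
    refine ⟨⋃ k, {ζ | e (Function.update x i ζ) ∈ A k}, Set.countable_iUnion fun k => ?_,
      fun ζ hζ => ?_⟩
    · refine Set.Subsingleton.countable fun ζ hζ ζ' hζ' => ?_
      by_contra hne
      refine hb i k ((Submodule.smul_mem_iff _ (sub_ne_zero.2 hne)).1 ?_)
      have := (A k).sub_mem hζ hζ'
      rwa [hupd, hupd x i ζ', add_sub_add_left_eq_sub, ← sub_smul] at this
    · have hmem : Function.update x i ζ ∈ Metric.closedBall (e.symm z) R := by
        rw [Metric.mem_closedBall, dist_pi_le_iff hR.le] at hx ⊢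
        intro j
        by_cases hj : j = i
        · subst hj
          simpa using (Metric.mem_ball.1 hζ.1).le
        · simpa [hj] using hx j
      have h1 : AnalyticAt ℂ F (e (Function.update x i ζ)) := by
        refine ha _ ⟨hRV hmem, fun k hk => hζ.2 (Set.mem_iUnion.2 ⟨k, hk⟩)⟩
      have h2 : DifferentiableAt ℂ (fun ζ => e (Function.update x i ζ)) ζ := by
        rw [show (fun ζ => e (Function.update x i ζ)) =
          fun ζ => e (Function.update x i 0) + ζ • b i from funext (hupd x i)]
        fun_prop
      exact DifferentiableAt.comp (g := F) ζ h1.differentiableAt h2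
  have h3 : F = (F ∘ e) ∘ e.symm := by ext; simp
  rw [h3]
  exact hG.comp (e.symm.toContinuousLinearMap.analyticAt z)

end RiemannExtension

/-! ### Coverings with prescribed subgroup over a space with a good cover. -/

theorem Path.Homotopic.Quotient.trans_trans_symm_trans {M : Type*} [TopologicalSpace M]
    {b y z w : M} (p : Path.Homotopic.Quotient b y) (q : Path.Homotopic.Quotient w y)
    (r : Path.Homotopic.Quotient y z) : (p.trans r).trans (q.trans r).symm = p.trans q.symm := by
  induction q using Path.Homotopic.Quotient.ind with | mk q => ?_
  induction r using Path.Homotopic.Quotient.ind with | mk r => ?_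
  rw [← mk_trans, ← mk_symm, Path.trans_symm, mk_trans, mk_symm, mk_symm, trans_assoc,
    ← trans_assoc (.mk r), trans_symm, refl_trans]

theorem FundamentalGroup.mapOfEq_mk {X Y : Type*} [TopologicalSpace X] [TopologicalSpace Y]
    (f : C(X, Y)) {x : X} {y : Y} (h : f x = y) (γ : Path x x) :
    FundamentalGroup.mapOfEq f h (Path.Homotopic.Quotient.mk γ) =
      Path.Homotopic.Quotient.mk ((γ.map f.continuous).cast h.symm h.symm) := by
  rw [FundamentalGroup.mapOfEq_apply]
  rfl

/-- A cover by path-connected open sets in which paths with the same ends are homotopic in the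
whole space. -/
structure GoodCover (M : Type*) [TopologicalSpace M] where
  U : M → Set M
  isOpen : ∀ x, IsOpen (U x)
  mem : ∀ x, x ∈ U x
  isPathConnected : ∀ x, IsPathConnected (U x)
  homotopic : ∀ (x : M) {y z : M} (γ γ' : Path y z), (∀ t, γ t ∈ U x) → (∀ t, γ' t ∈ U x) →
    γ.Homotopic γ'

namespace GoodCover

variable {M : Type u} [TopologicalSpace M] (𝒰 : GoodCover M) (b : M)

/-- The class of the paths from `i` to `y` in `U i`, if `y` lies in `U i`. -/
noncomputable def localClass [PathConnectedSpace M] (i y : M) : Path.Homotopic.Quotient i y :=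
  open Classical in
  if h : y ∈ 𝒰.U i then .mk ((𝒰.isPathConnected i).joinedIn i (𝒰.mem i) y h).somePath
  else .mk (PathConnectedSpace.somePath i y)

theorem mk_eq_localClass [PathConnectedSpace M] {i y : M} (γ : Path i y) (h : ∀ t, γ t ∈ 𝒰.U i) :
    .mk γ = 𝒰.localClass i y := by
  have hy : y ∈ 𝒰.U i := by simpa using h 1
  rw [localClass, dif_pos hy]
  exact Path.Homotopic.Quotient.eq.2 (𝒰.homotopic i _ _ h
    (((𝒰.isPathConnected i).joinedIn i (𝒰.mem i) y hy).somePath_mem))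

theorem localClass_trans_mk [PathConnectedSpace M] {i y z : M} (γ : Path y z)
    (h : ∀ t, γ t ∈ 𝒰.U i) :
    (𝒰.localClass i y).trans (.mk γ) = 𝒰.localClass i z := by
  have hy : y ∈ 𝒰.U i := by simpa using h 0
  have hJ := (𝒰.isPathConnected i).joinedIn i (𝒰.mem i) y hy
  rw [← 𝒰.mk_eq_localClass hJ.somePath hJ.somePath_mem, ← Path.Homotopic.Quotient.mk_trans,
    𝒰.mk_eq_localClass]
  intro t
  rw [Path.trans_apply]
  split_ifs
  exacts [hJ.somePath_mem _, h _]

section Transition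

variable [PathConnectedSpace M]

/-- A path class from `b` to `y` through the base point of `U i`. -/
noncomputable def baseClass (i y : M) : Path.Homotopic.Quotient b y :=
  (Path.Homotopic.Quotient.mk (PathConnectedSpace.somePath b i)).trans (𝒰.localClass i y)

theorem baseClass_trans_mk {i y z : M} (γ : Path y z) (h : ∀ t, γ t ∈ 𝒰.U i) :
    (𝒰.baseClass b i y).trans (.mk γ) = 𝒰.baseClass b i z := by
  rw [baseClass, Path.Homotopic.Quotient.trans_assoc, 𝒰.localClass_trans_mk γ h, baseClass]

/-- The transition functions of the coverings attached to a good cover. -/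
noncomputable def transition (i j y : M) : FundamentalGroup M b :=
  (𝒰.baseClass b i y).trans (𝒰.baseClass b j y).symm

end Transition

variable {b}

/-- The set of cosets of a subgroup of the fundamental group, as a discrete space. -/
def CosetFibre (H : Subgroup (FundamentalGroup M b)) : Type u := FundamentalGroup M b ⧸ H

instance (H : Subgroup (FundamentalGroup M b)) : TopologicalSpace (CosetFibre H) := ⊥

instance (H : Subgroup (FundamentalGroup M b)) : DiscreteTopology (CosetFibre H) := ⟨rfl⟩

noncomputable instance (H : Subgroup (FundamentalGroup M b)) :
    MulAction (FundamentalGroup M b) (CosetFibre H) :=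
  inferInstanceAs (MulAction (FundamentalGroup M b) (FundamentalGroup M b ⧸ H))

/-- The coset of a path class. -/
noncomputable def cosetMk (H : Subgroup (FundamentalGroup M b)) (α : FundamentalGroup M b) : CosetFibre H :=
  (α : FundamentalGroup M b ⧸ H)

theorem smul_cosetMk (H : Subgroup (FundamentalGroup M b)) (α β : FundamentalGroup M b) :
    α • cosetMk H β = cosetMk H (α * β) := rfl

theorem cosetMk_eq_iff {H : Subgroup (FundamentalGroup M b)} {α β : FundamentalGroup M b} :
    cosetMk H α = cosetMk H β ↔ α⁻¹ * β ∈ H := QuotientGroup.eq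

variable [PathConnectedSpace M]

theorem transition_self (i y : M) : 𝒰.transition b i i y = 1 :=
  Path.Homotopic.Quotient.trans_symm _

theorem transition_mul_transition (i j k y : M) :
    𝒰.transition b j k y * 𝒰.transition b i j y = 𝒰.transition b i k y := by
  rw [FundamentalGroup.mul_def, transition, transition, transition,
    Path.Homotopic.Quotient.trans_assoc, ← Path.Homotopic.Quotient.trans_assoc _ _
    (Path.Homotopic.Quotient.symm _), Path.Homotopic.Quotient.symm_trans,
    Path.Homotopic.Quotient.refl_trans]

/-- Transporting both base classes along a path inside `U i ∩ U j` changes each by the same factor,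
which cancels. Local constancy makes the coordinate changes continuous on the discrete fibre. -/
theorem transition_eventually_eq [LocallyPathConnectedSpace M] {i j y : M} (hi : y ∈ 𝒰.U i)
    (hj : y ∈ 𝒰.U j) : ∀ᶠ z in 𝓝 y, 𝒰.transition b i j z = 𝒰.transition b i j y := by
  obtain ⟨N, ⟨hN, hNp⟩, hNU⟩ := (path_connected_basis y).mem_iff.1
    (((𝒰.isOpen i).inter (𝒰.isOpen j)).mem_nhds ⟨hi, hj⟩)
  filter_upwards [hN] with z hz
  have hJ := hNp.joinedIn y (mem_of_mem_nhds hN) z hz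
  rw [transition, transition,
    ← 𝒰.baseClass_trans_mk b hJ.somePath fun t => (hNU (hJ.somePath_mem t)).1,
    ← 𝒰.baseClass_trans_mk b hJ.somePath fun t => (hNU (hJ.somePath_mem t)).2]
  exact Path.Homotopic.Quotient.trans_trans_symm_trans _ _ _

variable [LocallyPathConnectedSpace M] (H : Subgroup (FundamentalGroup M b))

/-- The covering attached to a subgroup of the fundamental group, as a fibre bundle. -/
noncomputable def bundleCore : FiberBundleCore M M (CosetFibre H) where
  baseSet := 𝒰.U
  isOpen_baseSet := 𝒰.isOpen
  indexAt x := x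
  mem_baseSet_at := 𝒰.mem
  coordChange i j y f := 𝒰.transition b i j y • f
  coordChange_self i y _ f := by rw [transition_self, one_smul]
  continuousOn_coordChange i j := by
    rintro ⟨y, f⟩ ⟨⟨hi, hj⟩, _⟩
    refine ContinuousAt.continuousWithinAt ?_
    have hc : ContinuousAt (fun p : M × CosetFibre H => 𝒰.transition b i j y • p.2) (y, f) :=
      (continuous_of_discreteTopology (f := fun f : CosetFibre H =>
        𝒰.transition b i j y • f)).continuousAt.comp continuousAt_snd
    refine hc.congr ?_
    filter_upwards [continuousAt_fst.eventually (𝒰.transition_eventually_eq (b := b) hi hj)]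
      with p hp
    rw [hp]
  coordChange_comp i j k y _ f := by rw [smul_smul, transition_mul_transition]

/-- The point of the covering given by a path class. -/
noncomputable def pointOfClass (y : M) (ξ : Path.Homotopic.Quotient b y) :
    (𝒰.bundleCore H).TotalSpace :=
  ⟨y, cosetMk H (ξ.trans (𝒰.baseClass b y y).symm)⟩

/-- The formula has the same shape in every trivialization, so a moving point can be followed in one
fixed chart. -/
theorem pointOfClass_coord (i y : M) (ξ : Path.Homotopic.Quotient b y) :
    ((𝒰.bundleCore H).localTriv i (𝒰.pointOfClass H y ξ)).2 =
      cosetMk H (ξ.trans (𝒰.baseClass b i y).symm) := by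
  rw [FiberBundleCore.localTriv_apply]
  change 𝒰.transition b y i y • cosetMk H _ = _
  rw [smul_cosetMk, FundamentalGroup.mul_def, transition, Path.Homotopic.Quotient.trans_assoc,
    ← Path.Homotopic.Quotient.trans_assoc _ _ (Path.Homotopic.Quotient.symm _),
    Path.Homotopic.Quotient.symm_trans, Path.Homotopic.Quotient.refl_trans]

theorem isCoveringMap_bundleCore : IsCoveringMap (𝒰.bundleCore H).proj :=
  IsFiberBundle.isCoveringMap fun x => ⟨(𝒰.bundleCore H).localTriv x, 𝒰.mem x⟩

theorem pointOfClass_congr {y z : M} (h : y = z) (ξ : Path.Homotopic.Quotient b y) :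
    𝒰.pointOfClass H y ξ = 𝒰.pointOfClass H z (ξ.cast rfl h.symm) := by
  subst h
  rw [Path.Homotopic.Quotient.cast_rfl_rfl]

/-- The lift of a path, given by the classes of its initial segments. -/
noncomputable def liftOfPath {x : M} (γ : Path b x) :
    Path (𝒰.pointOfClass H b (.refl b)) (𝒰.pointOfClass H x (.mk γ)) where
  toFun t := 𝒰.pointOfClass H (γ t) (.mk ((γ.subpath 0 t).cast γ.source.symm rfl))
  continuous_toFun := by
    rw [continuous_iff_continuousAt]
    intro t₀
    rw [FiberBundle.continuousAt_totalSpace (CosetFibre H)]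
    refine ⟨γ.continuous.continuousAt, ?_⟩
    obtain ⟨ε, hε, hU⟩ := Metric.mem_nhds_iff.1 (γ.continuous.continuousAt.preimage_mem_nhds
      ((𝒰.isOpen (γ t₀)).mem_nhds (𝒰.mem (γ t₀))))
    -- In the chart at `γ t₀` the coset is locally constant: the piece of path from `t₀` to `t`
    -- stays in `U (γ t₀)` and is absorbed by the base class.
    refine (continuousAt_const (y := cosetMk H ((Path.Homotopic.Quotient.mk
      ((γ.subpath 0 t₀).cast γ.source.symm rfl)).trans
        (𝒰.baseClass b (γ t₀) (γ t₀)).symm))).congr ?_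
    filter_upwards [Metric.ball_mem_nhds t₀ hε] with t ht
    change _ = ((𝒰.bundleCore H).localTriv (γ t₀) (𝒰.pointOfClass H (γ t) _)).2
    rw [pointOfClass_coord]
    have hsub : ∀ s, γ.subpath t₀ t s ∈ 𝒰.U (γ t₀) := by
      intro s
      have : γ.subpath t₀ t s ∈ Set.range (γ.subpath t₀ t) := ⟨s, rfl⟩
      rw [Path.range_subpath] at this
      obtain ⟨s', hs', hs⟩ := this
      rw [← hs]
      refine hU ?_
      rw [Metric.mem_ball, Subtype.dist_eq, Real.dist_eq] at ht ⊢
      refine lt_of_le_of_lt (Set.abs_sub_left_of_mem_uIcc (a := (t₀ : ℝ)) (b := (t : ℝ)) ?_) ht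
      rcases le_total t₀ t with h | h
      · rw [Set.uIcc_of_le h] at hs'
        rw [Set.uIcc_of_le (show (t₀ : ℝ) ≤ t from h)]
        exact ⟨hs'.1, hs'.2⟩
      · rw [Set.uIcc_of_ge h] at hs'
        rw [Set.uIcc_of_ge (show (t : ℝ) ≤ t₀ from h)]
        exact ⟨hs'.1, hs'.2⟩
    have hcl : Path.Homotopic.Quotient.mk ((γ.subpath 0 t).cast γ.source.symm rfl) =
        (Path.Homotopic.Quotient.mk ((γ.subpath 0 t₀).cast γ.source.symm rfl)).trans
          (.mk (γ.subpath t₀ t)) := by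
      have aux : ∀ {y : M} (hy : y = γ 0),
          Path.Homotopic.Quotient.mk ((γ.subpath 0 t).cast hy rfl) =
          (Path.Homotopic.Quotient.mk ((γ.subpath 0 t₀).cast hy rfl)).trans
            (.mk (γ.subpath t₀ t)) := by
        rintro _ rfl
        rw [← Path.Homotopic.Quotient.mk_trans]
        exact Path.Homotopic.Quotient.eq.2 ⟨(Path.Homotopy.subpathTransSubpath γ _ _ _).symm⟩
      exact aux _
    rw [hcl, ← 𝒰.baseClass_trans_mk b (γ.subpath t₀ t) hsub]
    rw [Path.Homotopic.Quotient.trans_trans_symm_trans]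
  source' := by
    rw [pointOfClass_congr 𝒰 H γ.source]
    congr 1
    rw [← Path.Homotopic.Quotient.mk_cast]
    refine congrArg _ (Path.ext (funext fun t => ?_))
    simp
  target' := by
    rw [pointOfClass_congr 𝒰 H γ.target]
    congr 1
    rw [← Path.Homotopic.Quotient.mk_cast]
    refine congrArg _ (Path.ext (funext fun t => ?_))
    simp

/-- A coset represented by α over `y` is the point of the class of α followed by the base class of
`y`; lifting a path of that class joins it to the base point. -/
theorem pathConnectedSpace_bundleCore : PathConnectedSpace (𝒰.bundleCore H).TotalSpace := by
  have key : ∀ e, Joined (𝒰.pointOfClass H b (.refl b)) e := by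
    rintro ⟨y, f⟩
    obtain ⟨α, rfl⟩ := QuotientGroup.mk_surjective (s := H) f
    obtain ⟨γ, hγ⟩ := Path.Homotopic.Quotient.mk_surjective
      (Path.Homotopic.Quotient.trans (show Path.Homotopic.Quotient b b from α)
        (𝒰.baseClass b y y))
    have hpt : 𝒰.pointOfClass H y (.mk γ) = ⟨y, cosetMk H α⟩ := by
      rw [pointOfClass, hγ, Path.Homotopic.Quotient.trans_assoc,
        Path.Homotopic.Quotient.trans_symm, Path.Homotopic.Quotient.trans_refl]
    exact ⟨(𝒰.liftOfPath H γ).cast rfl hpt.symm⟩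
  exact ⟨⟨𝒰.pointOfClass H b (.refl b)⟩, fun x y => (key x).symm.trans (key y)⟩

/-- A product in the fundamental group traverses its right factor first, so the trailing base class
is a factor on the left and cancels between left cosets. Thus the stabilizer is `H` itself and not a
conjugate. -/
theorem pointOfClass_eq_iff (α : FundamentalGroup M b) :
    𝒰.pointOfClass H b α = 𝒰.pointOfClass H b (.refl b) ↔ α ∈ H := by
  have h1 : ∀ ξ ξ' : Path.Homotopic.Quotient b b,
      𝒰.pointOfClass H b ξ = 𝒰.pointOfClass H b ξ' ↔
      cosetMk H (ξ.trans (𝒰.baseClass b b b).symm) =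
        cosetMk H (ξ'.trans (𝒰.baseClass b b b).symm) := by
    intro ξ ξ'
    exact ⟨fun h => eq_of_heq (Bundle.TotalSpace.ext_iff.1 h).2,
      fun h => congrArg (fun f => (⟨b, f⟩ : (𝒰.bundleCore H).TotalSpace)) h⟩
  rw [h1, eq_comm, cosetMk_eq_iff, ← FundamentalGroup.mul_def, ← FundamentalGroup.mul_def]
  have key : ∀ β : FundamentalGroup M b, (β * 1)⁻¹ * (β * α) ∈ H ↔ α ∈ H := by
    intro β
    rw [mul_one, inv_mul_cancel_left]
  exact key _

/-- The existence part of the classification of coverings. -/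
theorem exists_covering (𝒰 : GoodCover M) (H : Subgroup (FundamentalGroup M b)) : ∃ (E : Type u) (_ : TopologicalSpace E) (p : E → M)
    (hp : IsCoveringMap p) (e₀ : E) (he : p e₀ = b), PathConnectedSpace E ∧
    (FundamentalGroup.mapOfEq ⟨p, hp.continuous⟩ he).range = H := by
  have hcov := 𝒰.isCoveringMap_bundleCore H
  refine ⟨(𝒰.bundleCore H).TotalSpace, inferInstance, (𝒰.bundleCore H).proj,
    hcov, 𝒰.pointOfClass H b (.refl b), rfl,
    𝒰.pathConnectedSpace_bundleCore H, le_antisymm ?_ fun α hα => ?_⟩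
  · rintro _ ⟨q, rfl⟩
    induction q using Path.Homotopic.Quotient.ind with | mk Γ => ?_
    let γ : Path b b := Γ.map hcov.continuous
    have hγ := FundamentalGroup.mapOfEq_mk ⟨(𝒰.bundleCore H).proj, hcov.continuous⟩
      (x := 𝒰.pointOfClass H b (.refl b)) (y := b) rfl Γ
    refine (congrArg (· ∈ H) hγ).mpr ((𝒰.pointOfClass_eq_iff H (Path.Homotopic.Quotient.mk γ)).1 ?_)
    -- By uniqueness of lifts, a loop upstairs is the explicit lift of its projection, so its end
    -- point gives the coset of the projected class.
    have h1 : ⇑Γ = 𝒰.liftOfPath H γ := by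
      refine hcov.eq_of_comp_eq Γ.continuous (𝒰.liftOfPath H γ).continuous ?_ 0 ?_
      · ext t
        rfl
      · rw [Γ.source, (𝒰.liftOfPath H γ).source]
    have h2 := congrFun h1 1
    rw [Γ.target, (𝒰.liftOfPath H γ).target] at h2
    exact h2.symm
  · obtain ⟨γ, rfl⟩ := Path.Homotopic.Quotient.mk_surjective α
    have hpt := (𝒰.pointOfClass_eq_iff H _).2 hα
    refine ⟨Path.Homotopic.Quotient.mk ((𝒰.liftOfPath H γ).cast rfl hpt.symm), ?_⟩
    exact (FundamentalGroup.mapOfEq_mk ⟨(𝒰.bundleCore H).proj, hcov.continuous⟩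
      (x := 𝒰.pointOfClass H b (.refl b)) (y := b) rfl _).trans
      (congrArg Path.Homotopic.Quotient.mk (Path.ext (funext fun t => rfl)))

end GoodCover

/-! ### Finite linear groups without pseudoreflections and their free loci. -/

section SmallGroups

variable {n : ℕ} {G : Subgroup (GL (Fin n) ℂ)}

/-- The points with trivial stabilizer. -/
def freeLocus (G : Subgroup (GL (Fin n) ℂ)) : Set (Fin n → ℂ) :=
  {z | ∀ g ∈ G, (g : Matrix (Fin n) (Fin n) ℂ).mulVec z = z → g = 1}

/-- The fixed spaces of the nontrivial elements of a group. -/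
def fixedSpaces (G : Subgroup (GL (Fin n) ℂ)) (g : {g // g ∈ G ∧ g ≠ 1}) :
    Submodule ℂ (Fin n → ℂ) :=
  LinearMap.ker (Matrix.toLin' ((g.1 : Matrix (Fin n) (Fin n) ℂ) - 1))

theorem mem_fixedSpaces {g : {g // g ∈ G ∧ g ≠ 1}} {z : Fin n → ℂ} :
    z ∈ fixedSpaces G g ↔ (g.1 : Matrix (Fin n) (Fin n) ℂ).mulVec z = z := by
  rw [fixedSpaces, LinearMap.mem_ker, Matrix.toLin'_apply, Matrix.sub_mulVec, Matrix.one_mulVec,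
    sub_eq_zero]

theorem freeLocus_eq : freeLocus G = complSubspaces (fixedSpaces G) := by
  ext z
  simp only [freeLocus, complSubspaces, Set.mem_ofPred_eq, mem_fixedSpaces, Subtype.forall]
  exact ⟨fun h g hg hz => hg.2 (h g hg.1 hz), fun h g hg hz => by
    by_contra h1
    exact h g ⟨hg, h1⟩ hz⟩

theorem GL_mul_mulVec (g h : GL (Fin n) ℂ) (z : Fin n → ℂ) :
    ((g * h : GL (Fin n) ℂ) : Matrix (Fin n) (Fin n) ℂ).mulVec z =
      (g : Matrix (Fin n) (Fin n) ℂ).mulVec ((h : Matrix (Fin n) (Fin n) ℂ).mulVec z) := by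
  rw [Units.val_mul, Matrix.mulVec_mulVec]

theorem GL_inv_mulVec {g : GL (Fin n) ℂ} {z w : Fin n → ℂ} :
    ((g⁻¹ : GL (Fin n) ℂ) : Matrix (Fin n) (Fin n) ℂ).mulVec z = w ↔
      (g : Matrix (Fin n) (Fin n) ℂ).mulVec w = z := by
  constructor
  · rintro rfl
    rw [← GL_mul_mulVec, mul_inv_cancel, Units.val_one, Matrix.one_mulVec]
  · rintro rfl
    rw [← GL_mul_mulVec, inv_mul_cancel, Units.val_one, Matrix.one_mulVec]

theorem GL_one_mulVec (z : Fin n → ℂ) :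
    ((1 : GL (Fin n) ℂ) : Matrix (Fin n) (Fin n) ℂ).mulVec z = z := by
  rw [Units.val_one, Matrix.one_mulVec]

theorem continuous_GL_mulVec (g : GL (Fin n) ℂ) :
    Continuous fun z : Fin n → ℂ => (g : Matrix (Fin n) (Fin n) ℂ).mulVec z :=
  (Matrix.toLin' (g : Matrix (Fin n) (Fin n) ℂ)).continuous_of_finiteDimensional

theorem analyticAt_GL_mulVec (g : GL (Fin n) ℂ) (z : Fin n → ℂ) :
    AnalyticAt ℂ (fun z : Fin n → ℂ => (g : Matrix (Fin n) (Fin n) ℂ).mulVec z) z :=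
  (Matrix.toLin' (g : Matrix (Fin n) (Fin n) ℂ)).toContinuousLinearMap.analyticAt z

theorem mulVec_mem_freeLocus {g : GL (Fin n) ℂ} (hg : g ∈ G) {z : Fin n → ℂ}
    (hz : z ∈ freeLocus G) : (g : Matrix (Fin n) (Fin n) ℂ).mulVec z ∈ freeLocus G := by
  intro h hh hhz
  have h1 : g⁻¹ * h * g = 1 := by
    refine hz _ (G.mul_mem (G.mul_mem (G.inv_mem hg) hh) hg) ?_
    rw [GL_mul_mulVec, GL_mul_mulVec, hhz, GL_inv_mulVec]
  rw [mul_assoc, inv_mul_eq_one] at h1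
  exact right_eq_mul.1 h1

/-- The stabilizer of a point. -/
def pointStabilizer (G : Subgroup (GL (Fin n) ℂ)) (z : Fin n → ℂ) :
    Subgroup (GL (Fin n) ℂ) where
  carrier := {g | g ∈ G ∧ (g : Matrix (Fin n) (Fin n) ℂ).mulVec z = z}
  one_mem' := ⟨G.one_mem, GL_one_mulVec z⟩
  mul_mem' {g h} hg hh := ⟨G.mul_mem hg.1 hh.1, by rw [GL_mul_mulVec, hh.2, hg.2]⟩
  inv_mem' {g} hg := ⟨G.inv_mem hg.1, GL_inv_mulVec.2 hg.2⟩

theorem mem_pointStabilizer {z : Fin n → ℂ} {g : GL (Fin n) ℂ} : g ∈ pointStabilizer G z ↔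
    g ∈ G ∧ (g : Matrix (Fin n) (Fin n) ℂ).mulVec z = z := Iff.rfl

theorem pointStabilizer_eq_bot {z : Fin n → ℂ} (hz : z ∈ freeLocus G) :
    pointStabilizer G z = ⊥ :=
  (Subgroup.eq_bot_iff_forall _).2 fun g hg => hz g hg.1 hg.2

theorem freeLocus_bot : freeLocus (⊥ : Subgroup (GL (Fin n) ℂ)) = Set.univ :=
  Set.eq_univ_of_forall fun _ _ hg _ => Subgroup.mem_bot.1 hg

namespace IsSmallGroup

theorem mono {G' : Subgroup (GL (Fin n) ℂ)} (hG : IsSmallGroup G) (h : G' ≤ G) :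
    IsSmallGroup G' :=
  ⟨have := hG.finite; Finite.of_injective _ (Subgroup.inclusion_injective h),
    fun g hg => hG.codim_fixed g (h hg)⟩

theorem finite_index (hG : IsSmallGroup G) : Finite {g // g ∈ G ∧ g ≠ 1} :=
  have := hG.finite
  Finite.of_injective (fun g => (⟨g.1, g.2.1⟩ : G)) fun _ _ h =>
    Subtype.ext (congrArg (fun g : G => (g : GL (Fin n) ℂ)) h)

theorem finrank_fixedSpaces (hG : IsSmallGroup G) (g : {g // g ∈ G ∧ g ≠ 1}) :
    Module.finrank ℂ (fixedSpaces G g) + 2 ≤ Module.finrank ℂ (Fin n → ℂ) := by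
  rw [Module.finrank_fin_fun]
  exact hG.codim_fixed g.1 g.2.1 g.2.2

theorem fixedSpaces_ne_top (hG : IsSmallGroup G) (g : {g // g ∈ G ∧ g ≠ 1}) :
    fixedSpaces G g ≠ ⊤ :=
  ne_top_of_finrank_add_two_le hG.finrank_fixedSpaces g

theorem isOpen_freeLocus (hG : IsSmallGroup G) : IsOpen (freeLocus G) := by
  have := hG.finite_index
  rw [freeLocus_eq]
  exact isOpen_complSubspaces

theorem dense_freeLocus (hG : IsSmallGroup G) : Dense (freeLocus G) := by
  have := hG.finite_index
  rw [freeLocus_eq]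
  exact dense_complSubspaces hG.fixedSpaces_ne_top

theorem subset_closure_inter_freeLocus (hG : IsSmallGroup G) {D : Set (Fin n → ℂ)}
    (hD : IsOpen D) : D ⊆ closure (D ∩ freeLocus G) :=
  hG.dense_freeLocus.open_subset_closure_inter hD

theorem isPreconnected_inter_freeLocus (hG : IsSmallGroup G) {D : Set (Fin n → ℂ)}
    (hD : IsOpen D) (hDc : IsPreconnected D) : IsPreconnected (D ∩ freeLocus G) := by
  have := hG.finite_index
  rw [freeLocus_eq]
  exact isPreconnected_inter_complSubspaces hG.fixedSpaces_ne_top hD hDc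

theorem simplyConnectedSpace_inter_freeLocus (hG : IsSmallGroup G) {D : Set (Fin n → ℂ)}
    (hD : IsOpen D) (hDc : SimplyConnectedSpace D) :
    SimplyConnectedSpace ↥(D ∩ freeLocus G) := by
  have := hG.finite_index
  rw [freeLocus_eq]
  exact simplyConnectedSpace_inter_complSubspaces hG.finrank_fixedSpaces hD hDc

/-- A continuous function that is holomorphic on the free locus is holomorphic. -/
theorem analyticAt_of_freeLocus (hG : IsSmallGroup G) {V : Set (Fin n → ℂ)}
    (hV : IsOpen V) {F : (Fin n → ℂ) → ℂ} (hc : ContinuousOn F V)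
    (ha : ∀ z ∈ V ∩ freeLocus G, AnalyticAt ℂ F z) {z : Fin n → ℂ} (hz : z ∈ V) :
    AnalyticAt ℂ F z := by
  have := hG.finite_index
  rw [freeLocus_eq] at ha
  exact analyticAt_of_analyticAt_complSubspaces hG.fixedSpaces_ne_top hV hc ha hz

end IsSmallGroup

end SmallGroups

/-! ### Shrinking and recentring local uniformizations. -/

theorem analyticAt_comp_add_left_iff {n : ℕ} {f : (Fin n → ℂ) → ℂ} {z w : Fin n → ℂ} :
    AnalyticAt ℂ (fun w => f (z + w)) w ↔ AnalyticAt ℂ f (z + w) := by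
  constructor
  · intro h
    have h2 : AnalyticAt ℂ (fun y => y - z) (z + w) := analyticAt_id.sub analyticAt_const
    have h1 : AnalyticAt ℂ (fun w => f (z + w)) ((fun y => y - z) (z + w)) := by simpa using h
    have h3 := AnalyticAt.comp (g := fun w => f (z + w)) (f := fun y => y - z) h1 h2
    simpa [Function.comp_def] using h3
  · intro h
    exact AnalyticAt.comp (g := f) (f := fun w => z + w) h (analyticAt_const.add analyticAt_id)

namespace IsLocalUniformization

variable {X : Type u} [TopologicalSpace X] [StructureSheaf X] {n : ℕ}
  {G : Subgroup (GL (Fin n) ℂ)} {D : Set (Fin n → ℂ)} {q : (Fin n → ℂ) → X} {a : X}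

/-- Close to `z` only elements of the stabilizer relate points of the same fibre, and after
translation of `z` to 0 these act linearly. Thus `q` is again a local uniformization, now for the
stabilizer, and the two free loci correspond. -/
theorem exists_recenter (h : IsLocalUniformization G D q a) {z : Fin n → ℂ} (hz : z ∈ D)
    {O : Set (Fin n → ℂ)} (hO : IsOpen O) (hzO : z ∈ O) :
    ∃ D' : Set (Fin n → ℂ), Convex ℝ D' ∧ (∀ w ∈ D', z + w ∈ D ∩ O) ∧
      IsLocalUniformization (pointStabilizer G z) D' (fun w => q (z + w)) (q z) ∧
      ∀ w ∈ D', (z + w ∈ freeLocus G ↔ w ∈ freeLocus (pointStabilizer G z)) := by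
  have hfin := h.small.finite
  have hsmall : IsSmallGroup (pointStabilizer G z) := h.small.mono fun g hg => hg.1
  have hfin' := hsmall.finite
  -- The finitely many elements that move `z` also separate all points sufficiently close to `z`.
  have hev : ∀ᶠ p : (Fin n → ℂ) × (Fin n → ℂ) in 𝓝 (0, 0), ∀ g : G,
      (g : GL (Fin n) ℂ) ∉ pointStabilizer G z →
      ((g : GL (Fin n) ℂ) : Matrix (Fin n) (Fin n) ℂ).mulVec (z + p.1) ≠ z + p.2 := by
    rw [Filter.eventually_all]
    intro g
    by_cases hg : (g : GL (Fin n) ℂ) ∈ pointStabilizer G z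
    · exact Filter.Eventually.of_forall fun _ h => absurd hg h
    · have hc1 : Continuous fun p : (Fin n → ℂ) × (Fin n → ℂ) =>
          ((g : GL (Fin n) ℂ) : Matrix (Fin n) (Fin n) ℂ).mulVec (z + p.1) :=
        (continuous_GL_mulVec _).comp (continuous_const.add continuous_fst)
      have hc2 : Continuous fun p : (Fin n → ℂ) × (Fin n → ℂ) => z + p.2 :=
        continuous_const.add continuous_snd
      have hne : ((g : GL (Fin n) ℂ) : Matrix (Fin n) (Fin n) ℂ).mulVec
          (z + ((0, 0) : (Fin n → ℂ) × (Fin n → ℂ)).1) ≠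
          z + ((0, 0) : (Fin n → ℂ) × (Fin n → ℂ)).2 := by
        rw [add_zero]
        exact fun h' => hg ⟨g.2, h'⟩
      exact Filter.mem_of_superset ((isOpen_ne_fun hc1 hc2).mem_nhds hne) fun p hp _ => hp
  obtain ⟨ε₁, hε₁, hb₁⟩ := Metric.mem_nhds_iff.1 hev
  have hDO : (fun w => z + w) ⁻¹' (D ∩ O) ∈ 𝓝 (0 : Fin n → ℂ) :=
    (continuous_const.add continuous_id).continuousAt.preimage_mem_nhds
      ((h.isOpen.inter hO).mem_nhds (by simpa using ⟨hz, hzO⟩))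
  obtain ⟨ε₂, hε₂, hb₂⟩ := Metric.mem_nhds_iff.1 hDO
  set ε := min ε₁ ε₂
  have hε : 0 < ε := lt_min hε₁ hε₂
  -- Intersecting the linear preimages of a ball under the stabilizer makes the set stable and keeps
  -- it convex.
  let D' : Set (Fin n → ℂ) := ⋂ g : pointStabilizer G z,
    (Matrix.toLin' ((g : GL (Fin n) ℂ) : Matrix (Fin n) (Fin n) ℂ)) ⁻¹' Metric.ball 0 ε
  have hmem : ∀ {w}, w ∈ D' ↔ ∀ g ∈ pointStabilizer G z,
      (g : Matrix (Fin n) (Fin n) ℂ).mulVec w ∈ Metric.ball 0 ε := by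
    intro w
    simp [D']
  have hball : D' ⊆ Metric.ball 0 ε := fun w hw => by
    have := hmem.1 hw 1 (one_mem _)
    rwa [GL_one_mulVec] at this
  have hsub : ∀ w ∈ D', z + w ∈ D ∩ O := fun w hw =>
    hb₂ (Metric.ball_subset_ball (min_le_right _ _) (hball hw))
  have hstab : ∀ g ∈ G, ∀ w ∈ D', ∀ w' ∈ D',
      (g : Matrix (Fin n) (Fin n) ℂ).mulVec (z + w) = z + w' → g ∈ pointStabilizer G z := by
    intro g hg w hw w' hw' he
    by_contra hgs
    have hp : ((w, w') : (Fin n → ℂ) × (Fin n → ℂ)) ∈ Metric.ball (0, 0) ε₁ := by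
      rw [← ball_prod_same]
      exact ⟨Metric.ball_subset_ball (min_le_left _ _) (hball hw),
        Metric.ball_subset_ball (min_le_left _ _) (hball hw')⟩
    exact hb₁ hp ⟨g, hg⟩ hgs he
  have hlin : ∀ g ∈ pointStabilizer G z, ∀ w,
      (g : Matrix (Fin n) (Fin n) ℂ).mulVec (z + w) =
        z + (g : Matrix (Fin n) (Fin n) ℂ).mulVec w := by
    intro g hg w
    rw [Matrix.mulVec_add, hg.2]
  refine ⟨D', ?_, hsub, ⟨hsmall, ?_, ?_, ?_, ?_, ?_, ?_, ?_, ?_⟩, ?_⟩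
  · refine convex_iInter fun g => ?_
    exact (convex_ball (0 : Fin n → ℂ) ε).is_linear_preimage
      ((Matrix.toLin' ((g : GL (Fin n) ℂ) : Matrix (Fin n) (Fin n) ℂ)).restrictScalars ℝ).isLinear
  · exact isOpen_iInter_of_finite fun g => Metric.isOpen_ball.preimage
      (continuous_GL_mulVec (g : GL (Fin n) ℂ))
  · exact hmem.2 fun g _ => by
      rw [Matrix.mulVec_zero]
      exact Metric.mem_ball_self hε
  · intro g hg w hw
    refine hmem.2 fun g' hg' => ?_
    rw [← GL_mul_mulVec]
    exact hmem.1 hw _ (mul_mem hg' hg)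
  · exact h.continuousOn.comp (continuous_const.add continuous_id).continuousOn
      fun w hw => (hsub w hw).1
  · intro V hV hVo
    rw [← Set.image_image q (fun w => z + w)]
    refine h.isOpen_image _ ?_ ((Homeomorph.addLeft z).isOpenMap V hVo)
    rintro _ ⟨w, hw, rfl⟩
    exact (hsub w (hV hw)).1
  · intro w hw w' hw'
    rw [h.fibre _ (hsub w hw).1 _ (hsub w' hw').1]
    constructor
    · rintro ⟨g, hg, he⟩
      have hgs := hstab g hg w hw w' hw' he
      rw [hlin g hgs, add_right_inj] at he
      exact ⟨g, hgs, he⟩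
    · rintro ⟨g, hg, rfl⟩
      exact ⟨g, hg.1, hlin g hg w⟩
  · intro w hw f
    rw [h.sheaf _ (hsub w hw).1 f]
    exact analyticAt_comp_add_left_iff.symm
  · simp
  · intro w hw
    constructor
    · intro hfree g hg hgw
      exact hfree g hg.1 (by rw [hlin g hg, hgw])
    · intro hfree g hg hgw
      have hgs := hstab g hg w hw w hw hgw
      rw [hlin g hgs, add_right_inj] at hgw
      exact hfree g hgs hgw

/-- Recentring at 0, whose stabilizer is the whole group. -/
theorem exists_convex (h : IsLocalUniformization G D q a) {O : Set X} (hO : IsOpen O)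
    (ha : a ∈ O) : ∃ D' ⊆ D, Convex ℝ D' ∧ q '' D' ⊆ O ∧ IsLocalUniformization G D' q a := by
  obtain ⟨O', hO', hO'D⟩ := continuousOn_iff'.1 h.continuousOn O hO
  obtain ⟨D', hc, hsub, hu, -⟩ := h.exists_recenter h.zero_mem (hO'.inter h.isOpen)
    (by rw [← hO'D]; exact ⟨by rwa [Set.mem_preimage, h.map_zero], h.zero_mem⟩)
  have hstab : pointStabilizer G 0 = G := by
    ext g
    simp [mem_pointStabilizer]
  simp only [zero_add, hstab] at hu hsub
  refine ⟨D', fun w hw => (hsub w hw).1, hc, ?_, h.map_zero ▸ hu⟩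
  rintro _ ⟨w, hw, rfl⟩
  have := (hsub w hw).2
  rw [← hO'D] at this
  exact this.1

theorem mem_smoothLocus (h : IsLocalUniformization G D q a) {z : Fin n → ℂ}
    (hz : z ∈ D ∩ freeLocus G) : q z ∈ smoothLocus X := by
  obtain ⟨D', -, -, hu, -⟩ := h.exists_recenter hz.1 isOpen_univ (Set.mem_univ _)
  rw [pointStabilizer_eq_bot hz.2] at hu
  exact ⟨n, D', _, hu⟩

theorem mem_image (h : IsLocalUniformization G D q a) : a ∈ q '' D :=
  ⟨0, h.zero_mem, h.map_zero⟩

theorem isOpen_range (h : IsLocalUniformization G D q a) : IsOpen (q '' D) :=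
  h.isOpen_image D subset_rfl h.isOpen

theorem map_mulVec (h : IsLocalUniformization G D q a) {g : GL (Fin n) ℂ} (hg : g ∈ G)
    {z : Fin n → ℂ} (hz : z ∈ D) : q ((g : Matrix (Fin n) (Fin n) ℂ).mulVec z) = q z :=
  ((h.fibre z hz _ (h.stable g hg z hz)).2 ⟨g, hg, rfl⟩).symm

theorem mem_freeLocus_of_map_eq (h : IsLocalUniformization G D q a) {z w : Fin n → ℂ}
    (hz : z ∈ D ∩ freeLocus G) (hw : w ∈ D) (he : q z = q w) : w ∈ freeLocus G := by
  obtain ⟨g, hg, rfl⟩ := (h.fibre z hz.1 w hw).1 he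
  exact mulVec_mem_freeLocus hg hz.2

theorem image_subset_closure (h : IsLocalUniformization G D q a) {V : Set (Fin n → ℂ)}
    (hV : IsOpen V) (hVD : V ⊆ D) : q '' V ⊆ closure (q '' (V ∩ freeLocus G)) := by
  rintro _ ⟨z, hz, rfl⟩
  have h1 := h.small.subset_closure_inter_freeLocus hV hz
  exact mem_closure_image (h.continuousOn.continuousAt (h.isOpen.mem_nhds (hVD hz))) h1

/-- The set lies between the connected image of the free part of `V` and its closure; no description
of all smooth points is needed. -/
theorem isPreconnected_image_inter_smoothLocus (h : IsLocalUniformization G D q a)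
    {V : Set (Fin n → ℂ)} (hV : IsOpen V) (hVc : IsPreconnected V) (hVD : V ⊆ D) :
    IsPreconnected (q '' V ∩ smoothLocus X) := by
  have h1 : IsPreconnected (q '' (V ∩ freeLocus G)) :=
    (h.small.isPreconnected_inter_freeLocus hV hVc).image q
      (h.continuousOn.mono (Set.inter_subset_left.trans hVD))
  refine h1.subset_closure ?_ (Set.inter_subset_left.trans (h.image_subset_closure hV hVD))
  rintro _ ⟨z, hz, rfl⟩
  exact ⟨⟨z, hz.1, rfl⟩, h.mem_smoothLocus ⟨hVD hz.1, hz.2⟩⟩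

end IsLocalUniformization

/-! ### Topology of the smooth locus. -/

section SmoothLocus

variable {X : Type u} [TopologicalSpace X] [StructureSheaf X]

theorem isOpen_smoothLocus : IsOpen (smoothLocus X) := by
  rw [isOpen_iff_mem_nhds]
  rintro a ⟨n, D, q, h⟩
  filter_upwards [h.isOpen_range.mem_nhds h.mem_image]
  rintro _ ⟨z, hz, rfl⟩
  exact h.mem_smoothLocus ⟨hz, by rw [freeLocus_bot]; trivial⟩

theorem dense_smoothLocus (hX : IsPureOrbifold X) : Dense (smoothLocus X) := by
  intro a
  obtain ⟨n, G, D, q, h⟩ := hX.exists_uniformization a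
  refine closure_mono ?_ (h.image_subset_closure h.isOpen subset_rfl h.mem_image)
  rintro _ ⟨z, hz, rfl⟩
  exact h.mem_smoothLocus hz

theorem isPreconnected_smoothLocus (hX : IsPureOrbifold X) [PreconnectedSpace X] :
    IsPreconnected (smoothLocus X) := by
  refine isPreconnected_of_dense_of_locally isPreconnected_univ (Set.subset_univ _)
    (fun x _ => dense_smoothLocus hX x) fun a _ => ?_
  obtain ⟨n, G, D, q, h⟩ := hX.exists_uniformization a
  obtain ⟨D', hD', hc, -, h'⟩ := h.exists_convex isOpen_univ (Set.mem_univ a)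
  exact ⟨q '' D', h'.isOpen_range.mem_nhds h'.mem_image,
    h'.isPreconnected_image_inter_smoothLocus h'.isOpen hc.isPreconnected subset_rfl⟩

/-- The smooth locus is covered by images of convex sets under open embeddings. -/
theorem exists_isOpenEmbedding_smoothLocus (x : smoothLocus X) {O : Set (smoothLocus X)}
    (hO : O ∈ 𝓝 x) : ∃ (n : ℕ) (D : Set (Fin n → ℂ)) (Q : D → smoothLocus X),
      Convex ℝ D ∧ D.Nonempty ∧ IsOpenEmbedding Q ∧ x ∈ Set.range Q ∧ Set.range Q ⊆ O := by
  obtain ⟨n, D₀, q, h₀⟩ := x.2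
  obtain ⟨O', hO'O, hO'⟩ := mem_nhds_iff.1 hO
  obtain ⟨D, hD, hc, hsub, h⟩ := h₀.exists_convex
    (isOpen_smoothLocus.isOpenMap_subtype_val O' hO'.1) ⟨x, hO'.2, rfl⟩
  have hmem : ∀ z : D, q z ∈ smoothLocus X := fun z =>
    h.mem_smoothLocus ⟨z.2, by rw [freeLocus_bot]; trivial⟩
  refine ⟨n, D, fun z => ⟨q z, hmem z⟩, hc, ⟨0, h.zero_mem⟩, ?_, ?_, ?_⟩
  · refine IsOpenEmbedding.of_continuous_injective_isOpenMap ?_ ?_ ?_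
    · exact (continuousOn_iff_continuous_domRestrict.1 h.continuousOn).subtype_mk _
    · intro z w hzw
      obtain ⟨g, hg, hgw⟩ := (h.fibre z z.2 w w.2).1 (congrArg Subtype.val hzw)
      rw [Subgroup.mem_bot.1 hg, GL_one_mulVec] at hgw
      exact Subtype.ext hgw
    · intro V hV
      have h1 := h.isOpen_image _ (by simp) (h.isOpen.isOpenMap_subtype_val V hV)
      rw [isOpen_induced_iff]
      refine ⟨_, h1, ?_⟩
      ext y
      constructor
      · rintro ⟨_, ⟨z, hz, rfl⟩, hy⟩
        exact ⟨z, hz, Subtype.ext hy⟩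
      · rintro ⟨z, hz, rfl⟩
        exact ⟨z, ⟨z, hz, rfl⟩, rfl⟩
  · exact ⟨⟨0, h.zero_mem⟩, Subtype.ext h.map_zero⟩
  · rintro _ ⟨z, rfl⟩
    obtain ⟨y, hy, hyz⟩ := hsub ⟨z, z.2, rfl⟩
    have : (⟨q z, hmem z⟩ : smoothLocus X) = y := Subtype.ext hyz.symm
    exact (congrArg (· ∈ O) this).mpr (hO'O hy)

instance : LocallyPathConnectedSpace (smoothLocus X) := by
  refine ⟨fun x => ⟨fun s => ⟨fun hs => ?_, fun ⟨t, ht, hts⟩ => Filter.mem_of_superset ht.1 hts⟩⟩⟩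
  obtain ⟨n, D, Q, hc, hne, hQ, hx, hsub⟩ := exists_isOpenEmbedding_smoothLocus x hs
  refine ⟨Set.range Q, ⟨hQ.isOpen_range.mem_nhds hx, ?_⟩, hsub⟩
  have := isPathConnected_iff_pathConnectedSpace.1 (hc.isPathConnected hne)
  exact isPathConnected_range hQ.continuous

theorem Path.homotopic_of_isEmbedding {D M : Type*} [TopologicalSpace D] [TopologicalSpace M]
    [SimplyConnectedSpace D] {Q : D → M} (hQ : IsEmbedding Q) {y z : M} (γ γ' : Path y z)
    (h : ∀ t, γ t ∈ Set.range Q) (h' : ∀ t, γ' t ∈ Set.range Q) : γ.Homotopic γ' := by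
  obtain ⟨y', hy'⟩ : y ∈ Set.range Q := by simpa using h 0
  obtain ⟨z', hz'⟩ : z ∈ Set.range Q := by simpa using h 1
  subst hy' hz'
  have key : ∀ γ : Path (Q y') (Q z'), (∀ t, γ t ∈ Set.range Q) →
      ∃ δ : Path y' z', δ.map hQ.continuous = γ := by
    intro γ h
    choose s hs using h
    refine ⟨⟨⟨s, ?_⟩, hQ.injective (by simp [hs]), hQ.injective (by simp [hs])⟩, ?_⟩
    · rw [hQ.isInducing.continuous_iff]
      exact γ.continuous.congr fun t => (hs t).symm
    · ext t
      exact hs t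
  obtain ⟨δ, rfl⟩ := key γ h
  obtain ⟨δ', rfl⟩ := key γ' h'
  exact (SimplyConnectedSpace.paths_homotopic δ δ').map ⟨Q, hQ.continuous⟩

theorem nonempty_goodCover_smoothLocus : Nonempty (GoodCover (smoothLocus X)) := by
  choose n D Q hc hne hQ hx hsub using fun x : smoothLocus X =>
    exists_isOpenEmbedding_smoothLocus x Filter.univ_mem
  refine ⟨⟨fun x => Set.range (Q x), fun x => (hQ x).isOpen_range, hx, fun x => ?_,
    fun x y z γ γ' h h' => ?_⟩⟩
  · have := isPathConnected_iff_pathConnectedSpace.1 ((hc x).isPathConnected (hne x))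
    exact isPathConnected_range (hQ x).continuous
  · have := (hc x).contractibleSpace (hne x)
    exact Path.homotopic_of_isEmbedding (hQ x).isEmbedding γ γ' h h'

theorem pathConnectedSpace_smoothLocus (hX : IsPureOrbifold X) [PreconnectedSpace X]
    (b : smoothLocus X) : PathConnectedSpace (smoothLocus X) := by
  have : ConnectedSpace (smoothLocus X) :=
    isConnected_iff_connectedSpace.1 ⟨⟨b, b.2⟩, isPreconnected_smoothLocus hX⟩
  exact PathConnectedSpace.of_locallyPathConnectedSpace

end SmoothLocus

theorem IsLocalHomeomorph.locallyPathConnectedSpace {E M : Type*} [TopologicalSpace E]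
    [TopologicalSpace M] [LocallyPathConnectedSpace M] {f : E → M} (hf : IsLocalHomeomorph f) :
    LocallyPathConnectedSpace E := by
  refine ⟨fun x => ⟨fun s => ⟨fun hs => ?_, fun ⟨t, ht, hts⟩ => Filter.mem_of_superset ht.1 hts⟩⟩⟩
  obtain ⟨e, hx, rfl⟩ := hf x
  have h1 : e.target ∩ e.symm ⁻¹' s ∈ 𝓝 (e x) := by
    refine Filter.inter_mem (e.open_target.mem_nhds (e.map_source hx)) ?_
    refine (e.continuousAt_symm (e.map_source hx)).preimage_mem_nhds ?_
    rwa [e.left_inv hx]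
  obtain ⟨t, ⟨ht, htp⟩, hts⟩ := (path_connected_basis (e x)).mem_iff.1 h1
  have hts' : t ⊆ e.target ∩ e.symm ⁻¹' s := hts
  refine ⟨e.symm '' t, ⟨?_, htp.image' (e.continuousOn_symm.mono fun y hy => (hts' hy).1)⟩, ?_⟩
  · have := e.symm.image_mem_nhds (e.map_source hx) ht
    rwa [e.left_inv hx] at this
  · rintro _ ⟨y, hy, rfl⟩
    exact (hts' hy).2

/-! ### Fox completion of a spread. -/

open TopologicalSpace (Opens)

/-- A point of the completion of a spread `p : E → X`: a point `pt` of `X` with a compatible choice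
of connected components of `p⁻¹(W)`, for the open neighbourhoods `W` of `pt`. -/
structure FoxPoint {X E : Type*} [TopologicalSpace X] [TopologicalSpace E] (p : E → X) where
  pt : X
  comp : Opens X → Set E
  exists_eq : ∀ W : Opens X, pt ∈ W → ∃ e, p e ∈ W ∧ comp W = connectedComponentIn (p ⁻¹' W) e
  mono : ∀ W W' : Opens X, W ≤ W' → comp W ⊆ comp W'
  eq_empty : ∀ W : Opens X, pt ∉ W → comp W = ∅

namespace FoxPoint

variable {X E : Type*} [TopologicalSpace X] [TopologicalSpace E] {p : E → X}

theorem pt_mem (y : FoxPoint p) {W : Opens X} {e : E} (h : e ∈ y.comp W) : y.pt ∈ W := by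
  by_contra hW
  rw [y.eq_empty W hW] at h
  exact h

theorem comp_nonempty (y : FoxPoint p) {W : Opens X} (h : y.pt ∈ W) : (y.comp W).Nonempty := by
  obtain ⟨e, he, heq⟩ := y.exists_eq W h
  exact ⟨e, heq ▸ mem_connectedComponentIn he⟩

theorem comp_eq (y : FoxPoint p) {W : Opens X} {e : E} (h : e ∈ y.comp W) :
    y.comp W = connectedComponentIn (p ⁻¹' W) e := by
  obtain ⟨e', he', heq⟩ := y.exists_eq W (y.pt_mem h)
  rw [heq] at h ⊢
  exact connectedComponentIn_eq h

theorem comp_subset (y : FoxPoint p) (W : Opens X) : y.comp W ⊆ p ⁻¹' W := fun e he => by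
  rw [y.comp_eq he] at he
  exact connectedComponentIn_subset _ _ he

theorem comp_eq_comp {y y' : FoxPoint p} {W : Opens X} {e : E} (h : e ∈ y.comp W)
    (h' : e ∈ y'.comp W) : y.comp W = y'.comp W := by
  rw [y.comp_eq h, y'.comp_eq h']

theorem isPreconnected_comp (y : FoxPoint p) (W : Opens X) : IsPreconnected (y.comp W) := by
  by_cases h : y.pt ∈ W
  · obtain ⟨e, -, heq⟩ := y.exists_eq W h
    rw [heq]
    exact isPreconnected_connectedComponentIn
  · rw [y.eq_empty W h]
    exact isPreconnected_empty

theorem isOpen_comp [LocallyConnectedSpace E] (hp : Continuous p) (y : FoxPoint p)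
    (W : Opens X) : IsOpen (y.comp W) := by
  by_cases h : y.pt ∈ W
  · obtain ⟨e, -, heq⟩ := y.exists_eq W h
    rw [heq]
    exact (W.isOpen.preimage hp).connectedComponentIn
  · rw [y.eq_empty W h]
    exact isOpen_empty

/-- Components over the same open set coincide once they meet, and a common point over a small set
persists over every larger one. Over sets that miss `pt` both choices are empty by convention. -/
theorem ext_of_basis {y y' : FoxPoint p} (hpt : y.pt = y'.pt)
    (h : ∀ W : Opens X, y.pt ∈ W → ∃ W' ≤ W, ∃ e, e ∈ y.comp W' ∧ e ∈ y'.comp W') : y = y' := by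
  have hcomp : y.comp = y'.comp := by
    funext W
    by_cases hW : y.pt ∈ W
    · obtain ⟨W', hW', e, he, he'⟩ := h W hW
      exact comp_eq_comp (y.mono W' W hW' he) (y'.mono W' W hW' he')
    · rw [y.eq_empty W hW, y'.eq_empty W (hpt ▸ hW)]
  cases y
  cases y'
  subst hpt hcomp
  rfl

/-- Prescribing the component over one open set defines a basic neighbourhood. For intersections, a
component over `W ⊓ W'` is nonempty and therefore determines those over `W` and `W'`. -/
instance : TopologicalSpace (FoxPoint p) where
  IsOpen S := ∀ y ∈ S, ∃ W : Opens X, y.pt ∈ W ∧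
    ∀ y' : FoxPoint p, y'.pt ∈ W → y'.comp W = y.comp W → y' ∈ S
  isOpen_univ _ _ := ⟨⊤, trivial, fun _ _ _ => trivial⟩
  isOpen_inter S T hS hT y hy := by
    obtain ⟨W, hW, hWS⟩ := hS y hy.1
    obtain ⟨W', hW', hWT⟩ := hT y hy.2
    refine ⟨W ⊓ W', ⟨hW, hW'⟩, fun y' hy' he => ?_⟩
    obtain ⟨e, hey⟩ := y.comp_nonempty (W := W ⊓ W') ⟨hW, hW'⟩
    have hey' : e ∈ y'.comp (W ⊓ W') := he ▸ hey
    exact ⟨hWS y' hy'.1 (comp_eq_comp (y'.mono _ _ inf_le_left hey') (y.mono _ _ inf_le_left hey)),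
      hWT y' hy'.2 (comp_eq_comp (y'.mono _ _ inf_le_right hey') (y.mono _ _ inf_le_right hey))⟩
  isOpen_sUnion 𝒮 h𝒮 y := by
    rintro ⟨S, hS, hy⟩
    obtain ⟨W, hW, hWS⟩ := h𝒮 S hS y hy
    exact ⟨W, hW, fun y' h h' => ⟨S, hS, hWS y' h h'⟩⟩

theorem isOpen_setOf_comp_eq (W : Opens X) (K : Set E) :
    IsOpen {y : FoxPoint p | y.pt ∈ W ∧ y.comp W = K} :=
  fun _ hy => ⟨W, hy.1, fun _ h h' => ⟨h, h'.trans hy.2⟩⟩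

theorem mem_nhds_iff {y : FoxPoint p} {S : Set (FoxPoint p)} : S ∈ 𝓝 y ↔ ∃ W : Opens X, y.pt ∈ W ∧
    ∀ y' : FoxPoint p, y'.pt ∈ W → y'.comp W = y.comp W → y' ∈ S := by
  rw [_root_.mem_nhds_iff]
  constructor
  · rintro ⟨T, hTS, hT, hy⟩
    obtain ⟨W, hW, hWT⟩ := hT y hy
    exact ⟨W, hW, fun y' h h' => hTS (hWT y' h h')⟩
  · rintro ⟨W, hW, hWS⟩
    exact ⟨_, fun y' hy' => hWS y' hy'.1 hy'.2, isOpen_setOf_comp_eq W (y.comp W), hW, rfl⟩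

theorem continuous_pt : Continuous (pt : FoxPoint p → X) :=
  ⟨fun O hO _ hy => ⟨⟨O, hO⟩, hy, fun _ h _ => h⟩⟩

/-- Distinct points over the same `pt` have disjoint components over some `W`, and no point can have
both as its component over `W`. -/
instance [T2Space X] : T2Space (FoxPoint p) := by
  refine ⟨fun y y' hne => ?_⟩
  by_cases hpt : y.pt = y'.pt
  · by_contra hcon
    refine hne (ext_of_basis hpt fun W hW => ⟨W, le_rfl, ?_⟩)
    by_contra hdis
    refine hcon ⟨_, _, isOpen_setOf_comp_eq W (y.comp W), isOpen_setOf_comp_eq W (y'.comp W),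
      ⟨hW, rfl⟩, ⟨hpt ▸ hW, rfl⟩, Set.disjoint_left.2 fun z hz hz' => hdis ?_⟩
    obtain ⟨e, he⟩ := z.comp_nonempty hz.1
    exact ⟨e, hz.2 ▸ he, hz'.2 ▸ he⟩
  · obtain ⟨u, v, hu, hv, hyu, hyv, huv⟩ := t2_separation hpt
    exact ⟨_, _, hu.preimage continuous_pt, hv.preimage continuous_pt, hyu, hyv,
      huv.preimage _⟩

/-- The point of the completion given by a point of the spread. -/
def ofPoint (p : E → X) (e : E) : FoxPoint p where
  pt := p e
  comp W := connectedComponentIn (p ⁻¹' W) e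
  exists_eq _ hW := ⟨e, hW, rfl⟩
  mono _ _ h := connectedComponentIn_mono e (Set.preimage_mono h)
  eq_empty _ hW := connectedComponentIn_eq_empty hW

theorem mem_comp_ofPoint {e : E} {W : Opens X} (h : p e ∈ W) : e ∈ (ofPoint p e).comp W :=
  mem_connectedComponentIn h

theorem continuous_ofPoint [LocallyConnectedSpace E] (hp : Continuous p) :
    Continuous (ofPoint p) := by
  refine continuous_iff_continuousAt.2 fun e S hS => ?_
  obtain ⟨W, hW, hWS⟩ := mem_nhds_iff.1 hS
  have hopen : IsOpen ((ofPoint p e).comp W) := isOpen_comp hp _ W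
  rw [Filter.mem_map]
  refine Filter.mem_of_superset (hopen.mem_nhds (mem_comp_ofPoint hW)) fun e' he' => ?_
  have hpe' : p e' ∈ W := comp_subset (ofPoint p e) W he'
  exact hWS _ hpe' (comp_eq_comp (mem_comp_ofPoint hpe') he')

end FoxPoint

/-! ### Sheets of coverings, and the completion over the base of the covering. -/

section Sheets

variable {X E : Type*} [TopologicalSpace X] [TopologicalSpace E]

/-- `S` is a sheet of `p` over the open set `W`. -/
structure IsSheet (p : E → X) (W : Opens X) (S : Set E) : Prop where
  isOpen : IsOpen S
  injOn : Set.InjOn p S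
  image : p '' S = W
  comp_eq : ∀ e ∈ S, connectedComponentIn (p ⁻¹' W) e = S

/-- An open set whose preimage is a disjoint union of connected sheets. -/
def IsSheeted (p : E → X) (W : Opens X) : Prop :=
  ∀ e, p e ∈ W → ∃ S, e ∈ S ∧ IsSheet p W S

theorem IsSheet.comp_subset {p : E → X} {W : Opens X} {S T : Set E} (hS : IsSheet p W S)
    (hT : IsPreconnected T) (hTW : T ⊆ p ⁻¹' W) {e : E} (heT : e ∈ T) (heS : e ∈ S) : T ⊆ S := by
  rw [← hS.comp_eq e heS]
  exact hT.subset_connectedComponentIn heT hTW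

/-- Over a connected open part of an evenly covered set each sheet is connected, and the union of
the other sheets is open as well, so each sheet is a full component of the preimage. -/
theorem IsCoveringMap.exists_isSheeted {Z : Set X} (hZ : IsOpen Z) [LocallyConnectedSpace Z]
    {c : E → Z} (hc : IsCoveringMap c) {x : X} (hx : x ∈ Z) {O : Set X} (hO : O ∈ 𝓝 x) :
    ∃ W : Opens X, x ∈ W ∧ (W : Set X) ⊆ O ∩ Z ∧ IsSheeted (fun e => (c e : X)) W := by
  obtain ⟨hI, U, hxU, hUo, -, H, hH⟩ := hc ⟨x, hx⟩
  let W₀ : Set Z := connectedComponentIn (U ∩ Subtype.val ⁻¹' (interior O)) ⟨x, hx⟩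
  have hW₀ : IsOpen W₀ :=
    (hUo.inter (isOpen_interior.preimage continuous_subtype_val)).connectedComponentIn
  have hxW₀ : (⟨x, hx⟩ : Z) ∈ W₀ :=
    mem_connectedComponentIn ⟨hxU, mem_interior_iff_mem_nhds.2 hO⟩
  have hsub : W₀ ⊆ U ∩ Subtype.val ⁻¹' (interior O) := connectedComponentIn_subset _ _
  have hpre : IsPreconnected W₀ := isPreconnected_connectedComponentIn
  refine ⟨⟨Subtype.val '' W₀, hZ.isOpenMap_subtype_val W₀ hW₀⟩, ⟨_, hxW₀, rfl⟩, ?_, ?_⟩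
  · rintro _ ⟨w, hw, rfl⟩
    exact ⟨interior_subset (hsub hw).2, w.2⟩
  have hpreim : (fun e => (c e : X)) ⁻¹' (Subtype.val '' W₀) = c ⁻¹' W₀ := by
    ext e
    refine ⟨fun ⟨w, hw, h⟩ => ?_, fun h => ⟨_, h, rfl⟩⟩
    obtain rfl : w = c e := Subtype.ext h
    exact hw
  intro e₁ he₁
  replace he₁ : c e₁ ∈ W₀ := (hpreim ▸ he₁ : e₁ ∈ c ⁻¹' W₀)
  have hc₁ : e₁ ∈ c ⁻¹' U := (hsub he₁).1
  let i := (H ⟨e₁, hc₁⟩).2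
  let S : Set E := Subtype.val '' {e : c ⁻¹' U | c e ∈ W₀ ∧ (H e).2 = i}
  let S' : Set E := Subtype.val '' {e : c ⁻¹' U | c e ∈ W₀ ∧ (H e).2 ≠ i}
  have hcU : IsOpen (c ⁻¹' U) := hUo.preimage hc.continuous
  have hopen : ∀ P : _ → Prop, IsOpen (Subtype.val '' {e : c ⁻¹' U | c e ∈ W₀ ∧ P (H e).2}) := by
    intro P
    refine hcU.isOpenMap_subtype_val _ (IsOpen.inter
      (hW₀.preimage (hc.continuous.comp continuous_subtype_val)) ?_)
    exact (isOpen_discrete {i | P i}).preimage (continuous_snd.comp H.continuous)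
  have hS : IsOpen S := hopen (· = i)
  have hS' : IsOpen S' := hopen (· ≠ i)
  have hSS' : c ⁻¹' W₀ ⊆ S ∪ S' := fun e he => by
    by_cases h : (H ⟨e, (hsub he).1⟩).2 = i
    · exact Or.inl ⟨⟨e, (hsub he).1⟩, ⟨he, h⟩, rfl⟩
    · exact Or.inr ⟨⟨e, (hsub he).1⟩, ⟨he, h⟩, rfl⟩
  have hdis : Disjoint S S' := by
    rw [Set.disjoint_left]
    rintro _ ⟨e, he, rfl⟩ ⟨e', he', h⟩
    obtain rfl := Subtype.ext h
    exact he'.2 he.2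
  have hSeq : S = (fun w : W₀ => (H.symm (⟨w, (hsub w.2).1⟩, i) : E)) '' Set.univ := by
    ext e
    constructor
    · rintro ⟨e', ⟨he, hi⟩, rfl⟩
      refine ⟨⟨c e', he⟩, trivial, ?_⟩
      have : (⟨⟨c e', (hsub he).1⟩, i⟩ : U × _) = H e' := Prod.ext (Subtype.ext (hH e').symm) hi.symm
      simp [this]
    · rintro ⟨w, -, rfl⟩
      refine ⟨H.symm (⟨w, (hsub w.2).1⟩, i), ⟨?_, by simp⟩, rfl⟩
      have := hH (H.symm (⟨w, (hsub w.2).1⟩, i))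
      rw [Homeomorph.apply_symm_apply] at this
      rw [← this]
      exact w.2
  have hSpre : IsPreconnected S := by
    rw [hSeq]
    have := isPreconnected_iff_preconnectedSpace.1 hpre
    refine isPreconnected_univ.image _ (Continuous.continuousOn ?_)
    refine continuous_subtype_val.comp (H.symm.continuous.comp ?_)
    exact (Continuous.subtype_mk continuous_subtype_val _).prodMk continuous_const
  have hSW : S ⊆ c ⁻¹' W₀ := by
    rintro _ ⟨e, he, rfl⟩
    exact he.1
  refine ⟨S, ⟨⟨e₁, hc₁⟩, ⟨he₁, rfl⟩, rfl⟩, hS, ?_, ?_, ?_⟩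
  · rintro _ ⟨e, he, rfl⟩ _ ⟨e', he', rfl⟩ h
    have : H e = H e' := Prod.ext (Subtype.ext (by rw [hH, hH]; exact Subtype.ext h))
      (he.2.trans he'.2.symm)
    rw [H.injective this]
  · ext y
    constructor
    · rintro ⟨e, he, rfl⟩
      exact ⟨c e, hSW he, rfl⟩
    · rintro ⟨w, hw, rfl⟩
      refine ⟨(H.symm (⟨w, (hsub hw).1⟩, i) : E), hSeq ▸ ⟨⟨w, hw⟩, trivial, rfl⟩, ?_⟩
      have := hH (H.symm (⟨w, (hsub hw).1⟩, i))
      rw [Homeomorph.apply_symm_apply] at this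
      exact congrArg Subtype.val this.symm
  · intro e he
    rw [show (fun e => (c e : X)) ⁻¹' (⟨Subtype.val '' W₀, hZ.isOpenMap_subtype_val W₀ hW₀⟩ :
      Opens X) = c ⁻¹' W₀ from hpreim]
    refine subset_antisymm ?_ (hSpre.subset_connectedComponentIn he hSW)
    exact isPreconnected_connectedComponentIn.subset_left_of_subset_union hS hS' hdis
      ((connectedComponentIn_subset _ _).trans hSS') ⟨e, mem_connectedComponentIn (hSW he), he⟩

/-- A sheet over a smaller set, contained in the image of the part of the first sheet inside `O`,
lies in the first sheet by connectedness and hence in `O` by injectivity. -/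
theorem IsCoveringMap.exists_isSheet_subset {Z : Set X} (hZ : IsOpen Z) [LocallyConnectedSpace Z]
    {c : E → Z} (hc : IsCoveringMap c) {e : E} {O : Set E} (hO : O ∈ 𝓝 e) :
    ∃ (W : Opens X) (S : Set E), e ∈ S ∧ S ⊆ O ∧ IsSheet (fun e => (c e : X)) W S := by
  obtain ⟨W, hxW, hWZ, hW⟩ := hc.exists_isSheeted hZ (c e).2 Filter.univ_mem
  obtain ⟨S, heS, hS⟩ := hW e hxW
  have himg : (fun e => (c e : X)) '' (S ∩ O) ∈ 𝓝 (c e : X) :=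
    (hZ.isOpenMap_subtype_val.comp hc.isOpenMap).image_mem_nhds
      (Filter.inter_mem (hS.isOpen.mem_nhds heS) hO)
  obtain ⟨W', hxW', hWZ', hW'⟩ := hc.exists_isSheeted hZ (c e).2 himg
  obtain ⟨S', heS', hS'⟩ := hW' e hxW'
  refine ⟨W', S', heS', fun e' he' => ?_, hS'⟩
  have hsub : S' ⊆ S := by
    refine hS.comp_subset ?_ ?_ heS' heS
    · rw [← hS'.comp_eq e heS']
      exact isPreconnected_connectedComponentIn
    · intro d hd
      have : (c d : X) ∈ (W' : Set X) := hS'.image ▸ ⟨d, hd, rfl⟩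
      obtain ⟨d', hd', hdd'⟩ := (hWZ' this).1
      exact hS.image ▸ ⟨d', hd'.1, hdd'⟩
  have : (c e' : X) ∈ (W' : Set X) := hS'.image ▸ ⟨e', he', rfl⟩
  obtain ⟨d, hd, hde⟩ := (hWZ' this).1
  exact hS.injOn hd.1 (hsub he') hde ▸ hd.2

theorem FoxPoint.ofPoint_injective {Z : Set X} (hZ : IsOpen Z) [LocallyConnectedSpace Z]
    {c : E → Z} (hc : IsCoveringMap c) :
    Function.Injective (FoxPoint.ofPoint fun e => (c e : X)) := by
  intro e e' h
  have hpt : (c e : X) = c e' := congrArg FoxPoint.pt h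
  obtain ⟨W, S, heS, -, hS⟩ := hc.exists_isSheet_subset hZ (e := e) Filter.univ_mem
  have heW : (c e : X) ∈ W := (hS.image ▸ ⟨e, heS, rfl⟩ : (c e : X) ∈ (W : Set X))
  have h1 : e' ∈ (FoxPoint.ofPoint (fun e => (c e : X)) e).comp W := by
    rw [h]
    exact FoxPoint.mem_comp_ofPoint (p := fun e => (c e : X)) (hpt ▸ heW : (c e' : X) ∈ W)
  have h2 : e' ∈ S := hS.comp_eq e heS ▸ h1
  exact hS.injOn heS h2 hpt

/-- Over the base of the covering the completion adds nothing: the chosen component over a sheeted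
set is a sheet, and it has exactly one point over `y.pt`. -/
theorem FoxPoint.exists_ofPoint_eq {Z : Set X} (hZ : IsOpen Z) [LocallyConnectedSpace Z]
    {c : E → Z} (hc : IsCoveringMap c)
    (y : FoxPoint fun e => (c e : X)) (hy : y.pt ∈ Z) :
    ∃ e, FoxPoint.ofPoint (fun e => (c e : X)) e = y := by
  have key : ∀ W : Opens X, IsSheeted (fun e => (c e : X)) W → y.pt ∈ W →
      ∃ e ∈ y.comp W, (c e : X) = y.pt := by
    intro W hW hyW
    obtain ⟨e₁, he₁⟩ := y.comp_nonempty hyW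
    obtain ⟨S, heS, hS⟩ := hW e₁ (y.comp_subset W he₁)
    rw [y.comp_eq he₁, hS.comp_eq e₁ heS]
    have : y.pt ∈ (fun e => (c e : X)) '' S := hS.image ▸ hyW
    exact this
  obtain ⟨W, hyW, -, hW⟩ := hc.exists_isSheeted hZ hy Filter.univ_mem
  obtain ⟨e, he, hpe⟩ := key W hW hyW
  obtain ⟨S, heS, hS⟩ := hW e (y.comp_subset W he)
  refine ⟨e, FoxPoint.ext_of_basis hpe fun W₀ hW₀ => ?_⟩
  obtain ⟨W', hyW', hWW', hW'⟩ := hc.exists_isSheeted hZ hy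
    ((W₀ ⊓ W).isOpen.mem_nhds ⟨hpe ▸ hW₀, hyW⟩)
  obtain ⟨e', he', hpe'⟩ := key W' hW' hyW'
  have hle : W' ≤ W₀ ⊓ W := fun x hx => (hWW' hx).1
  have h1 : e' ∈ y.comp W := y.mono _ _ (hle.trans inf_le_right) he'
  rw [y.comp_eq he, hS.comp_eq e heS] at h1
  -- The point found over the smaller set lies in the same sheet `S` over the same base point, so
  -- the choice of `e` does not depend on the neighbourhood.
  obtain rfl : e' = e := hS.injOn h1 heS (hpe'.trans hpe.symm)
  exact ⟨W', hle.trans inf_le_left, e', FoxPoint.mem_comp_ofPoint (p := fun e => (c e : X))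
    (hpe'.symm ▸ hyW' : (c e' : X) ∈ W'), he'⟩

theorem FoxPoint.isOpenMap_ofPoint {Z : Set X} (hZ : IsOpen Z) [LocallyConnectedSpace Z]
    {c : E → Z} (hc : IsCoveringMap c) :
    IsOpenMap (FoxPoint.ofPoint fun e => (c e : X)) := by
  intro O hO
  rw [isOpen_iff_mem_nhds]
  rintro _ ⟨e, he, rfl⟩
  obtain ⟨W, S, heS, hSO, hS⟩ := hc.exists_isSheet_subset hZ (hO.mem_nhds he)
  obtain ⟨W', hxW', hWZ', -⟩ := hc.exists_isSheeted hZ (c e).2 Filter.univ_mem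
  have heW : (c e : X) ∈ W := (hS.image ▸ ⟨e, heS, rfl⟩ : (c e : X) ∈ (W : Set X))
  rw [FoxPoint.mem_nhds_iff]
  refine ⟨W, heW, fun y hyW hy => ?_⟩
  have hyZ : y.pt ∈ Z := by
    have : y.pt ∈ (fun e => (c e : X)) '' S := hS.image ▸ hyW
    obtain ⟨d, -, hd⟩ := this
    rw [← hd]
    exact (c d).2
  obtain ⟨e', rfl⟩ := FoxPoint.exists_ofPoint_eq hZ hc y hyZ
  refine ⟨e', hSO ?_, rfl⟩
  rw [← hS.comp_eq e heS]
  have := FoxPoint.mem_comp_ofPoint (p := fun e => (c e : X)) (e := e') hyW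
  rw [hy] at this
  exact this

end Sheets

theorem FoxPoint.exists_disjoint_comp {X E : Type*} [TopologicalSpace X] [TopologicalSpace E]
    {p : E → X} {y y' : FoxPoint p} (hpt : y.pt = y'.pt) (hne : y ≠ y') :
    ∃ W : Opens X, y.pt ∈ W ∧ ∀ W' ≤ W, ∀ e ∈ y.comp W', e ∉ y'.comp W' := by
  by_contra! hcon
  refine hne (FoxPoint.ext_of_basis hpt fun W hW => ?_)
  obtain ⟨W', hW', e, he, he'⟩ := hcon W hW
  exact ⟨W', hW', e, he, he'⟩

theorem IsSheet.isPreconnected_inter_preimage {X E : Type*} [TopologicalSpace X]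
    [TopologicalSpace E] {p : E → X} (hp : IsOpenMap p) {W : Opens X} {S : Set E}
    (hS : IsSheet p W S) {T : Set X} (hT : IsPreconnected T) (hTW : T ⊆ W) :
    IsPreconnected (S ∩ p ⁻¹' T) := by
  have h : IsPreconnected ((fun e : S => p e) ⁻¹' T) := by
    refine hT.preimage_of_isOpenMap (fun e e' h => Subtype.ext (hS.injOn e.2 e'.2 h))
      (hp.comp hS.isOpen.isOpenMap_subtype_val) fun x hx => ?_
    have : x ∈ p '' S := hS.image ▸ hTW hx
    obtain ⟨e, he, rfl⟩ := this
    exact ⟨⟨e, he⟩, rfl⟩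
  have h2 := h.image Subtype.val continuous_subtype_val.continuousOn
  rwa [show Subtype.val '' ((fun e : S => p e) ⁻¹' T) = S ∩ p ⁻¹' T from
    Subtype.image_preimage_coe S (p ⁻¹' T)] at h2

theorem IsSheet.apply_mem {X E : Type*} [TopologicalSpace X]
    [TopologicalSpace E] {p : E → X} {W : Opens X} {S : Set E}
    (hS : IsSheet p W S) {e : E} (he : e ∈ S) : p e ∈ W := by
  have : p e ∈ (W : Set X) := hS.image ▸ ⟨e, he, rfl⟩
  exact this

namespace IsLocalUniformization

variable {X : Type u} [TopologicalSpace X] [StructureSheaf X] {n : ℕ}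
  {G : Subgroup (GL (Fin n) ℂ)} {D : Set (Fin n → ℂ)} {q : (Fin n → ℂ) → X} {a : X}

theorem exists_convex_nhds (h : IsLocalUniformization G D q a) {z : Fin n → ℂ} (hz : z ∈ D)
    {O : Set X} (hO : O ∈ 𝓝 (q z)) {V₀ : Set (Fin n → ℂ)} (hV₀ : V₀ ∈ 𝓝 z) :
    ∃ V : Set (Fin n → ℂ), IsOpen V ∧ Convex ℝ V ∧ z ∈ V ∧ V ⊆ D ∩ V₀ ∧ q '' V ⊆ O := by
  have h1 : q ⁻¹' O ∩ (D ∩ V₀) ∈ 𝓝 z := Filter.inter_mem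
    ((h.continuousOn.continuousAt (h.isOpen.mem_nhds hz)).preimage_mem_nhds hO)
    (Filter.inter_mem (h.isOpen.mem_nhds hz) hV₀)
  obtain ⟨ε, hε, hb⟩ := Metric.mem_nhds_iff.1 h1
  exact ⟨Metric.ball z ε, Metric.isOpen_ball, convex_ball _ _, Metric.mem_ball_self hε,
    fun w hw => (hb hw).2, Set.image_subset_iff.2 fun w hw => (hb hw).1⟩

end IsLocalUniformization

/-! ### Lifts of uniformizations and their extension to the completion. -/

section Lifts

variable {X : Type u} [TopologicalSpace X] [StructureSheaf X] {E : Type*} [TopologicalSpace E]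
  {c : E → smoothLocus X} {n : ℕ}
  {G : Subgroup (GL (Fin n) ℂ)} {D : Set (Fin n → ℂ)} {q : (Fin n → ℂ) → X} {a : X}

/-- A lift to a covering of the smooth locus, over the free locus of a local uniformization. -/
structure IsLift (c : E → smoothLocus X) (G : Subgroup (GL (Fin n) ℂ)) (D : Set (Fin n → ℂ))
    (q : (Fin n → ℂ) → X) (l : (Fin n → ℂ) → E) : Prop where
  continuousOn : ContinuousOn l (D ∩ freeLocus G)
  map_eq : ∀ z ∈ D ∩ freeLocus G, (c (l z) : X) = q z

/-- The codimension hypothesis enters here: the free part of `D` remains simply connected, so the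
lifting criterion imposes no condition. -/
theorem IsLocalUniformization.exists_lift (h : IsLocalUniformization G D q a)
    (hD : SimplyConnectedSpace D) (hc : IsCoveringMap c) {z : Fin n → ℂ}
    (hz : z ∈ D ∩ freeLocus G) {e : E} (he : (c e : X) = q z) : ∃ l, IsLift c G D q l ∧ l z = e := by
  classical
  have := h.small.simplyConnectedSpace_inter_freeLocus h.isOpen hD
  have : LocallyPathConnectedSpace ↥(D ∩ freeLocus G) :=
    (h.isOpen.inter h.small.isOpen_freeLocus).locallyPathConnectedSpace
  let f : C(↥(D ∩ freeLocus G), smoothLocus X) :=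
    ⟨fun w => ⟨q w, h.mem_smoothLocus w.2⟩, (continuousOn_iff_continuous_domRestrict.1
      (h.continuousOn.mono Set.inter_subset_left)).subtype_mk _⟩
  obtain ⟨F, ⟨hF0, hF⟩, -⟩ := hc.existsUnique_continuousMap_lifts f ⟨z, hz⟩ e (Subtype.ext he)
  obtain ⟨l, hl⟩ : ∃ l : (Fin n → ℂ) → E, ∀ w (hw : w ∈ D ∩ freeLocus G), l w = F ⟨w, hw⟩ :=
    ⟨fun w => if hw : w ∈ D ∩ freeLocus G then F ⟨w, hw⟩ else e, fun w hw => dif_pos hw⟩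
  refine ⟨l, ⟨?_, fun w hw => ?_⟩, ?_⟩
  · rw [continuousOn_iff_continuous_domRestrict]
    refine F.continuous.congr fun w => ?_
    exact (hl w w.2).symm
  · rw [hl w hw]
    exact congrArg Subtype.val (congrFun hF ⟨w, hw⟩)
  · rw [hl z hz, hF0]

namespace IsLift

variable {l l' : (Fin n → ℂ) → E}

theorem eqOn (hl : IsLift c G D q l) (hl' : IsLift c G D q l') (hc : IsCoveringMap c)
    {T : Set (Fin n → ℂ)} (hT : IsPreconnected T) (hTD : T ⊆ D ∩ freeLocus G) {z : Fin n → ℂ}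
    (hz : z ∈ T) (h : l z = l' z) : Set.EqOn l l' T :=
  hc.eqOn_of_comp_eqOn hT (hl.continuousOn.mono hTD) (hl'.continuousOn.mono hTD)
    (fun w hw => Subtype.ext ((hl.map_eq w (hTD hw)).trans (hl'.map_eq w (hTD hw)).symm)) hz h

theorem comp_mulVec (hl : IsLift c G D q l) (h : IsLocalUniformization G D q a)
    {g : GL (Fin n) ℂ} (hg : g ∈ G) :
    IsLift c G D q fun z => l ((g : Matrix (Fin n) (Fin n) ℂ).mulVec z) where
  continuousOn := hl.continuousOn.comp (continuous_GL_mulVec g).continuousOn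
    fun z hz => ⟨h.stable g hg z hz.1, mulVec_mem_freeLocus hg hz.2⟩
  map_eq z hz := by
    rw [hl.map_eq _ ⟨h.stable g hg z hz.1, mulVec_mem_freeLocus hg hz.2⟩, h.map_mulVec hg hz.1]

theorem isOpen_image (hl : IsLift c G D q l) (h : IsLocalUniformization G D q a)
    (hc : IsCoveringMap c) {V : Set (Fin n → ℂ)} (hV : IsOpen V) (hVD : V ⊆ D ∩ freeLocus G) :
    IsOpen (l '' V) := by
  rw [isOpen_iff_mem_nhds]
  rintro _ ⟨z, hz, rfl⟩
  obtain ⟨W, S, heS, -, hS⟩ := hc.exists_isSheet_subset isOpen_smoothLocus (e := l z)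
    Filter.univ_mem
  have hVo : IsOpen (V ∩ l ⁻¹' S) := (hl.continuousOn.mono hVD).isOpen_inter_preimage hV hS.isOpen
  have hqo := h.isOpen_image _ (Set.inter_subset_left.trans (hVD.trans Set.inter_subset_left)) hVo
  have hcont : Continuous fun e => (c e : X) := continuous_subtype_val.comp hc.continuous
  filter_upwards [hS.isOpen.mem_nhds heS, (hqo.preimage hcont).mem_nhds
    ⟨z, ⟨hz, heS⟩, (hl.map_eq z (hVD hz)).symm⟩]
  rintro e he ⟨w, ⟨hw, hwS⟩, hwe⟩
  exact ⟨w, hw, hS.injOn hwS he ((hl.map_eq w (hVD hw)).trans hwe)⟩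

theorem recenter (hl : IsLift c G D q l) {z : Fin n → ℂ} {D' : Set (Fin n → ℂ)}
    {G' : Subgroup (GL (Fin n) ℂ)}
    (hD' : ∀ w ∈ D', z + w ∈ D) (hf : ∀ w ∈ D', (z + w ∈ freeLocus G ↔ w ∈ freeLocus G')) :
    IsLift c G' D' (fun w => q (z + w)) fun w => l (z + w) where
  continuousOn := hl.continuousOn.comp (continuous_const.add continuous_id).continuousOn
    fun w hw => ⟨hD' w hw.1, (hf w hw.1).2 hw.2⟩
  map_eq w hw := hl.map_eq _ ⟨hD' w hw.1, (hf w hw.1).2 hw.2⟩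

end IsLift

/-- A local uniformization with a lift `l` over its free locus to a covering `c` of the smooth
locus, and the extension `q'` of this lift to the completion of the covering. -/
structure IsFoxChart (c : E → smoothLocus X) (G : Subgroup (GL (Fin n) ℂ)) (D : Set (Fin n → ℂ))
    (q : (Fin n → ℂ) → X) (a : X) (l : (Fin n → ℂ) → E)
    (q' : (Fin n → ℂ) → FoxPoint fun e => (c e : X)) : Prop where
  unif : IsLocalUniformization G D q a
  preconn : IsPreconnected D
  lift : IsLift c G D q l
  pt_eq : ∀ z ∈ D, (q' z).pt = q z
  mem_comp : ∀ z ∈ D, ∀ V ⊆ D, IsOpen V → IsPreconnected V → z ∈ V → ∀ W : Opens X, q '' V ⊆ W →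
    ∀ v ∈ V ∩ freeLocus G, l v ∈ (q' z).comp W

/-- The extension at `z` selects, over each `W`, the component containing the values of the lift at
free points near `z`. This is unambiguous because a connected open `V` has connected free part. -/
theorem IsLift.exists_isFoxChart {l : (Fin n → ℂ) → E} (hl : IsLift c G D q l)
    (h : IsLocalUniformization G D q a) (hD : IsPreconnected D) : ∃ q', IsFoxChart c G D q a l q' := by
  have hex : ∀ z : D, ∃ y : FoxPoint fun e => (c e : X), y.pt = q z ∧
      ∀ V ⊆ D, IsOpen V → IsPreconnected V → z.1 ∈ V → ∀ W : Opens X, q '' V ⊆ W →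
        ∀ v ∈ V ∩ freeLocus G, l v ∈ y.comp W := by
    rintro ⟨z, hz⟩
    have key : ∀ V ⊆ D, IsOpen V → IsPreconnected V → z ∈ V → ∀ V' ⊆ D, IsOpen V' →
        IsPreconnected V' → z ∈ V' → ∀ W : Opens X, q '' V ⊆ W → q '' V' ⊆ W →
        ∀ v ∈ V ∩ freeLocus G, ∀ v' ∈ V' ∩ freeLocus G,
          connectedComponentIn ((fun e => (c e : X)) ⁻¹' W) (l v) =
            connectedComponentIn ((fun e => (c e : X)) ⁻¹' W) (l v') := by
      intro V hVD hV hVc hzV V' hV'D hV' hVc' hzV' W hW hW' v hv v' hv'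
      have main : ∀ V ⊆ D, IsOpen V → IsPreconnected V → q '' V ⊆ W → ∀ v ∈ V ∩ freeLocus G,
          ∀ v' ∈ V ∩ freeLocus G, connectedComponentIn ((fun e => (c e : X)) ⁻¹' W) (l v) =
            connectedComponentIn ((fun e => (c e : X)) ⁻¹' W) (l v') := by
        intro V hVD hV hVc hW v hv v' hv'
        have hsub : V ∩ freeLocus G ⊆ D ∩ freeLocus G := Set.inter_subset_inter_left _ hVD
        have hpre : IsPreconnected (l '' (V ∩ freeLocus G)) :=
          (h.small.isPreconnected_inter_freeLocus hV hVc).image l (hl.continuousOn.mono hsub)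
        refine connectedComponentIn_eq (hpre.subset_connectedComponentIn ⟨v, hv, rfl⟩ ?_
          ⟨v', hv', rfl⟩)
        rintro _ ⟨w, hw, rfl⟩
        exact hW ⟨w, hw.1, (hl.map_eq w (hsub hw)).symm⟩
      -- Two admissible neighbourhoods of `z` share a free point, through which their components are
      -- compared.
      obtain ⟨u, huV, huf⟩ := mem_closure_iff.1 (h.small.dense_freeLocus z) (V ∩ V')
        (hV.inter hV') ⟨hzV, hzV'⟩
      exact (main V hVD hV hVc hW v hv u ⟨huV.1, huf⟩).trans
        (main V' hV'D hV' hVc' hW' u ⟨huV.2, huf⟩ v' hv')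
    have hnear : ∀ W : Opens X, q z ∈ W → ∃ V ⊆ D, IsOpen V ∧ IsPreconnected V ∧ z ∈ V ∧
        q '' V ⊆ W ∧ ∃ v ∈ V ∩ freeLocus G, (c (l v) : X) ∈ W := by
      intro W hW
      obtain ⟨V, hV, hVc, hzV, hVD, hVW⟩ := h.exists_convex_nhds hz (W.isOpen.mem_nhds hW)
        Filter.univ_mem
      obtain ⟨v, hvV, hvf⟩ := mem_closure_iff.1 (h.small.dense_freeLocus z) V hV hzV
      refine ⟨V, fun w hw => (hVD hw).1, hV, hVc.isPreconnected, hzV, hVW, v, ⟨hvV, hvf⟩, ?_⟩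
      rw [hl.map_eq v ⟨(hVD hvV).1, hvf⟩]
      exact hVW ⟨v, hvV, rfl⟩
    refine ⟨⟨q z, fun W => {e | ∃ V ⊆ D, IsOpen V ∧ IsPreconnected V ∧ z ∈ V ∧ q '' V ⊆ W ∧
      ∃ v ∈ V ∩ freeLocus G, e ∈ connectedComponentIn ((fun e => (c e : X)) ⁻¹' W) (l v)},
      ?_, ?_, ?_⟩, rfl, ?_⟩
    · intro W hW
      obtain ⟨V, hVD, hV, hVc, hzV, hVW, v, hv, hvW⟩ := hnear W hW
      refine ⟨l v, hvW, subset_antisymm ?_ fun e he => ⟨V, hVD, hV, hVc, hzV, hVW, v, hv, he⟩⟩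
      rintro e ⟨V', hV'D, hV', hVc', hzV', hVW', v', hv', he⟩
      rwa [key V hVD hV hVc hzV V' hV'D hV' hVc' hzV' W hVW hVW' v hv v' hv']
    · rintro W W' hWW' e ⟨V, hVD, hV, hVc, hzV, hVW, v, hv, he⟩
      exact ⟨V, hVD, hV, hVc, hzV, hVW.trans hWW', v, hv,
        connectedComponentIn_mono _ (Set.preimage_mono hWW') he⟩
    · intro W hW
      refine Set.eq_empty_of_forall_notMem ?_
      rintro e ⟨V, hVD, hV, hVc, hzV, hVW, v, hv, he⟩
      exact hW (hVW ⟨z, hzV, rfl⟩)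
    · intro V hVD hV hVc hzV W hVW v hv
      refine ⟨V, hVD, hV, hVc, hzV, hVW, v, hv, mem_connectedComponentIn ?_⟩
      have := hl.map_eq v ⟨hVD hv.1, hv.2⟩
      rw [Set.mem_preimage, this]
      exact hVW ⟨v, hv.1, rfl⟩
  choose Q hQ using hex
  classical
  obtain ⟨q', hQ'⟩ : ∃ q' : (Fin n → ℂ) → FoxPoint fun e => (c e : X),
      ∀ z (hz : z ∈ D), q' z = Q ⟨z, hz⟩ :=
    ⟨fun z => if hz : z ∈ D then Q ⟨z, hz⟩ else Q ⟨0, h.zero_mem⟩, fun z hz => dif_pos hz⟩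
  refine ⟨q', h, hD, hl, ?_, ?_⟩
  · intro z hz
    rw [hQ' z hz]
    exact (hQ ⟨z, hz⟩).1
  · intro z hz
    rw [hQ' z hz]
    exact (hQ ⟨z, hz⟩).2

namespace IsFoxChart

variable {l : (Fin n → ℂ) → E} {q' : (Fin n → ℂ) → FoxPoint fun e => (c e : X)}

theorem eq_ofPoint (h : IsFoxChart c G D q a l q') {z : Fin n → ℂ} (hz : z ∈ D ∩ freeLocus G) :
    q' z = FoxPoint.ofPoint (fun e => (c e : X)) (l z) := by
  have hpt : (q' z).pt = c (l z) := (h.pt_eq z hz.1).trans (h.lift.map_eq z hz).symm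
  refine FoxPoint.ext_of_basis hpt fun W hW => ⟨W, le_rfl, l z, ?_, ?_⟩
  · obtain ⟨V, hV, hVc, hzV, hVD, hVW⟩ := h.unif.exists_convex_nhds hz.1
      (W.isOpen.mem_nhds (h.pt_eq z hz.1 ▸ hW)) Filter.univ_mem
    exact h.mem_comp z hz.1 V (fun w hw => (hVD hw).1) hV hVc.isPreconnected hzV W hVW z
      ⟨hzV, hz.2⟩
  · exact FoxPoint.mem_comp_ofPoint (p := fun e => (c e : X)) (hpt ▸ hW : (c (l z) : X) ∈ W)

theorem continuousOn (h : IsFoxChart c G D q a l q') : ContinuousOn q' D := by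
  refine fun z hz => ContinuousAt.continuousWithinAt fun S hS => ?_
  obtain ⟨W, hW, hWS⟩ := FoxPoint.mem_nhds_iff.1 hS
  obtain ⟨V, hV, hVc, hzV, hVD, hVW⟩ := h.unif.exists_convex_nhds hz
    (W.isOpen.mem_nhds (h.pt_eq z hz ▸ hW)) Filter.univ_mem
  have hVD' : V ⊆ D := fun w hw => (hVD hw).1
  rw [Filter.mem_map]
  refine Filter.mem_of_superset (hV.mem_nhds hzV) fun z' hz' => hWS _ ?_ ?_
  · rw [h.pt_eq z' (hVD' hz')]
    exact hVW ⟨z', hz', rfl⟩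
  · obtain ⟨v, hvV, hvf⟩ := mem_closure_iff.1 (h.unif.small.dense_freeLocus z) V hV hzV
    exact FoxPoint.comp_eq_comp
      (h.mem_comp z' (hVD' hz') V hVD' hV hVc.isPreconnected hz' W hVW v ⟨hvV, hvf⟩)
      (h.mem_comp z hz V hVD' hV hVc.isPreconnected hzV W hVW v ⟨hvV, hvf⟩)

theorem recenter (h : IsFoxChart c G D q a l q') {z : Fin n → ℂ} (hz : z ∈ D)
    {O : Set (Fin n → ℂ)} (hO : IsOpen O) (hzO : z ∈ O) :
    ∃ D' : Set (Fin n → ℂ), (∀ w ∈ D', z + w ∈ D ∩ O) ∧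
      IsFoxChart c (pointStabilizer G z) D' (fun w => q (z + w)) (q z) (fun w => l (z + w))
        (fun w => q' (z + w)) := by
  obtain ⟨D', hD'c, hD', hu, hf⟩ := h.unif.exists_recenter hz hO hzO
  refine ⟨D', hD', hu, hD'c.isPreconnected, h.lift.recenter (fun w hw => (hD' w hw).1) hf,
    fun w hw => h.pt_eq _ (hD' w hw).1, fun w hw V hVD' hV hVc hwV W hVW v hv => ?_⟩
  refine h.mem_comp _ (hD' w hw).1 ((fun w => z + w) '' V) ?_ ((Homeomorph.addLeft z).isOpenMap V hV)
    (hVc.image _ (continuous_const.add continuous_id).continuousOn) ⟨w, hwV, rfl⟩ W ?_ _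
    ⟨⟨v, hv.1, rfl⟩, (hf v (hVD' hv.1)).2 hv.2⟩
  · rintro _ ⟨w, hw, rfl⟩
    exact (hD' w (hVD' hw)).1
  · rwa [Set.image_image]

end IsFoxChart

end Lifts

/-! ### Charts of the completion as quotients. -/

section FoxCharts

variable {X : Type u} [TopologicalSpace X] [StructureSheaf X] {E : Type*} [TopologicalSpace E]
  {c : E → smoothLocus X} {n : ℕ}
  {G : Subgroup (GL (Fin n) ℂ)} {D : Set (Fin n → ℂ)} {q : (Fin n → ℂ) → X} {a : X}

namespace IsLift

variable {l : (Fin n → ℂ) → E}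

/-- The image of a lift is also closed over the image of the free locus. If a point of the sheet
through `e` is a value of the lift, a translate of the lift by the group stays in that sheet over a
connected neighbourhood and attains `e`. -/
theorem isOpen_diff_image (hl : IsLift c G D q l) (h : IsLocalUniformization G D q a)
    (hc : IsCoveringMap c) :
    IsOpen {e | (c e : X) ∈ q '' (D ∩ freeLocus G) ∧ e ∉ l '' (D ∩ freeLocus G)} := by
  rw [isOpen_iff_mem_nhds]
  rintro e ⟨⟨z, hz, hze⟩, he⟩
  have hDf : IsOpen (D ∩ freeLocus G) := h.isOpen.inter h.small.isOpen_freeLocus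
  obtain ⟨W, S, heS, -, hS⟩ := hc.exists_isSheet_subset isOpen_smoothLocus (e := e)
    Filter.univ_mem
  have heW : q z ∈ W := hze ▸ hS.apply_mem heS
  obtain ⟨V, hV, hVc, hzV, hVD, hVW⟩ := h.exists_convex_nhds hz.1 (W.isOpen.mem_nhds heW)
    (hDf.mem_nhds hz)
  have hcont : Continuous fun e => (c e : X) := continuous_subtype_val.comp hc.continuous
  have hqV := (h.isOpen_image V (fun w hw => (hVD hw).1) hV).preimage hcont
  filter_upwards [hS.isOpen.mem_nhds heS, hqV.mem_nhds ⟨z, hzV, hze⟩]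
  rintro e₁ he₁ ⟨v, hv, hve⟩
  refine ⟨⟨v, (hVD hv).2, hve⟩, ?_⟩
  rintro ⟨w, hw, rfl⟩
  have hqw : q v = q w := hve.trans (hl.map_eq w hw)
  obtain ⟨g, hg, rfl⟩ := (h.fibre v (hVD hv).1 w hw.1).1 hqw
  have hlg := hl.comp_mulVec h hg
  have hsub : (fun z => l ((g : Matrix (Fin n) (Fin n) ℂ).mulVec z)) '' V ⊆ S := by
    refine hS.comp_subset (hVc.isPreconnected.image _ (hlg.continuousOn.mono fun w hw =>
      (hVD hw).2)) ?_ ⟨v, hv, rfl⟩ he₁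
    rintro _ ⟨w, hw, rfl⟩
    exact hVW ⟨w, hw, (hlg.map_eq w (hVD hw).2).symm⟩
  refine he ⟨_, ⟨h.stable g hg z hz.1, mulVec_mem_freeLocus hg hz.2⟩, ?_⟩
  exact hS.injOn (hsub ⟨z, hzV, rfl⟩) heS ((hlg.map_eq z hz).trans hze)

/-- A connected subset of the preimage of a local uniformization that meets the image of a lift
is contained in it, over the image of the free locus. -/
theorem inter_subset_image (hl : IsLift c G D q l) (h : IsLocalUniformization G D q a)
    (hc : IsCoveringMap c) {M : Set E} (hM : IsPreconnected M)
    (hMo : IsOpen M) (hMD : ∀ e ∈ M, (c e : X) ∈ q '' D) {z₀ : Fin n → ℂ}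
    (hz₀ : z₀ ∈ D ∩ freeLocus G) (hMz₀ : l z₀ ∈ M) :
    M ∩ {e | (c e : X) ∈ q '' (D ∩ freeLocus G)} ⊆ l '' (D ∩ freeLocus G) := by
  have hDf : IsOpen (D ∩ freeLocus G) := h.isOpen.inter h.small.isOpen_freeLocus
  have hpo : IsOpenMap fun e => (c e : X) := isOpen_smoothLocus.isOpenMap_subtype_val.comp hc.isOpenMap
  -- Points of `M` whose image is not known to come from the free locus are discarded; what is left
  -- is dense and locally connected in `M`, hence connected.
  have hMf : IsPreconnected (M ∩ {e | (c e : X) ∈ q '' (D ∩ freeLocus G)}) := by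
    refine isPreconnected_of_dense_of_locally hM Set.inter_subset_left ?_ fun e he => ?_
    · intro e he
      rw [mem_closure_iff]
      intro O hO heO
      obtain ⟨x, ⟨e', he', hxe'⟩, hx⟩ := mem_closure_iff.1
        (h.image_subset_closure h.isOpen subset_rfl (hMD e he)) _ (hpo _ (hO.inter hMo))
        ⟨e, ⟨heO, he⟩, rfl⟩
      refine ⟨e', he'.1, he'.2, ?_⟩
      change (c e' : X) ∈ q '' (D ∩ freeLocus G)
      exact (show (c e' : X) = x from hxe') ▸ hx
    · obtain ⟨z, hz, hze⟩ := hMD e he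
      obtain ⟨W, S, heS, hSM, hS⟩ := hc.exists_isSheet_subset isOpen_smoothLocus (hMo.mem_nhds he)
      have heW : q z ∈ W := hze ▸ hS.apply_mem heS
      obtain ⟨V, hV, hVc, hzV, hVD, hVW⟩ := h.exists_convex_nhds hz (W.isOpen.mem_nhds heW)
        Filter.univ_mem
      have hVD' : V ⊆ D := fun w hw => (hVD hw).1
      have hcont : Continuous fun e => (c e : X) := continuous_subtype_val.comp hc.continuous
      have hqV := (h.isOpen_image V hVD' hV).preimage hcont
      refine ⟨S ∩ (fun e => (c e : X)) ⁻¹' (q '' V), Filter.inter_mem (hS.isOpen.mem_nhds heS)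
        (hqV.mem_nhds ⟨z, hzV, hze⟩), ?_⟩
      have hpre := hS.isPreconnected_inter_preimage hpo
        ((h.small.isPreconnected_inter_freeLocus hV hVc.isPreconnected).image q
          (h.continuousOn.mono (Set.inter_subset_left.trans hVD')))
        ((Set.image_mono Set.inter_subset_left).trans hVW)
      convert hpre using 1
      ext e'
      constructor
      · rintro ⟨⟨he'S, v, hv, hve⟩, -, w, hw, hwe⟩
        have := h.mem_freeLocus_of_map_eq hw (hVD' hv) (hwe.trans hve.symm)
        exact ⟨he'S, v, ⟨hv, this⟩, hve⟩
      · rintro ⟨he'S, v, hv, hve⟩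
        exact ⟨⟨he'S, v, hv.1, hve⟩, hSM he'S, v, ⟨hVD' hv.1, hv.2⟩, hve⟩
  refine hMf.subset_left_of_subset_union (hl.isOpen_image h hc hDf subset_rfl)
    (hl.isOpen_diff_image h hc) ?_ ?_ ?_
  · exact Set.disjoint_left.2 fun e he he' => he'.2 he
  · intro e he
    by_cases h' : e ∈ l '' (D ∩ freeLocus G)
    · exact Or.inl h'
    · exact Or.inr ⟨he.2, h'⟩
  · exact ⟨l z₀, ⟨hMz₀, z₀, hz₀, (hl.map_eq z₀ hz₀).symm⟩, z₀, hz₀, rfl⟩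

end IsLift

namespace IsFoxChart

variable {l : (Fin n → ℂ) → E} {q' : (Fin n → ℂ) → FoxPoint fun e => (c e : X)}

/-- The image of a local uniformization, as an open set. -/
def _root_.IsLocalUniformization.opens (h : IsLocalUniformization G D q a) : Opens X :=
  ⟨q '' D, h.isOpen_range⟩

/-- A chosen component has open image in X, so it contains a point over the dense image of the free
locus. -/
theorem exists_mem_comp_inter (hc : IsCoveringMap c) (h : IsLocalUniformization G D q a)
    (y : FoxPoint fun e => (c e : X)) {V : Set (Fin n → ℂ)} (hV : IsOpen V) (hVD : V ⊆ D)
    {W : Opens X} (hWV : (W : Set X) ⊆ q '' V) (hyW : y.pt ∈ W) :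
    ∃ v ∈ V ∩ freeLocus G, ∃ e ∈ y.comp W, (c e : X) = q v := by
  have hloc : LocallyPathConnectedSpace E := hc.isLocalHomeomorph.locallyPathConnectedSpace
  have hcont : Continuous fun e => (c e : X) := continuous_subtype_val.comp hc.continuous
  have hpo : IsOpenMap fun e => (c e : X) := isOpen_smoothLocus.isOpenMap_subtype_val.comp hc.isOpenMap
  obtain ⟨e₀, he₀⟩ := y.comp_nonempty hyW
  obtain ⟨x, ⟨e, he, hex⟩, v, hv, hvx⟩ := mem_closure_iff.1
    (h.image_subset_closure hV hVD (hWV (y.comp_subset W he₀))) _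
    (hpo _ (FoxPoint.isOpen_comp hcont y W)) ⟨e₀, he₀, rfl⟩
  exact ⟨v, hv, e, he, hex.trans hvx.symm⟩

/-- Over `y.pt` the chart takes only the values at the finitely many translates of one preimage
`z₁`. If `y` were none of them, a single small open set would separate its component from all
theirs; but that component contains a value of the lift near some translate. -/
theorem exists_map_eq (h : IsFoxChart c G D q a l q') (hc : IsCoveringMap c)
    (y : FoxPoint fun e => (c e : X)) (hy : y.pt ∈ q '' D) {z₀ : Fin n → ℂ}
    (hz₀ : z₀ ∈ D ∩ freeLocus G) (hyz₀ : l z₀ ∈ y.comp h.unif.opens) : ∃ z ∈ D, q' z = y := by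
  have hloc : LocallyPathConnectedSpace E := hc.isLocalHomeomorph.locallyPathConnectedSpace
  have hcont : Continuous fun e => (c e : X) := continuous_subtype_val.comp hc.continuous
  have hfin := h.unif.small.finite
  have hsub := h.lift.inter_subset_image h.unif hc (y.isPreconnected_comp h.unif.opens)
    (FoxPoint.isOpen_comp hcont y _) (fun e he => y.comp_subset _ he) hz₀ hyz₀
  obtain ⟨z₁, hz₁, hz₁y⟩ := hy
  by_contra! hcon
  have hex : ∀ g : G, ∃ (W : Opens X) (V : Set (Fin n → ℂ)), y.pt ∈ W ∧
      (∀ e ∈ y.comp W, e ∉ (q' (((g : GL (Fin n) ℂ) : Matrix (Fin n) (Fin n) ℂ).mulVec z₁)).comp W) ∧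
      IsOpen V ∧ IsPreconnected V ∧ ((g : GL (Fin n) ℂ) : Matrix (Fin n) (Fin n) ℂ).mulVec z₁ ∈ V ∧
      V ⊆ D ∧ q '' V ⊆ W := by
    intro g
    have hgz := h.unif.stable g g.2 z₁ hz₁
    have hq : q (((g : GL (Fin n) ℂ) : Matrix (Fin n) (Fin n) ℂ).mulVec z₁) = y.pt := by
      rw [h.unif.map_mulVec g.2 hz₁, hz₁y]
    have hpt : y.pt = (q' (((g : GL (Fin n) ℂ) : Matrix (Fin n) (Fin n) ℂ).mulVec z₁)).pt := by
      rw [h.pt_eq _ hgz, hq]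
    obtain ⟨W, hyW, hW⟩ := FoxPoint.exists_disjoint_comp hpt (hcon _ hgz).symm
    obtain ⟨V, hV, hVc, hzV, hVD, hVW⟩ := h.unif.exists_convex_nhds hgz
      (W.isOpen.mem_nhds (hq ▸ hyW)) Filter.univ_mem
    exact ⟨W, V, hyW, hW W le_rfl, hV, hVc.isPreconnected, hzV, fun w hw => (hVD hw).1, hVW⟩
  choose W V hyW hdis hV hVc hzV hVD hVW using hex
  -- All translates of `V₁` stay in the chosen neighbourhoods, so the image of `V₁` lies in every `W
  -- g` and serves all the separations at once.
  let V₁ : Set (Fin n → ℂ) := ⋂ g : G,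
    (fun z => ((g : GL (Fin n) ℂ) : Matrix (Fin n) (Fin n) ℂ).mulVec z) ⁻¹' V g
  have hV₁ : IsOpen V₁ := isOpen_iInter_of_finite fun g => (hV g).preimage (continuous_GL_mulVec _)
  have hzV₁ : z₁ ∈ V₁ := Set.mem_iInter.2 hzV
  have hV₁D : V₁ ⊆ D := fun w hw => by
    have : (((1 : G) : GL (Fin n) ℂ) : Matrix (Fin n) (Fin n) ℂ).mulVec w ∈ D :=
      hVD _ (Set.mem_iInter.1 hw 1)
    rwa [OneMemClass.coe_one, GL_one_mulVec] at this
  let W₁ : Opens X := ⟨q '' V₁, h.unif.isOpen_image V₁ hV₁D hV₁⟩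
  have hW₁ : ∀ g, W₁ ≤ W g := by
    rintro g _ ⟨w, hw, rfl⟩
    rw [← h.unif.map_mulVec g.2 (hV₁D hw)]
    exact hVW g ⟨_, Set.mem_iInter.1 hw g, rfl⟩
  obtain ⟨v, hv, e, he, hev⟩ := exists_mem_comp_inter hc h.unif y hV₁ hV₁D (W := W₁) subset_rfl
    ⟨z₁, hzV₁, hz₁y⟩
  have hvD : v ∈ D := hV₁D hv.1
  obtain ⟨w, hw, rfl⟩ := hsub ⟨y.mono W₁ h.unif.opens (Set.image_mono hV₁D) he, v,
    ⟨hvD, hv.2⟩, hev.symm⟩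
  obtain ⟨g, hg, rfl⟩ := (h.unif.fibre v hvD w hw.1).1 (hev.symm.trans (h.lift.map_eq w hw))
  refine hdis ⟨g, hg⟩ _ (y.mono W₁ _ (hW₁ _) he) ?_
  exact h.mem_comp _ (h.unif.stable g hg z₁ hz₁) (V ⟨g, hg⟩) (hVD _) (hV _) (hVc _) (hzV _) _
    (hVW _) _ ⟨Set.mem_iInter.1 hv.1 ⟨g, hg⟩, hw.2⟩

theorem _root_.IsLocalUniformization.exists_isFoxChart (h : IsLocalUniformization G D q a)
    (hD : SimplyConnectedSpace D) (hc : IsCoveringMap c) (y : FoxPoint fun e => (c e : X))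
    (hy : y.pt ∈ q '' D) : ∃ l q', IsFoxChart c G D q a l q' ∧ ∃ z ∈ D, q' z = y := by
  obtain ⟨v, hv, e, he, hev⟩ := exists_mem_comp_inter hc h y h.isOpen subset_rfl
    (W := h.opens) subset_rfl hy
  obtain ⟨l, hl, rfl⟩ := h.exists_lift hD hc hv hev
  have hpre : IsPreconnected D := isPreconnected_iff_preconnectedSpace.2 inferInstance
  obtain ⟨q', hq'⟩ := hl.exists_isFoxChart h hpre
  exact ⟨l, q', hq', hq'.exists_map_eq hc y hy hv he⟩

/-- After recentring at a point of `V`, a whole basic neighbourhood of its image consists of values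
of the smaller chart, by `exists_map_eq`. -/
theorem isOpen_image (h : IsFoxChart c G D q a l q') (hc : IsCoveringMap c)
    {V : Set (Fin n → ℂ)} (hVD : V ⊆ D) (hV : IsOpen V) : IsOpen (q' '' V) := by
  rw [isOpen_iff_mem_nhds]
  rintro _ ⟨z, hz, rfl⟩
  obtain ⟨D', hD', h'⟩ := h.recenter (hVD hz) hV hz
  obtain ⟨v, hvD', hvf⟩ := mem_closure_iff.1 (h'.unif.small.dense_freeLocus 0) D' h'.unif.isOpen
    h'.unif.zero_mem
  refine FoxPoint.mem_nhds_iff.2 ⟨h'.unif.opens, ?_, fun y hyW hy => ?_⟩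
  · rw [h.pt_eq z (hVD hz)]
    exact h'.unif.mem_image
  · have hmem := h'.mem_comp 0 h'.unif.zero_mem D' subset_rfl h'.unif.isOpen h'.preconn
      h'.unif.zero_mem h'.unif.opens subset_rfl v ⟨hvD', hvf⟩
    rw [add_zero, ← hy] at hmem
    obtain ⟨w, hw, hwy⟩ := h'.exists_map_eq hc y hyW ⟨hvD', hvf⟩ hmem
    exact ⟨_, (hD' w hw).2, hwy⟩

/-- The elements of the group that preserve the lift. -/
def liftStabilizer (h : IsFoxChart c G D q a l q') : Subgroup (GL (Fin n) ℂ) where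
  carrier := {g | g ∈ G ∧
    ∀ z ∈ D ∩ freeLocus G, l ((g : Matrix (Fin n) (Fin n) ℂ).mulVec z) = l z}
  one_mem' := ⟨G.one_mem, fun z _ => by rw [GL_one_mulVec]⟩
  mul_mem' {g g'} hg hg' := ⟨G.mul_mem hg.1 hg'.1, fun z hz => by
    rw [GL_mul_mulVec, hg.2 _ ⟨h.unif.stable g' hg'.1 z hz.1, mulVec_mem_freeLocus hg'.1 hz.2⟩,
      hg'.2 z hz]⟩
  inv_mem' {g} hg := ⟨G.inv_mem hg.1, fun z hz => by
    have := hg.2 _ ⟨h.unif.stable _ (G.inv_mem hg.1) z hz.1,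
      mulVec_mem_freeLocus (G.inv_mem hg.1) hz.2⟩
    rw [← this, GL_inv_mulVec.1 rfl]⟩

theorem liftStabilizer_le (h : IsFoxChart c G D q a l q') : h.liftStabilizer ≤ G :=
  fun _ hg => hg.1

/-- Equality holds on the free locus by definition of the stabilizer, and extends by density since
the completion is Hausdorff. -/
theorem map_mulVec [T2Space X] (h : IsFoxChart c G D q a l q') {g : GL (Fin n) ℂ}
    (hg : g ∈ h.liftStabilizer) {z : Fin n → ℂ} (hz : z ∈ D) :
    q' ((g : Matrix (Fin n) (Fin n) ℂ).mulVec z) = q' z := by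
  have hfree : Set.EqOn (fun z => q' ((g : Matrix (Fin n) (Fin n) ℂ).mulVec z)) q'
      (D ∩ freeLocus G) := by
    intro z hz
    have hgz : (g : Matrix (Fin n) (Fin n) ℂ).mulVec z ∈ D ∩ freeLocus G :=
      ⟨h.unif.stable g hg.1 z hz.1, mulVec_mem_freeLocus hg.1 hz.2⟩
    change q' ((g : Matrix (Fin n) (Fin n) ℂ).mulVec z) = q' z
    rw [h.eq_ofPoint hz, h.eq_ofPoint hgz, hg.2 z hz]
  exact hfree.of_subset_closure (h.continuousOn.comp (continuous_GL_mulVec g).continuousOn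
    (h.unif.stable g hg.1)) h.continuousOn Set.inter_subset_left
    (h.unif.small.subset_closure_inter_freeLocus h.unif.isOpen) hz

/-- Images of small neighbourhoods of `z` and `w` are open and share a point, so a free `u` near `z`
and some `g u` near `w` have the same image. The lift and its translate by `g` then agree at `u`,
hence on the connected free locus. -/
theorem fibre [T2Space X] (h : IsFoxChart c G D q a l q') (hc : IsCoveringMap c)
    {z w : Fin n → ℂ} (hz : z ∈ D) (hw : w ∈ D) :
    q' z = q' w ↔ ∃ g ∈ h.liftStabilizer, (g : Matrix (Fin n) (Fin n) ℂ).mulVec z = w := by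
  constructor
  swap
  · rintro ⟨g, hg, rfl⟩
    exact (h.map_mulVec hg hz).symm
  intro hzw
  have hfin := h.unif.small.finite
  -- The neighbourhoods are so small that an element carrying a point of one to a point of the other
  -- must carry `z` to `w`.
  have hev : ∀ᶠ p : (Fin n → ℂ) × (Fin n → ℂ) in 𝓝 (z, w), ∀ g : G,
      ((g : GL (Fin n) ℂ) : Matrix (Fin n) (Fin n) ℂ).mulVec z ≠ w →
      ((g : GL (Fin n) ℂ) : Matrix (Fin n) (Fin n) ℂ).mulVec p.1 ≠ p.2 := by
    rw [Filter.eventually_all]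
    intro g
    by_cases hg : ((g : GL (Fin n) ℂ) : Matrix (Fin n) (Fin n) ℂ).mulVec z = w
    · exact Filter.Eventually.of_forall fun _ h => absurd hg h
    · exact Filter.mem_of_superset ((isOpen_ne_fun ((continuous_GL_mulVec _).comp continuous_fst)
        continuous_snd).mem_nhds hg) fun p hp _ => hp
  rw [nhds_prod_eq, Filter.eventually_prod_iff] at hev
  obtain ⟨P, hP, Q, hQ, hPQ⟩ := hev
  have hVz : q' '' (interior {x | P x} ∩ D) ∈ 𝓝 (q' z) :=
    (h.isOpen_image hc Set.inter_subset_right (isOpen_interior.inter h.unif.isOpen)).mem_nhds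
      ⟨z, ⟨mem_interior_iff_mem_nhds.2 hP, hz⟩, rfl⟩
  have hVw : q' '' (interior {x | Q x} ∩ D) ∈ 𝓝 (q' z) :=
    (h.isOpen_image hc Set.inter_subset_right (isOpen_interior.inter h.unif.isOpen)).mem_nhds
      ⟨w, ⟨mem_interior_iff_mem_nhds.2 hQ, hw⟩, hzw.symm⟩
  have hnhds : {x | P x} ∩ D ∩ q' ⁻¹' (q' '' (interior {x | Q x} ∩ D)) ∈ 𝓝 z :=
    Filter.inter_mem (Filter.inter_mem hP (h.unif.isOpen.mem_nhds hz))
      ((h.continuousOn.continuousAt (h.unif.isOpen.mem_nhds hz)).preimage_mem_nhds hVw)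
  obtain ⟨u, ⟨⟨hPu, huD⟩, v, hv, hvu⟩, huf⟩ := mem_closure_iff_nhds.1
    (h.unif.small.dense_freeLocus z) _ hnhds
  have hq : q u = q v := by rw [← h.pt_eq u huD, ← h.pt_eq v hv.2, hvu]
  obtain ⟨g, hg, rfl⟩ := (h.unif.fibre u huD v hv.2).1 hq
  have hgz : (g : Matrix (Fin n) (Fin n) ℂ).mulVec z = w := by
    by_contra hne
    exact hPQ hPu (interior_subset hv.1) ⟨g, hg⟩ hne rfl
  refine ⟨g, ⟨hg, ?_⟩, hgz⟩
  rw [h.eq_ofPoint ⟨huD, huf⟩, h.eq_ofPoint ⟨hv.2, mulVec_mem_freeLocus hg huf⟩] at hvu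
  exact (h.lift.comp_mulVec h.unif hg).eqOn h.lift hc
    (h.unif.small.isPreconnected_inter_freeLocus h.unif.isOpen h.preconn) subset_rfl ⟨huD, huf⟩
    (FoxPoint.ofPoint_injective isOpen_smoothLocus hc hvu)

end IsFoxChart

end FoxCharts

/-! ### The complex structure of the completion. -/

section FoxSheaf

variable {X : Type u} [TopologicalSpace X] [StructureSheaf X] {E : Type*} [TopologicalSpace E]
  {c : E → smoothLocus X}

/-- Holomorphy of function germs on the completion of a covering of the smooth locus: holomorphy in
some chart. -/
def FoxHolAt (c : E → smoothLocus X) (f : (FoxPoint fun e => (c e : X)) → ℂ)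
    (y : FoxPoint fun e => (c e : X)) : Prop :=
  ∃ (n : ℕ) (G : Subgroup (GL (Fin n) ℂ)) (D : Set (Fin n → ℂ)) (q : (Fin n → ℂ) → X) (a : X)
    (l : (Fin n → ℂ) → E) (q' : (Fin n → ℂ) → FoxPoint fun e => (c e : X)) (z : Fin n → ℂ),
    IsFoxChart c G D q a l q' ∧ z ∈ D ∧ q' z = y ∧ AnalyticAt ℂ (f ∘ q') z

/-- Near a point of the covering, functions on its completion are pulled back from the base. -/
theorem FoxPoint.exists_eventually_eq_comp_pt (hc : IsCoveringMap c) (e : E)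
    (f : (FoxPoint fun e => (c e : X)) → ℂ) : ∃ g : X → ℂ,
      ∀ᶠ y in 𝓝 (FoxPoint.ofPoint (fun e => (c e : X)) e), f y = g y.pt := by
  classical
  have : Nonempty E := ⟨e⟩
  obtain ⟨W, S, heS, -, hS⟩ := hc.exists_isSheet_subset isOpen_smoothLocus (e := e)
    Filter.univ_mem
  refine ⟨fun x => f (FoxPoint.ofPoint _ (Function.invFunOn (fun e => (c e : X)) S x)), ?_⟩
  filter_upwards [(FoxPoint.isOpenMap_ofPoint isOpen_smoothLocus hc S hS.isOpen).mem_nhds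
    ⟨e, heS, rfl⟩]
  rintro _ ⟨e', he', rfl⟩
  congr 2
  exact (hS.injOn.leftInvOn_invFunOn he').symm

namespace IsFoxChart

variable {n : ℕ} {G : Subgroup (GL (Fin n) ℂ)} {D : Set (Fin n → ℂ)} {q : (Fin n → ℂ) → X} {a : X}
  {l : (Fin n → ℂ) → E} {q' : (Fin n → ℂ) → FoxPoint fun e => (c e : X)}

theorem continuousAt (h : IsFoxChart c G D q a l q') {z : Fin n → ℂ} (hz : z ∈ D) :
    ContinuousAt q' z :=
  h.continuousOn.continuousAt (h.unif.isOpen.mem_nhds hz)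

theorem image_mem_nhds (h : IsFoxChart c G D q a l q') (hc : IsCoveringMap c) {z : Fin n → ℂ}
    (hz : z ∈ D) {V : Set (Fin n → ℂ)} (hV : V ∈ 𝓝 z) : q' '' V ∈ 𝓝 (q' z) :=
  Filter.mem_of_superset ((h.isOpen_image hc Set.inter_subset_right
    (isOpen_interior.inter h.unif.isOpen)).mem_nhds ⟨z, ⟨mem_interior_iff_mem_nhds.2 hV, hz⟩, rfl⟩)
    (Set.image_mono (Set.inter_subset_left.trans interior_subset))

theorem comp_pt_eventuallyEq (h : IsFoxChart c G D q a l q') {z : Fin n → ℂ} (hz : z ∈ D)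
    (g : X → ℂ) : (fun y : FoxPoint fun e => (c e : X) => g y.pt) ∘ q' =ᶠ[𝓝 z] g ∘ q := by
  filter_upwards [h.unif.isOpen.mem_nhds hz] with w hw
  simp [h.pt_eq w hw]

/-- Independence of the chart, without transition maps and without assuming equal dimensions. At
free points the function is locally pulled back from X, whose sheaf compares the two charts. Charts
being open maps, the function is continuous, and the Riemann extension theorem covers the remaining
points. -/
theorem analyticAt_of_foxHolAt (h : IsFoxChart c G D q a l q') (hc : IsCoveringMap c)
    {f : (FoxPoint fun e => (c e : X)) → ℂ} {z : Fin n → ℂ} (hz : z ∈ D)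
    (hf : FoxHolAt c f (q' z)) : AnalyticAt ℂ (f ∘ q') z := by
  obtain ⟨n₁, G₁, D₁, q₁, a₁, l₁, q₁', z₁, h₁, hz₁, hzz, hf₁⟩ := hf
  obtain ⟨N, hN, hNo, hzN⟩ := mem_nhds_iff.1
    (Filter.inter_mem hf₁.eventually_analyticAt (h₁.unif.isOpen.mem_nhds hz₁))
  have hND : N ⊆ D₁ := fun w hw => (hN hw).2
  have hqN : IsOpen (q₁' '' N) := h₁.isOpen_image hc hND hNo
  have hV : IsOpen (D ∩ q' ⁻¹' (q₁' '' N)) := h.continuousOn.isOpen_inter_preimage h.unif.isOpen hqN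
  have hcont : ∀ y ∈ q₁' '' N, ContinuousAt f y := by
    rintro _ ⟨w, hw, rfl⟩ S hS
    have hSw : (f ∘ q₁') ⁻¹' S ∩ N ∈ 𝓝 w :=
      Filter.inter_mem ((hN hw).1.continuousAt.preimage_mem_nhds hS) (hNo.mem_nhds hw)
    rw [Filter.mem_map]
    refine Filter.mem_of_superset (h₁.image_mem_nhds hc (hND hw) hSw) ?_
    rintro _ ⟨v, hv, rfl⟩
    exact hv.1
  refine h.unif.small.analyticAt_of_freeLocus hV (fun w hw => ?_) (fun w hw => ?_)
    ⟨hz, z₁, hzN, hzz⟩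
  · exact ((hcont _ hw.2).comp (h.continuousAt hw.1)).continuousWithinAt
  · obtain ⟨⟨hwD, v, hvN, hvw⟩, hwf⟩ := hw
    obtain ⟨g, hg⟩ := FoxPoint.exists_eventually_eq_comp_pt hc (l w) f
    rw [← h.eq_ofPoint ⟨hwD, hwf⟩] at hg
    have e1 : f ∘ q' =ᶠ[𝓝 w] g ∘ q :=
      Filter.EventuallyEq.trans ((h.continuousAt hwD).eventually hg) (h.comp_pt_eventuallyEq hwD g)
    have hg' := hg
    rw [← hvw] at hg'
    have e2 : f ∘ q₁' =ᶠ[𝓝 v] g ∘ q₁ :=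
      Filter.EventuallyEq.trans ((h₁.continuousAt (hND hvN)).eventually hg')
        (h₁.comp_pt_eventuallyEq (hND hvN) g)
    have hq : q₁ v = q w := by rw [← h₁.pt_eq v (hND hvN), ← h.pt_eq w hwD, hvw]
    rw [analyticAt_congr e1, ← h.unif.sheaf w hwD, ← hq, h₁.unif.sheaf v (hND hvN),
      ← analyticAt_congr e2]
    exact (hN hvN).1

end IsFoxChart

/-- The structure sheaf of the completion of a covering of the smooth locus. -/
abbrev foxStructureSheaf (hc : IsCoveringMap c) : StructureSheaf (FoxPoint fun e => (c e : X)) where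
  HolAt := FoxHolAt c
  congr := by
    rintro f g y hfg ⟨n, G, D, q, a, l, q', z, h, hz, rfl, hf⟩
    exact ⟨n, G, D, q, a, l, q', z, h, hz, rfl,
      hf.congr ((h.continuousAt hz).eventually hfg)⟩
  eventually := by
    rintro f y ⟨n, G, D, q, a, l, q', z, h, hz, rfl, hf⟩
    refine Filter.mem_of_superset (h.image_mem_nhds hc hz (Filter.inter_mem
      hf.eventually_analyticAt (h.unif.isOpen.mem_nhds hz))) ?_
    rintro _ ⟨w, hw, rfl⟩
    exact ⟨n, G, D, q, a, l, q', w, h, hw.2, rfl, hw.1⟩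

section

variable {n : ℕ} {G : Subgroup (GL (Fin n) ℂ)} {D : Set (Fin n → ℂ)} {q : (Fin n → ℂ) → X} {a : X}
  {l : (Fin n → ℂ) → E} {q' : (Fin n → ℂ) → FoxPoint fun e => (c e : X)}

theorem IsFoxChart.isLocalUniformization [T2Space X] (h : IsFoxChart c G D q a l q')
    (hc : IsCoveringMap c) :
    letI := foxStructureSheaf hc
    IsLocalUniformization h.liftStabilizer D q' (q' 0) :=
  letI := foxStructureSheaf hc
  { small := h.unif.small.mono h.liftStabilizer_le
    isOpen := h.unif.isOpen
    zero_mem := h.unif.zero_mem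
    stable := fun g hg => h.unif.stable g hg.1
    continuousOn := h.continuousOn
    isOpen_image := fun _ hVD hV => h.isOpen_image hc hVD hV
    fibre := fun _ hz _ hw => h.fibre hc hz hw
    sheaf := fun z hz _ => ⟨fun hf => h.analyticAt_of_foxHolAt hc hz hf,
      fun hf => ⟨n, G, D, q, a, l, q', z, h, hz, rfl, hf⟩⟩
    map_zero := rfl }

end

theorem FoxPoint.exists_isFoxChart (hX : IsPureOrbifold X) (hc : IsCoveringMap c)
    (y : FoxPoint fun e => (c e : X)) : ∃ (n : ℕ) (G : Subgroup (GL (Fin n) ℂ))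
      (D : Set (Fin n → ℂ)) (q : (Fin n → ℂ) → X) (l : (Fin n → ℂ) → E)
      (q' : (Fin n → ℂ) → FoxPoint fun e => (c e : X)), IsFoxChart c G D q y.pt l q' ∧ q' 0 = y := by
  obtain ⟨n, G, D₀, q, h₀⟩ := hX.exists_uniformization y.pt
  obtain ⟨D, -, hconv, -, h⟩ := h₀.exists_convex isOpen_univ (Set.mem_univ _)
  have hcon := hconv.contractibleSpace ⟨0, h.zero_mem⟩
  obtain ⟨l, q', hq', z, hz, hzy⟩ := h.exists_isFoxChart inferInstance hc y h.mem_image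
  have hz0 : q 0 = q z := by rw [h.map_zero, ← hzy, hq'.pt_eq z hz]
  -- The fibre of `q` over its centre is the orbit of 0, that is, 0 alone.
  obtain ⟨g, -, hg⟩ := (h.fibre 0 h.zero_mem z hz).1 hz0
  rw [Matrix.mulVec_zero] at hg
  exact ⟨n, G, D, q, l, q', hq', by rw [hg, hzy]⟩

theorem FoxPoint.isPureOrbifold (hX : IsPureOrbifold X) (hc : IsCoveringMap c) :
    letI := foxStructureSheaf hc
    IsPureOrbifold (FoxPoint fun e => (c e : X)) := by
  have := hX.t2
  let := foxStructureSheaf hc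
  refine ⟨inferInstance, fun y => ?_⟩
  obtain ⟨n, G, D, q, l, q', h, hy⟩ := y.exists_isFoxChart hX hc
  exact ⟨n, _, D, q', hy ▸ h.isLocalUniformization hc⟩

theorem FoxPoint.foxHolAt_comp_pt_iff (hX : IsPureOrbifold X) (hc : IsCoveringMap c)
    (y : FoxPoint fun e => (c e : X)) (f : X → ℂ) :
    FoxHolAt c (f ∘ FoxPoint.pt) y ↔ StructureSheaf.HolAt f y.pt := by
  obtain ⟨n, G, D, q, l, q', h, hy⟩ := y.exists_isFoxChart hX hc
  have he := h.comp_pt_eventuallyEq h.unif.zero_mem f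
  rw [← h.unif.map_zero, h.unif.sheaf 0 h.unif.zero_mem, ← analyticAt_congr he]
  refine ⟨fun hf => h.analyticAt_of_foxHolAt hc h.unif.zero_mem (hy ▸ hf), fun hf => ?_⟩
  exact ⟨n, G, D, q, _, l, q', 0, h, h.unif.zero_mem, hy, hf⟩

theorem FoxPoint.denseRange_ofPoint (hX : IsPureOrbifold X) (hc : IsCoveringMap c) :
    DenseRange (FoxPoint.ofPoint fun e => (c e : X)) := by
  intro y
  obtain ⟨n, G, D, q, l, q', h, rfl⟩ := y.exists_isFoxChart hX hc
  refine closure_mono ?_ (mem_closure_image (h.continuousAt h.unif.zero_mem)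
    (h.unif.small.subset_closure_inter_freeLocus h.unif.isOpen h.unif.zero_mem))
  rintro _ ⟨z, hz, rfl⟩
  exact ⟨l z, (h.eq_ofPoint hz).symm⟩

/-- A covering of the smooth locus, as an open subset of its completion. -/
noncomputable def FoxPoint.homeomorphPreimage (hc : IsCoveringMap c) :
    E ≃ₜ (FoxPoint.pt ⁻¹' smoothLocus X : Set (FoxPoint fun e => (c e : X))) :=
  have hloc : LocallyPathConnectedSpace E := hc.isLocalHomeomorph.locallyPathConnectedSpace
  have hcont : Continuous fun e => (c e : X) := continuous_subtype_val.comp hc.continuous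
  (Equiv.ofBijective (fun e => (⟨FoxPoint.ofPoint (fun e => (c e : X)) e, (c e).2⟩ :
      (FoxPoint.pt ⁻¹' smoothLocus X : Set (FoxPoint fun e => (c e : X)))))
    ⟨fun _ _ h => FoxPoint.ofPoint_injective isOpen_smoothLocus hc (congrArg Subtype.val h),
      fun y => (FoxPoint.exists_ofPoint_eq isOpen_smoothLocus hc y.1 y.2).imp
        fun _ h => Subtype.ext h⟩).toHomeomorphOfContinuousOpen
    ((FoxPoint.continuous_ofPoint hcont).subtype_mk _)
    fun O hO => by
      rw [isOpen_induced_iff]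
      refine ⟨_, FoxPoint.isOpenMap_ofPoint isOpen_smoothLocus hc O hO, ?_⟩
      ext y
      exact ⟨fun ⟨e, he, hy⟩ => ⟨e, he, Subtype.ext hy⟩,
        fun ⟨e, he, hy⟩ => ⟨e, he, congrArg Subtype.val hy⟩⟩

theorem FoxPoint.restrictPreimage_homeomorphPreimage (hc : IsCoveringMap c) (e : E) :
    (smoothLocus X).restrictPreimage FoxPoint.pt (FoxPoint.homeomorphPreimage hc e) = c e := rfl

/-- The image is connected over X* because it lies in the closure of the image of the free part.
Conversely, the component of a point over `q '' D` is locally constant, hence constant along a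
connected component, and `exists_map_eq` then yields a preimage in `D`. -/
theorem FoxPoint.components (hc : IsCoveringMap c) {n : ℕ}
    {G : Subgroup (GL (Fin n) ℂ)} {D : Set (Fin n → ℂ)} {q : (Fin n → ℂ) → X} {a : X}
    {l : (Fin n → ℂ) → E} {q' : (Fin n → ℂ) → FoxPoint fun e => (c e : X)}
    (h : IsFoxChart c G D q a l q') {z : Fin n → ℂ} (hz : z ∈ D)
    (hzs : q z ∈ smoothLocus X) :
    q' '' D ∩ FoxPoint.pt ⁻¹' smoothLocus X =
      connectedComponentIn (FoxPoint.pt ⁻¹' (q '' D ∩ smoothLocus X)) (q' z) := by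
  have hmaps : q' '' D ⊆ FoxPoint.pt ⁻¹' (q '' D) := by
    rintro _ ⟨w, hw, rfl⟩
    exact ⟨w, hw, (h.pt_eq w hw).symm⟩
  have hzm : q' z ∈ FoxPoint.pt ⁻¹' (q '' D ∩ smoothLocus X) :=
    ⟨hmaps ⟨z, hz, rfl⟩, by rwa [h.pt_eq z hz]⟩
  refine subset_antisymm ?_ fun y hy => ?_
  · refine IsPreconnected.subset_connectedComponentIn ?_ ⟨⟨z, hz, rfl⟩, hzm.2⟩
      fun y hy => ⟨hmaps hy.1, hy.2⟩
    have h1 : IsPreconnected (q' '' (D ∩ freeLocus G)) :=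
      (h.unif.small.isPreconnected_inter_freeLocus h.unif.isOpen h.preconn).image q'
        (h.continuousOn.mono Set.inter_subset_left)
    refine h1.subset_closure ?_ ?_
    · rintro _ ⟨w, hw, rfl⟩
      exact ⟨⟨w, hw.1, rfl⟩, by
        rw [Set.mem_preimage, h.pt_eq w hw.1]
        exact h.unif.mem_smoothLocus hw⟩
    · rintro _ ⟨⟨w, hw, rfl⟩, -⟩
      exact mem_closure_image (h.continuousAt hw)
        (h.unif.small.subset_closure_inter_freeLocus h.unif.isOpen hw)
  · have hcomp : (q' z).comp h.unif.opens = y.comp h.unif.opens := by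
      have hsub := (connectedComponentIn_subset (FoxPoint.pt ⁻¹' (q '' D ∩ smoothLocus X)) (q' z))
      have hopen : IsOpen {y : FoxPoint fun e => (c e : X) | y.pt ∈ h.unif.opens ∧
          y.comp h.unif.opens ≠ (q' z).comp h.unif.opens} := by
        rw [isOpen_iff_mem_nhds]
        intro y hy
        filter_upwards [(FoxPoint.isOpen_setOf_comp_eq _ _).mem_nhds ⟨hy.1, rfl⟩] with y' hy'
        exact ⟨hy'.1, hy'.2 ▸ hy.2⟩
      refine ((isPreconnected_connectedComponentIn.subset_left_of_subset_union
        (FoxPoint.isOpen_setOf_comp_eq h.unif.opens ((q' z).comp h.unif.opens)) hopen ?_ ?_ ?_ hy).2).symm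
      · exact Set.disjoint_left.2 fun y hy hy' => hy'.2 hy.2
      · intro y' hy'
        by_cases he : y'.comp h.unif.opens = (q' z).comp h.unif.opens
        · exact Or.inl ⟨(hsub hy').1, he⟩
        · exact Or.inr ⟨(hsub hy').1, he⟩
      · exact ⟨q' z, mem_connectedComponentIn hzm, hzm.1, rfl⟩
    have hy' := connectedComponentIn_subset _ _ hy
    obtain ⟨v, hvD, hvf⟩ := mem_closure_iff.1 (h.unif.small.dense_freeLocus z) D h.unif.isOpen hz
    have hv := h.mem_comp z hz D subset_rfl h.unif.isOpen h.preconn hz h.unif.opens subset_rfl v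
      ⟨hvD, hvf⟩
    rw [hcomp] at hv
    exact ⟨h.exists_map_eq hc y hy'.1 ⟨hvD, hvf⟩ hv, hy'.2⟩

theorem FoxPoint.isOrbifoldCovering (hX : IsPureOrbifold X) (hc : IsCoveringMap c)
    (hcs : Function.Surjective c) [ConnectedSpace E] :
    letI := foxStructureSheaf hc
    IsOrbifoldCovering (FoxPoint.pt : (FoxPoint fun e => (c e : X)) → X) := by
  have := hX.t2
  have hloc : LocallyPathConnectedSpace E := hc.isLocalHomeomorph.locallyPathConnectedSpace
  have hcont : Continuous fun e => (c e : X) := continuous_subtype_val.comp hc.continuous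
  let := foxStructureSheaf hc
  refine ⟨FoxPoint.isPureOrbifold hX hc, ?_, ⟨FoxPoint.continuous_pt, fun y f hf =>
    (y.foxHolAt_comp_pt_iff hX hc f).2 hf⟩, ?_, ?_, fun y _ f hf =>
    (y.foxHolAt_comp_pt_iff hX hc f).1 hf, ?_⟩
  · have := (FoxPoint.denseRange_ofPoint hX hc).preconnectedSpace
      (FoxPoint.continuous_ofPoint hcont)
    obtain ⟨e⟩ := ‹ConnectedSpace E›.toNonempty
    exact { toNonempty := ⟨FoxPoint.ofPoint _ e⟩ }
  · have h := hc.comp_homeomorph (FoxPoint.homeomorphPreimage hc).symm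
    convert h using 1
    ext y
    obtain ⟨e, rfl⟩ := (FoxPoint.homeomorphPreimage hc).surjective y
    simp [FoxPoint.restrictPreimage_homeomorphPreimage]
  · intro x
    obtain ⟨e, rfl⟩ := hcs x
    exact ⟨_, FoxPoint.restrictPreimage_homeomorphPreimage hc e⟩
  · intro a n G D q h hD y hy
    obtain ⟨l, q', hq', z, hz, rfl⟩ := h.exists_isFoxChart hD hc y hy.1
    refine ⟨q' 0, hq'.liftStabilizer, q', ?_, hq'.liftStabilizer_le, hq'.isLocalUniformization hc,
      FoxPoint.components hc hq' hz (hq'.pt_eq z hz ▸ hy.2), hq'.pt_eq⟩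
    rw [hq'.pt_eq 0 h.zero_mem, h.map_zero]

end FoxSheaf

/-! ### Every subgroup is realized. -/

section Existence

variable {X : Type u} [TopologicalSpace X] [StructureSheaf X]

theorem FundamentalGroup.range_mapOfEq_le {A B M : Type*} [TopologicalSpace A]
    [TopologicalSpace B] [TopologicalSpace M] {φ : A → B} (hφ : Continuous φ) {f : C(A, M)}
    {g : C(B, M)} (hfg : ∀ x, g (φ x) = f x) {x : A} {y : B} {m : M} (hx : f x = m)
    (hxy : φ x = y) (hy : g y = m) :
    (FundamentalGroup.mapOfEq f hx).range ≤ (FundamentalGroup.mapOfEq g hy).range := by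
  rintro _ ⟨p, rfl⟩
  refine ⟨FundamentalGroup.mapOfEq ⟨φ, hφ⟩ hxy p, ?_⟩
  simp only [FundamentalGroup.mapOfEq_apply]
  induction p using Path.Homotopic.Quotient.ind with
  | mk γ =>
    exact congrArg Path.Homotopic.Quotient.mk (Path.ext (funext fun t => hfg _))

theorem IsCoveringMap.surjective_of_pathConnectedSpace {E M : Type*} [TopologicalSpace E]
    [TopologicalSpace M] [PathConnectedSpace M] [Nonempty E] {c : E → M} (hc : IsCoveringMap c) :
    Function.Surjective c := by
  intro m
  obtain ⟨e⟩ := ‹Nonempty E›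
  obtain ⟨γ⟩ := PathConnectedSpace.joined (c e) m
  have h := hc.liftPath_lifts γ e (by simp)
  refine ⟨hc.liftPath γ e (by simp) 1, ?_⟩
  have := congrFun h 1
  simpa using this

theorem PointedOrbifoldCovering.exists_subgroup_eq (hX : IsPureOrbifold X) [ConnectedSpace X]
    (b : smoothLocus X) (H : Subgroup (OrbifoldFundamentalGroup X b)) :
    ∃ P : PointedOrbifoldCovering X b, P.subgroup = H := by
  have := pathConnectedSpace_smoothLocus hX b
  obtain ⟨𝒰⟩ := nonempty_goodCover_smoothLocus (X := X)
  obtain ⟨E, _, c, hc, e₀, he, hE, hH⟩ := 𝒰.exists_covering H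
  let := foxStructureSheaf hc
  let P : PointedOrbifoldCovering X b :=
    { space := FoxPoint fun e => (c e : X)
      proj := FoxPoint.pt
      isCovering := FoxPoint.isOrbifoldCovering hX hc hc.surjective_of_pathConnectedSpace
      point := FoxPoint.ofPoint _ e₀
      proj_point := congrArg Subtype.val he }
  refine ⟨P, ?_⟩
  rw [← hH]
  let e := FoxPoint.homeomorphPreimage hc
  refine le_antisymm (FundamentalGroup.range_mapOfEq_le e.symm.continuous
    (fun y => ?_) P.restr_smoothPoint (e.symm_apply_apply e₀) he)
    (FundamentalGroup.range_mapOfEq_le e.continuous (fun _ => rfl) he rfl P.restr_smoothPoint)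
  obtain ⟨y, rfl⟩ := e.surjective y
  rw [e.symm_apply_apply]
  rfl

end Existence

/-! ### Complements of zero sets of analytic functions. -/

section ZeroSets

theorem isPreconnected_ball_diff_singleton (z : ℂ) (ε : ℝ) :
    IsPreconnected (Metric.ball z ε \ {z}) := by
  have h := (isPreconnected_inter_complSubspaces (A := fun _ : Unit => (⊥ : Submodule ℂ ℂ))
    (fun _ => bot_ne_top) (Metric.isOpen_ball (x := (0 : ℂ)) (ε := ε))
    (convex_ball 0 ε).isPreconnected).image (fun w => z + w)
    (continuous_const.add continuous_id).continuousOn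
  convert h using 1
  ext w
  simp only [Set.mem_sdiff, Metric.mem_ball, Set.mem_singleton_iff, complSubspaces, Set.mem_image,
    Set.mem_inter_iff, Set.mem_ofPred_eq, Submodule.mem_bot, forall_const, dist_zero_right]
  constructor
  · rintro ⟨h1, h2⟩
    exact ⟨w - z, ⟨by rwa [← dist_eq_norm], sub_ne_zero.2 h2⟩, by ring⟩
  · rintro ⟨v, ⟨h1, h2⟩, rfl⟩
    exact ⟨by simpa [dist_eq_norm] using h1, by simpa using h2⟩

theorem AnalyticOnNhd.subset_closure_ne_zero {V : Type*} [NormedAddCommGroup V] [NormedSpace ℂ V]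
    {f : V → ℂ} {Ω : Set V} (hf : AnalyticOnNhd ℂ f Ω) (hΩ : IsOpen Ω) (hΩc : IsPreconnected Ω)
    {z₀ : V} (hz₀ : z₀ ∈ Ω) (h₀ : f z₀ ≠ 0) : Ω ⊆ closure (Ω ∩ {z | f z ≠ 0}) := by
  intro z hz
  by_contra hcl
  refine h₀ (hf.eqOn_zero_of_preconnected_of_eventuallyEq_zero hΩc hz ?_ hz₀)
  filter_upwards [isClosed_closure.isOpen_compl.mem_nhds hcl, hΩ.mem_nhds hz] with w hw hwΩ
  by_contra hne
  exact hw (subset_closure ⟨hwΩ, hne⟩)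

theorem AnalyticOnNhd.isPreconnected_ne_zero_complex {f : ℂ → ℂ} {Ω : Set ℂ}
    (hf : AnalyticOnNhd ℂ f Ω) (hΩ : IsOpen Ω) (hΩc : IsPreconnected Ω) {z₀ : ℂ} (hz₀ : z₀ ∈ Ω)
    (h₀ : f z₀ ≠ 0) : IsPreconnected (Ω ∩ {z | f z ≠ 0}) := by
  refine isPreconnected_of_dense_of_locally hΩc Set.inter_subset_left
    (hf.subset_closure_ne_zero hΩ hΩc hz₀ h₀) fun z hz => ?_
  rcases (hf z hz).eventually_eq_zero_or_eventually_ne_zero with h | h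
  · exact absurd (hf.eqOn_zero_of_preconnected_of_eventuallyEq_zero hΩc hz h hz₀) h₀
  · obtain ⟨ε, hε, hb⟩ := Metric.mem_nhds_iff.1
      (Filter.inter_mem (hΩ.mem_nhds hz) (eventually_nhdsWithin_iff.1 h))
    refine ⟨Metric.ball z ε, Metric.ball_mem_nhds z hε, ?_⟩
    by_cases hfz : f z = 0
    · convert isPreconnected_ball_diff_singleton z ε using 1
      ext w
      constructor
      · rintro ⟨h1, -, h2⟩
        exact ⟨h1, fun h3 => h2 (by rwa [Set.mem_singleton_iff.1 h3])⟩
      · rintro ⟨h1, h2⟩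
        exact ⟨h1, (hb h1).1, (hb h1).2 h2⟩
    · convert (convex_ball z ε).isPreconnected using 1
      refine Set.inter_eq_left.2 fun w hw => ⟨(hb hw).1, ?_⟩
      by_cases hwz : w = z
      · rwa [hwz]
      · exact (hb hw).2 hwz

/-- Restriction to the complex line through two points where the function does not vanish. There the
zeros are isolated, and the domain is convex in ℂ. -/
theorem AnalyticOnNhd.isPreconnected_ne_zero {V : Type*} [NormedAddCommGroup V] [NormedSpace ℂ V]
    [NormedSpace ℝ V] [IsScalarTower ℝ ℂ V]
    {f : V → ℂ} {Ω : Set V} (hf : AnalyticOnNhd ℂ f Ω) (hΩ : IsOpen Ω) (hΩc : Convex ℝ Ω) :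
    IsPreconnected (Ω ∩ {z | f z ≠ 0}) := by
  refine isPreconnected_of_forall_pair fun x hx y hy => ?_
  let φ : ℂ → V := fun t => x + t • (y - x)
  have hφ : ∀ t, AnalyticAt ℂ φ t := fun t =>
    analyticAt_const.add (analyticAt_id.smul analyticAt_const)
  have hφc : Continuous φ := continuous_iff_continuousAt.2 fun t => (hφ t).continuousAt
  have hconv : Convex ℝ (φ ⁻¹' Ω) := by
    intro s hs t ht a b ha hb hab
    have : φ (a • s + b • t) = a • φ s + b • φ t := by
      simp only [φ, add_smul, smul_add, smul_assoc]
      have h1 : x = a • x + b • x := by rw [← add_smul, hab, one_smul]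
      nth_rewrite 1 [h1]
      abel
    rw [Set.mem_preimage, this]
    exact hΩc hs ht ha hb hab
  have h0 : φ 0 = x := by simp [φ]
  have h1 : φ 1 = y := by simp [φ]
  have han : AnalyticOnNhd ℂ (f ∘ φ) (φ ⁻¹' Ω) := fun t ht => (hf _ ht).comp (hφ t)
  have hpre := han.isPreconnected_ne_zero_complex (hΩ.preimage hφc) hconv.isPreconnected
    (z₀ := 0) (by rw [Set.mem_preimage, h0]; exact hx.1) (by rw [Function.comp_apply, h0]; exact hx.2)
  refine ⟨φ '' (φ ⁻¹' Ω ∩ {t | (f ∘ φ) t ≠ 0}), ?_, ⟨0, ?_, h0⟩, ⟨1, ?_, h1⟩,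
    hpre.image φ hφc.continuousOn⟩
  · rintro _ ⟨t, ht, rfl⟩
    exact ht
  · refine ⟨by rw [Set.mem_preimage, h0]; exact hx.1, ?_⟩
    change f (φ 0) ≠ 0
    rw [h0]
    exact hx.2
  · refine ⟨by rw [Set.mem_preimage, h1]; exact hy.1, ?_⟩
    change f (φ 1) ≠ 0
    rw [h1]
    exact hy.2

end ZeroSets

/-! ### Invariant functions that detect the free locus. -/

section InvariantFunctions

theorem analyticAt_dotProduct_mulVec {n : ℕ} (v : Fin n → ℂ) (A : Matrix (Fin n) (Fin n) ℂ)
    (z : Fin n → ℂ) : AnalyticAt ℂ (fun z => v ⬝ᵥ A.mulVec z) z :=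
  LinearMap.toContinuousLinearMap (IsLinearMap.mk' (fun z : Fin n → ℂ => v ⬝ᵥ A.mulVec z)
    ⟨fun x y => by rw [Matrix.mulVec_add, dotProduct_add],
      fun c x => by rw [Matrix.mulVec_smul, dotProduct_smul]⟩) |>.analyticAt z

/-- Finitely many nonzero vectors are not annihilated by a suitable linear form. -/
theorem exists_forall_dotProduct_ne_zero {n : ℕ} {ι : Type*} [Finite ι] (x : ι → Fin n → ℂ)
    (hx : ∀ i, x i ≠ 0) : ∃ v : Fin n → ℂ, ∀ i, v ⬝ᵥ x i ≠ 0 := by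
  let A : ι → Submodule ℂ (Fin n → ℂ) := fun i =>
    LinearMap.ker (IsLinearMap.mk' (fun v : Fin n → ℂ => v ⬝ᵥ x i)
      ⟨fun v w => add_dotProduct v w (x i), fun c v => smul_dotProduct c v (x i)⟩)
  have hmem : ∀ i v, v ∈ A i ↔ v ⬝ᵥ x i = 0 := fun i v => LinearMap.mem_ker
  have hA : ∀ i, A i ≠ ⊤ := by
    intro i htop
    refine hx i ((dotProduct_eq_zero_iff (v := x i)).1 fun w => ?_)
    rw [dotProduct_comm, ← hmem, htop]
    trivial
  obtain ⟨v, hv⟩ := (dense_complSubspaces hA).nonempty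
  exact ⟨v, fun i hi => hv i ((hmem i v).2 hi)⟩

variable {n : ℕ} {G : Subgroup (GL (Fin n) ℂ)}

/-- An invariant analytic function that vanishes off the free locus, but not at a given point of
it. -/
theorem IsSmallGroup.exists_invariant_function (hG : IsSmallGroup G) {z₀ : Fin n → ℂ}
    (hz₀ : z₀ ∈ freeLocus G) : ∃ P : (Fin n → ℂ) → ℂ, (∀ z, AnalyticAt ℂ P z) ∧
      (∀ g ∈ G, ∀ z, P ((g : Matrix (Fin n) (Fin n) ℂ).mulVec z) = P z) ∧
      (∀ z, P z ≠ 0 → z ∈ freeLocus G) ∧ P z₀ ≠ 0 := by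
  classical
  have := hG.finite
  have := hG.finite_index
  let := Fintype.ofFinite G
  let := Fintype.ofFinite {g // g ∈ G ∧ g ≠ 1}
  -- The function is the product, over h in G and g ≠ 1, of a linear form at (g - 1) h z. The
  -- product over h makes it invariant, and the factors with h = 1 vanish where g fixes z.
  let M : G × {g // g ∈ G ∧ g ≠ 1} → Matrix (Fin n) (Fin n) ℂ := fun p =>
    ((p.2.1 : Matrix (Fin n) (Fin n) ℂ) - 1) * ((p.1 : GL (Fin n) ℂ) : Matrix (Fin n) (Fin n) ℂ)
  have hM : ∀ p z, (M p).mulVec z = (p.2.1 : Matrix (Fin n) (Fin n) ℂ).mulVec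
      (((p.1 : GL (Fin n) ℂ) : Matrix (Fin n) (Fin n) ℂ).mulVec z) -
      ((p.1 : GL (Fin n) ℂ) : Matrix (Fin n) (Fin n) ℂ).mulVec z := fun p z => by
    rw [← Matrix.mulVec_mulVec, Matrix.sub_mulVec, Matrix.one_mulVec]
  obtain ⟨v, hv⟩ := exists_forall_dotProduct_ne_zero (fun p => (M p).mulVec z₀) fun p h => by
    rw [hM, sub_eq_zero] at h
    exact p.2.2.2 (mulVec_mem_freeLocus p.1.2 hz₀ _ p.2.2.1 h)
  refine ⟨fun z => ∏ p, v ⬝ᵥ (M p).mulVec z, fun z => ?_, fun g hg z => ?_, fun z hz => ?_,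
    Finset.prod_ne_zero_iff.2 fun p _ => hv p⟩
  · exact Finset.analyticAt_fun_prod _ fun p _ => analyticAt_dotProduct_mulVec v (M p) z
  · refine Fintype.prod_equiv ((Equiv.mulRight (⟨g, hg⟩ : G)).prodCongr (Equiv.refl _)) _ _
      fun p => ?_
    rw [hM, hM]
    simp
  · intro g hg hgz
    by_contra hne
    refine Finset.prod_ne_zero_iff.1 hz (1, ⟨g, hg, hne⟩) (Finset.mem_univ _) ?_
    rw [hM]
    simp [hgz]

variable {X : Type u} [TopologicalSpace X] [StructureSheaf X] {D : Set (Fin n → ℂ)}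
  {q : (Fin n → ℂ) → X} {a : X}

/-- The invariant function descends to X. Its pullback under a holomorphic map shows that the points
not sent into q(D₀) lie in an analytic zero set. -/
theorem IsLocalUniformization.exists_function (h : IsLocalUniformization G D q a)
    {z₀ : Fin n → ℂ} (hz₀ : z₀ ∈ D ∩ freeLocus G) : ∃ ψ : X → ℂ,
      (∀ z ∈ D, StructureSheaf.HolAt ψ (q z)) ∧ (∀ z ∈ D, ψ (q z) ≠ 0 → z ∈ freeLocus G) ∧
      ψ (q z₀) ≠ 0 := by
  obtain ⟨P, hP, hinv, hfree, hne⟩ := h.small.exists_invariant_function hz₀.2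
  have hψ : ∀ z ∈ D, P (Function.invFunOn q D (q z)) = P z := by
    intro z hz
    have hm : q z ∈ q '' D := ⟨z, hz, rfl⟩
    obtain ⟨g, hg, hgz⟩ := (h.fibre _ (Function.invFunOn_mem hm) z hz).1 (Function.invFunOn_eq hm)
    rw [← hinv g hg, hgz]
  refine ⟨fun x => P (Function.invFunOn q D x), fun z hz => ?_, fun z hz hne => ?_, ?_⟩
  · rw [h.sheaf z hz]
    refine (hP z).congr ?_
    filter_upwards [h.isOpen.mem_nhds hz] with w hw
    exact (hψ w hw).symm
  · exact hfree z (hψ z hz ▸ hne)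
  · change P (Function.invFunOn q D (q z₀)) ≠ 0
    rwa [hψ z₀ hz₀.1]

/-- In a chart of the source, the preimage of the image of the free locus under a holomorphic map
contains a dense connected set, if it is not empty. -/
theorem IsHolomorphicMap.exists_isPreconnected {Y : Type*} [TopologicalSpace Y] [StructureSheaf Y]
    {r : Y → X} (hr : IsHolomorphicMap r) (h : IsLocalUniformization G D q a) {m : ℕ}
    {K : Subgroup (GL (Fin m) ℂ)} {B : Set (Fin m → ℂ)} {p : (Fin m → ℂ) → Y} {y : Y}
    (hp : IsLocalUniformization K B p y) (hB : Convex ℝ B) (hBD : ∀ w ∈ B, r (p w) ∈ q '' D)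
    {w₀ : Fin m → ℂ} (hw₀ : w₀ ∈ B) (hrw₀ : r (p w₀) ∈ q '' (D ∩ freeLocus G)) :
    ∃ S ⊆ B, IsPreconnected S ∧ B ⊆ closure S ∧ ∀ w ∈ S, r (p w) ∈ q '' (D ∩ freeLocus G) := by
  obtain ⟨z₀, hz₀, hz₀w⟩ := hrw₀
  obtain ⟨ψ, hψ, hfree, hne⟩ := h.exists_function hz₀
  have han : AnalyticOnNhd ℂ (ψ ∘ r ∘ p) B := by
    intro w hw
    obtain ⟨z, hz, hzw⟩ := hBD w hw
    rw [← Function.comp_assoc, ← hp.sheaf w hw]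
    refine hr.pullback _ ψ ?_
    rw [← hzw]
    exact hψ z hz
  refine ⟨B ∩ {w | (ψ ∘ r ∘ p) w ≠ 0}, Set.inter_subset_left,
    han.isPreconnected_ne_zero hp.isOpen hB,
    han.subset_closure_ne_zero hp.isOpen hB.isPreconnected hw₀ ?_, fun w hw => ?_⟩
  · simpa [← hz₀w] using hne
  · obtain ⟨z, hz, hzw⟩ := hBD w hw.1
    exact ⟨z, ⟨hz, hfree z hz (by rw [hzw]; exact hw.2)⟩, hzw⟩

end InvariantFunctions

/-! ### Orbifold coverings over and near the singular locus. -/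

namespace IsOrbifoldCovering

variable {X : Type u} [TopologicalSpace X] [StructureSheaf X]
  {Y : Type v} [TopologicalSpace Y] [StructureSheaf Y] {r : Y → X}

theorem isOpen_image (hr : IsOrbifoldCovering r) {O : Set Y} (hO : IsOpen O) :
    IsOpen (r '' (O ∩ r ⁻¹' smoothLocus X)) := by
  have h := isOpen_smoothLocus.isOpenMap_subtype_val _
    (hr.isCoveringMap.isOpenMap _ (hO.preimage continuous_subtype_val))
  convert h using 1
  ext x
  constructor
  · rintro ⟨y, hy, rfl⟩
    exact ⟨⟨r y, hy.2⟩, ⟨⟨y, hy.2⟩, hy.1, rfl⟩, rfl⟩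
  · rintro ⟨_, ⟨y, hy, rfl⟩, rfl⟩
    exact ⟨y, ⟨hy, y.2⟩, rfl⟩

/-- In a convex chart of Y mapped into a chart of X, the nonvanishing set of the pulled back
function is connected, dense and contained in the preimage of X*. The closure hypothesis on `y`
ensures that this function is not identically zero. -/
theorem exists_nhds_isPreconnected (hX : IsPureOrbifold X) (hr : IsOrbifoldCovering r) {y : Y}
    (hy : y ∈ closure (r ⁻¹' smoothLocus X)) {O : Set Y} (hO : O ∈ 𝓝 y) :
    ∃ N ∈ 𝓝 y, N ⊆ O ∧ N ⊆ closure (r ⁻¹' smoothLocus X) ∧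
      IsPreconnected (N ∩ r ⁻¹' smoothLocus X) := by
  obtain ⟨n, G, D, q, h⟩ := hX.exists_uniformization (r y)
  obtain ⟨m, K, B₀, p, hp₀⟩ := hr.isPureOrbifold.exists_uniformization y
  have hO' : IsOpen (interior O ∩ r ⁻¹' (q '' D)) :=
    isOpen_interior.inter (h.isOpen_range.preimage hr.holomorphic.continuous)
  obtain ⟨B, -, hB, hBO, hp⟩ := hp₀.exists_convex hO' ⟨mem_interior_iff_mem_nhds.2 hO, h.mem_image⟩
  obtain ⟨e, heN, he⟩ := mem_closure_iff.1 hy _ hp.isOpen_range hp.mem_image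
  -- A point over X* need not map into the image of the free locus, but `r` is open there and that
  -- image is dense, so a nearby point does.
  obtain ⟨x, ⟨e', ⟨⟨w₀, hw₀, rfl⟩, -⟩, rfl⟩, hx⟩ := mem_closure_iff.1
    (h.image_subset_closure h.isOpen subset_rfl (hBO heN).2) _ (hr.isOpen_image hp.isOpen_range)
    ⟨e, ⟨heN, he⟩, rfl⟩
  obtain ⟨S, hSB, hS, hBS, hSfree⟩ := hr.holomorphic.exists_isPreconnected h hp hB
    (fun w hw => (hBO ⟨w, hw, rfl⟩).2) hw₀ hx
  have hSs : p '' S ⊆ r ⁻¹' smoothLocus X := by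
    rintro _ ⟨w, hw, rfl⟩
    obtain ⟨z, hz, hzw⟩ := hSfree w hw
    rw [Set.mem_preimage, ← hzw]
    exact h.mem_smoothLocus hz
  have hcl : p '' B ⊆ closure (p '' S) := by
    rintro _ ⟨w, hw, rfl⟩
    exact mem_closure_image (hp.continuousOn.continuousAt (hp.isOpen.mem_nhds hw)) (hBS hw)
  refine ⟨p '' B, hp.isOpen_range.mem_nhds hp.mem_image, fun e he => interior_subset (hBO he).1,
    hcl.trans (closure_mono hSs), ?_⟩
  exact (hS.image p (hp.continuousOn.mono hSB)).subset_closure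
    (fun e he => ⟨Set.image_mono hSB he, hSs he⟩) (Set.inter_subset_left.trans hcl)

/-- Density is not part of the definition. The closure is open by `exists_nhds_isPreconnected`, it
is nonempty, and Y is connected. -/
theorem dense_preimage (hX : IsPureOrbifold X) (hr : IsOrbifoldCovering r) :
    Dense (r ⁻¹' smoothLocus X) := by
  have := hr.connected
  have hopen : IsOpen (closure (r ⁻¹' smoothLocus X)) := by
    rw [isOpen_iff_mem_nhds]
    intro y hy
    obtain ⟨N, hN, -, hNc, -⟩ := hr.exists_nhds_isPreconnected hX hy Filter.univ_mem
    exact Filter.mem_of_superset hN hNc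
  obtain ⟨y₀⟩ := hr.connected.toNonempty
  have : Nonempty X := ⟨r y₀⟩
  obtain ⟨x, hx⟩ := (dense_smoothLocus hX).nonempty
  obtain ⟨y, -⟩ := hr.surjective ⟨x, hx⟩
  rw [dense_iff_closure_eq]
  exact IsClopen.eq_univ ⟨isClosed_closure, hopen⟩ ⟨y, subset_closure y.2⟩

theorem isPreconnected_preimage (hX : IsPureOrbifold X) (hr : IsOrbifoldCovering r) :
    IsPreconnected (r ⁻¹' smoothLocus X) := by
  have := hr.connected
  refine isPreconnected_of_dense_of_locally isPreconnected_univ (Set.subset_univ _)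
    (fun y _ => hr.dense_preimage hX y) fun y _ => ?_
  obtain ⟨N, hN, -, -, hc⟩ :=
    hr.exists_nhds_isPreconnected hX (hr.dense_preimage hX y) Filter.univ_mem
  exact ⟨N, hN, hc⟩

theorem locallyPathConnectedSpace (hr : IsOrbifoldCovering r) :
    LocallyPathConnectedSpace (r ⁻¹' smoothLocus X) :=
  hr.isCoveringMap.isLocalHomeomorph.locallyPathConnectedSpace

theorem pathConnectedSpace (hX : IsPureOrbifold X) (hr : IsOrbifoldCovering r)
    (y : r ⁻¹' smoothLocus X) : PathConnectedSpace (r ⁻¹' smoothLocus X) := by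
  have : ConnectedSpace (r ⁻¹' smoothLocus X) :=
    isConnected_iff_connectedSpace.1 ⟨⟨y, y.2⟩, hr.isPreconnected_preimage hX⟩
  have := hr.locallyPathConnectedSpace
  exact PathConnectedSpace.of_locallyPathConnectedSpace

theorem eqOn_of_comp_eqOn (hr : IsOrbifoldCovering r) {A : Type*} [TopologicalSpace A]
    {T : Set A} (hT : IsPreconnected T) {f g : A → Y} (hf : ContinuousOn f T)
    (hg : ContinuousOn g T) (hfg : ∀ t ∈ T, r (f t) = r (g t))
    (hs : ∀ t ∈ T, r (f t) ∈ smoothLocus X) {t₀ : A} (ht₀ : t₀ ∈ T) (h₀ : f t₀ = g t₀) :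
    Set.EqOn f g T := by
  have := isPreconnected_iff_preconnectedSpace.1 hT
  let f' : T → r ⁻¹' smoothLocus X := fun t => ⟨f t, hs t t.2⟩
  let g' : T → r ⁻¹' smoothLocus X := fun t => ⟨g t, by
    rw [Set.mem_preimage, ← hfg t t.2]
    exact hs t t.2⟩
  have h : f' = g' := hr.isCoveringMap.eq_of_comp_eq
    ((continuousOn_iff_continuous_domRestrict.1 hf).subtype_mk _)
    ((continuousOn_iff_continuous_domRestrict.1 hg).subtype_mk _)
    (funext fun t => Subtype.ext (hfg t t.2)) ⟨t₀, ht₀⟩ (Subtype.ext h₀)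
  exact fun t ht => congrArg Subtype.val (congrFun h ⟨t, ht⟩)

end IsOrbifoldCovering

/-- Since 0 is the only point of D over `a`, intersecting the translates of a neighbourhood of 0
gives an open set saturated in D. -/
theorem IsLocalUniformization.exists_stable_subset {X : Type u} [TopologicalSpace X]
    [StructureSheaf X] {n : ℕ} {G : Subgroup (GL (Fin n) ℂ)} {D : Set (Fin n → ℂ)}
    {q : (Fin n → ℂ) → X} {a : X} (h : IsLocalUniformization G D q a) {O : Set (Fin n → ℂ)}
    (hO : O ∈ 𝓝 0) : ∃ W ∈ 𝓝 a, ∀ z ∈ D, q z ∈ W → z ∈ O := by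
  have := h.small.finite
  let V : Set (Fin n → ℂ) := (⋂ g : G,
    (fun z => ((g : GL (Fin n) ℂ) : Matrix (Fin n) (Fin n) ℂ).mulVec z) ⁻¹' interior O) ∩ D
  have hV : IsOpen V := (isOpen_iInter_of_finite fun g =>
    isOpen_interior.preimage (continuous_GL_mulVec _)).inter h.isOpen
  refine ⟨q '' V, (h.isOpen_image V Set.inter_subset_right hV).mem_nhds
    ⟨0, ⟨Set.mem_iInter.2 fun g => ?_, h.zero_mem⟩, h.map_zero⟩, ?_⟩
  · rw [Set.mem_preimage, Matrix.mulVec_zero]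
    exact mem_interior_iff_mem_nhds.2 hO
  · rintro z hz ⟨w, hw, hwz⟩
    obtain ⟨g, hg, rfl⟩ := (h.fibre w hw.2 z hz).1 hwz
    exact interior_subset (Set.mem_iInter.1 hw.1 ⟨g, hg⟩)

namespace IsOrbifoldCovering

variable {X : Type u} [TopologicalSpace X] [StructureSheaf X]
  {Y : Type v} [TopologicalSpace Y] [StructureSheaf Y] {r : Y → X}

/-- Every point of an orbifold covering is the centre of a local uniformization that covers one of
the base. -/
theorem exists_uniformization (hX : IsPureOrbifold X) (hr : IsOrbifoldCovering r) (y : Y) :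
    ∃ (n : ℕ) (G G' : Subgroup (GL (Fin n) ℂ)) (D : Set (Fin n → ℂ)) (q : (Fin n → ℂ) → X)
      (q' : (Fin n → ℂ) → Y), Convex ℝ D ∧ IsLocalUniformization G D q (r y) ∧
        IsLocalUniformization G' D q' y ∧ ∀ z ∈ D, r (q' z) = q z := by
  obtain ⟨n, G, D₀, q, h₀⟩ := hX.exists_uniformization (r y)
  obtain ⟨D, -, hD, -, h⟩ := h₀.exists_convex isOpen_univ (Set.mem_univ _)
  have := hD.contractibleSpace ⟨0, h.zero_mem⟩
  have hrc := hr.holomorphic.continuous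
  have hdense := hr.dense_preimage hX
  obtain ⟨N, hN, hND, -, hNc⟩ := hr.exists_nhds_isPreconnected hX (hdense y)
    (hrc.continuousAt.preimage_mem_nhds (h.isOpen_range.mem_nhds h.mem_image))
  obtain ⟨e, heN, he⟩ := mem_closure_iff_nhds.1 (hdense y) N hN
  obtain ⟨a', G', q', ha', -, h', himg, hq'⟩ := hr.components _ n G D q h inferInstance e
    ⟨hND heN, he⟩
  have hsub : N ∩ r ⁻¹' smoothLocus X ⊆ q' '' D := by
    refine (hNc.subset_connectedComponentIn (F := r ⁻¹' (q '' D ∩ smoothLocus X)) ⟨heN, he⟩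
      fun x hx => ⟨hND hx.1, hx.2⟩).trans ?_
    rw [← himg]
    exact Set.inter_subset_left
  -- Points over X* close to `y` lie in the chart, and since their images approach the centre of `q`
  -- they come from vectors close to 0. They are therefore also close to `a'`, contrary to a
  -- separation of `y` and `a'`.
  have hya : y = a' := by
    have := hr.isPureOrbifold.t2
    by_contra hne
    obtain ⟨A, B, hA, hB, hyA, haB, hAB⟩ := t2_separation hne
    have hBn : q' ⁻¹' B ∈ 𝓝 (0 : Fin n → ℂ) :=
      (h'.continuousOn.continuousAt (h'.isOpen.mem_nhds h'.zero_mem)).preimage_mem_nhds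
        (hB.mem_nhds (h'.map_zero.symm ▸ haB))
    obtain ⟨W, hW, hWB⟩ := h.exists_stable_subset hBn
    obtain ⟨x, ⟨⟨hxA, hxN⟩, hxW⟩, hx⟩ := mem_closure_iff_nhds.1 (hdense y) _
      (Filter.inter_mem (Filter.inter_mem (hA.mem_nhds hyA) hN)
        (hrc.continuousAt.preimage_mem_nhds hW))
    obtain ⟨z, hz, rfl⟩ := hsub ⟨hxN, hx⟩
    exact Set.disjoint_left.1 hAB hxA (hWB z hz (hq' z hz ▸ hxW))
  exact ⟨n, G, G', D, q, q', hD, h, hya ▸ h', hq'⟩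

variable {Y' : Type w} [TopologicalSpace Y'] [StructureSheaf Y'] {r' : Y' → X}

/-- Both coverings are uniformized by the same `D` over the same `q`, so in these charts the map is
given by a single group element `g`. The formula makes sense on all of `D` and descends to the
source. -/
theorem exists_local_extension (hX : IsPureOrbifold X) (hr : IsOrbifoldCovering r)
    (hr' : IsOrbifoldCovering r') {f : Y → Y'} (hf : ContinuousOn f (r ⁻¹' smoothLocus X))
    (hfr : ∀ y ∈ r ⁻¹' smoothLocus X, r' (f y) = r y) (y : Y) : ∃ N, IsOpen N ∧ y ∈ N ∧
      ∃ F : Y → Y', Set.EqOn F f (N ∩ r ⁻¹' smoothLocus X) ∧ (∀ x ∈ N, r' (F x) = r x) ∧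
        (∀ x ∈ N, ContinuousAt F x) ∧ ∀ x ∈ N, ∀ φ : Y' → ℂ,
          StructureSheaf.HolAt φ (F x) → StructureSheaf.HolAt (φ ∘ F) x := by
  have := hr'.isPureOrbifold.t2
  obtain ⟨n, G, G₁, D, q, q₁, hD, h, h₁, hq₁⟩ := hr.exists_uniformization hX y
  have := hD.contractibleSpace ⟨0, h.zero_mem⟩
  have hsm : ∀ z ∈ D ∩ freeLocus G, r (q₁ z) ∈ smoothLocus X := fun z hz => by
    rw [hq₁ z hz.1]
    exact h.mem_smoothLocus hz
  obtain ⟨z₀, hz₀⟩ : (D ∩ freeLocus G).Nonempty :=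
    h.small.dense_freeLocus.inter_open_nonempty D h.isOpen ⟨0, h.zero_mem⟩
  have hfz₀ : r' (f (q₁ z₀)) = q z₀ := by rw [hfr _ (hsm z₀ hz₀), hq₁ z₀ hz₀.1]
  have hmem : f (q₁ z₀) ∈ r' ⁻¹' (q '' D ∩ smoothLocus X) :=
    ⟨⟨z₀, hz₀.1, hfz₀.symm⟩, by rw [hfz₀]; exact h.mem_smoothLocus hz₀⟩
  obtain ⟨a', G₂, q₂, -, -, h₂, himg, hq₂⟩ := hr'.components _ n G D q h inferInstance _ hmem
  have hmem' := mem_connectedComponentIn hmem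
  rw [← himg] at hmem'
  obtain ⟨z₁, hz₁, hz₁f⟩ := hmem'.1
  have hqz : q z₀ = q z₁ := by rw [← hq₂ z₁ hz₁, hz₁f, hfz₀]
  obtain ⟨g, hg, rfl⟩ := (h.fibre z₀ hz₀.1 z₁ hz₁).1 hqz
  -- The element `g` is chosen so that `k` and `f ∘ q₁`, two lifts of `q` on the free part, agree at
  -- `z₀`; they then agree on the whole connected free part.
  let k : (Fin n → ℂ) → Y' := fun z => q₂ ((g : Matrix (Fin n) (Fin n) ℂ).mulVec z)
  have hkc : ContinuousOn k D :=
    h₂.continuousOn.comp (continuous_GL_mulVec g).continuousOn (h.stable g hg)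
  have hkr : ∀ z ∈ D, r' (k z) = q z := fun z hz => by
    rw [hq₂ _ (h.stable g hg z hz), h.map_mulVec hg hz]
  have hfq₁ : ContinuousOn (f ∘ q₁) (D ∩ freeLocus G) :=
    hf.comp (h₁.continuousOn.mono Set.inter_subset_left) hsm
  have hkf : Set.EqOn k (f ∘ q₁) (D ∩ freeLocus G) := by
    refine hr'.eqOn_of_comp_eqOn (h.small.isPreconnected_inter_freeLocus h.isOpen hD.isPreconnected)
      (hkc.mono Set.inter_subset_left) hfq₁ (fun z hz => ?_) (fun z hz => ?_) hz₀ hz₁f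
    · rw [hkr z hz.1, Function.comp_apply, hfr _ (hsm z hz), hq₁ z hz.1]
    · rw [hkr z hz.1]
      exact h.mem_smoothLocus hz
  have hcl := h.small.subset_closure_inter_freeLocus h.isOpen
  -- Constancy of `k` on the fibres of `q₁` holds at free points, where `k` factors through `q₁`,
  -- and extends to `D` by continuity.
  have hwell : ∀ z ∈ D, ∀ w ∈ D, q₁ z = q₁ w → k z = k w := by
    intro z hz w hw hzw
    obtain ⟨g', hg', rfl⟩ := (h₁.fibre z hz w hw).1 hzw
    have hfree : Set.EqOn k (fun z => k ((g' : Matrix (Fin n) (Fin n) ℂ).mulVec z))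
        (D ∩ freeLocus G) := by
      intro v hv
      have hgv := h₁.stable g' hg' v hv.1
      have hqv : q₁ ((g' : Matrix (Fin n) (Fin n) ℂ).mulVec v) = q₁ v := h₁.map_mulVec hg' hv.1
      have hgvf := h.mem_freeLocus_of_map_eq hv hgv (by rw [← hq₁ v hv.1, ← hq₁ _ hgv, hqv])
      change k v = k ((g' : Matrix (Fin n) (Fin n) ℂ).mulVec v)
      rw [hkf hv, hkf ⟨hgv, hgvf⟩, Function.comp_apply, Function.comp_apply, hqv]
    exact hfree.of_subset_closure hkc (hkc.comp (continuous_GL_mulVec g').continuousOn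
      (h₁.stable g' hg')) Set.inter_subset_left hcl hz
  let F : Y → Y' := fun x => k (Function.invFunOn q₁ D x)
  have hF : ∀ z ∈ D, F (q₁ z) = k z := fun z hz =>
    have hm : q₁ z ∈ q₁ '' D := ⟨z, hz, rfl⟩
    hwell _ (Function.invFunOn_mem hm) z hz (Function.invFunOn_eq hm)
  have hFc : ∀ x ∈ q₁ '' D, ContinuousAt F x := by
    rintro _ ⟨z, hz, rfl⟩ S hS
    rw [hF z hz] at hS
    have hSz : k ⁻¹' S ∈ 𝓝 z := (hkc.continuousAt (h.isOpen.mem_nhds hz)).preimage_mem_nhds hS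
    obtain ⟨O, hOS, hO, hzO⟩ := mem_nhds_iff.1 hSz
    rw [Filter.mem_map]
    refine Filter.mem_of_superset ((h₁.isOpen_image _ Set.inter_subset_right
      (hO.inter h₁.isOpen)).mem_nhds ⟨z, ⟨hzO, hz⟩, rfl⟩) ?_
    rintro _ ⟨w, hw, rfl⟩
    rw [Set.mem_preimage, hF w hw.2]
    exact hOS hw.1
  have hsub : q₁ '' (D ∩ freeLocus G) ⊆ q₁ '' D ∩ r ⁻¹' smoothLocus X := by
    rintro _ ⟨z, hz, rfl⟩
    exact ⟨⟨z, hz.1, rfl⟩, hsm z hz⟩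
  refine ⟨q₁ '' D, h₁.isOpen_range, h₁.mem_image, F, ?_, ?_, hFc, ?_⟩
  · have hfree : Set.EqOn F f (q₁ '' (D ∩ freeLocus G)) := by
      rintro _ ⟨z, hz, rfl⟩
      exact (hF z hz.1).trans (hkf hz)
    refine hfree.of_subset_closure (fun x hx => (hFc x hx.1).continuousWithinAt)
      (hf.mono Set.inter_subset_right) hsub ?_
    rintro _ ⟨⟨z, hz, rfl⟩, -⟩
    exact mem_closure_image (h₁.continuousOn.continuousAt (h₁.isOpen.mem_nhds hz)) (hcl hz)
  · rintro _ ⟨z, hz, rfl⟩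
    rw [hF z hz, hkr z hz, hq₁ z hz]
  · rintro _ ⟨z, hz, rfl⟩ φ hφ
    rw [hF z hz, h₂.sheaf _ (h.stable g hg z hz)] at hφ
    rw [h₁.sheaf z hz]
    refine (AnalyticAt.comp (g := φ ∘ q₂)
      (f := fun z => (g : Matrix (Fin n) (Fin n) ℂ).mulVec z) hφ (analyticAt_GL_mulVec g z)).congr ?_
    filter_upwards [h₁.isOpen.mem_nhds hz] with w hw
    simp only [Function.comp_apply]
    rw [hF w hw]

/-- A continuous map over the smooth locus extends to a holomorphic map of orbifold coverings. -/
theorem exists_extension (hX : IsPureOrbifold X) (hr : IsOrbifoldCovering r)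
    (hr' : IsOrbifoldCovering r') {f : Y → Y'} (hf : ContinuousOn f (r ⁻¹' smoothLocus X))
    (hfr : ∀ y ∈ r ⁻¹' smoothLocus X, r' (f y) = r y) :
    ∃ F : Y → Y', IsHolomorphicMap F ∧ Set.EqOn F f (r ⁻¹' smoothLocus X) ∧
      ∀ y, r' (F y) = r y := by
  have := hr'.isPureOrbifold.t2
  choose N hN hyN F hFf hFr hFc hFh using hr.exists_local_extension hX hr' hf hfr
  -- Local extensions agree with `f` over X*, which is dense, so they agree wherever both are
  -- defined.
  have hglue : ∀ y, ∀ x ∈ N y, F x x = F y x := by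
    intro y x hx
    have h : Set.EqOn (F x) (F y) (N x ∩ N y ∩ r ⁻¹' smoothLocus X) := fun t ht =>
      (hFf x ⟨ht.1.1, ht.2⟩).trans (hFf y ⟨ht.1.2, ht.2⟩).symm
    exact h.of_subset_closure (t := N x ∩ N y)
      (fun t ht => (hFc x t ht.1).continuousWithinAt)
      (fun t ht => (hFc y t ht.2).continuousWithinAt) Set.inter_subset_left
      ((hr.dense_preimage hX).open_subset_closure_inter ((hN x).inter (hN y))) ⟨hyN x, hx⟩
  have hev : ∀ y, (fun x => F x x) =ᶠ[𝓝 y] F y := fun y => by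
    filter_upwards [(hN y).mem_nhds (hyN y)] with x hx
    exact hglue y x hx
  refine ⟨fun x => F x x, ⟨continuous_iff_continuousAt.2 fun y =>
    (hFc y y (hyN y)).congr (hev y).symm, fun y φ hφ => ?_⟩, fun y hy => hFf y ⟨hyN y, hy⟩,
    fun y => hFr y y (hyN y)⟩
  exact StructureSheaf.congr ((hev y).symm.fun_comp φ) (hFh y y (hyN y) φ hφ)

end IsOrbifoldCovering

section

/-! ### Change of base point in a covering. -/

theorem MulAut.conj_apply_inv_mul_mul {π : Type*} [Group π] (g p : π) :
    MulAut.conj g (g⁻¹ * p * g) = p := by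
  simp [mul_assoc]

variable {E : Type*} {M : Type*} [TopologicalSpace E] [TopologicalSpace M]

theorem IsCoveringMap.exists_continuousMap_lift_of_range_le {A : Type*} [TopologicalSpace A]
    [PathConnectedSpace A] [LocallyPathConnectedSpace A] {p : E → M} (hp : IsCoveringMap p)
    {f : C(A, M)} {a₀ : A} {e₀ : E} {b : M} (hf : f a₀ = b) (he : p e₀ = b)
    (h : (FundamentalGroup.mapOfEq f hf).range ≤
      (FundamentalGroup.mapOfEq ⟨p, hp.continuous⟩ he).range) :
    ∃ F : C(A, E), F a₀ = e₀ ∧ ∀ a, p (F a) = f a := by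
  subst hf
  have hmap : FundamentalGroup.mapOfEq f rfl = FundamentalGroup.map f a₀ := by
    refine MonoidHom.ext fun p => ?_
    induction p using Path.Homotopic.Quotient.ind with
    | mk γ =>
      rw [FundamentalGroup.mapOfEq_apply]
      rfl
  obtain ⟨F, ⟨hF, hpF⟩, -⟩ := hp.existsUnique_continuousMap_lifts_of_range_le he (hmap ▸ h)
  exact ⟨F, hF, congrFun hpF⟩

/-- The loop defined by a path between two points of a fibre. -/
def FundamentalGroup.ofPath (f : C(E, M)) {x y : E} {b : M} (hx : f x = b) (hy : f y = b)
    (δ : Path x y) : FundamentalGroup M b :=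
  Path.Homotopic.Quotient.mk ((δ.map f.continuous).cast hx.symm hy.symm)

theorem FundamentalGroup.inv_mul_mul_mem_range (f : C(E, M)) {x y : E} {b : M} (hx : f x = b)
    (hy : f y = b) (δ : Path x y) {p : FundamentalGroup M b}
    (hp : p ∈ (FundamentalGroup.mapOfEq f hy).range) :
    (FundamentalGroup.ofPath f hx hy δ)⁻¹ * p * FundamentalGroup.ofPath f hx hy δ ∈
      (FundamentalGroup.mapOfEq f hx).range := by
  obtain ⟨p, rfl⟩ := hp
  induction p using Path.Homotopic.Quotient.ind with
  | mk γ =>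
    -- Products in the group are traversed from right to left, so g⁻¹ p g is the path δ, then the
    -- loop, then δ reversed.
    refine ⟨Path.Homotopic.Quotient.mk (δ.trans (γ.trans δ.symm)), ?_⟩
    rw [FundamentalGroup.mapOfEq_mk, FundamentalGroup.mapOfEq_mk]
    refine congrArg Path.Homotopic.Quotient.mk (Path.ext (funext fun t => ?_))
    simp only [Path.cast_coe, Path.map_coe, Path.trans_apply, Function.comp_apply]
    split_ifs <;> rfl

theorem FundamentalGroup.ofPath_symm (f : C(E, M)) {x y : E} {b : M} (hx : f x = b) (hy : f y = b)
    (δ : Path x y) :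
    FundamentalGroup.ofPath f hy hx δ.symm = (FundamentalGroup.ofPath f hx hy δ)⁻¹ := rfl

theorem FundamentalGroup.map_conj_range_mapOfEq (f : C(E, M)) {x y : E} {b : M} (hx : f x = b)
    (hy : f y = b) (δ : Path x y) :
    (FundamentalGroup.mapOfEq f hx).range.map
      (MulAut.conj (FundamentalGroup.ofPath f hx hy δ)).toMonoidHom =
      (FundamentalGroup.mapOfEq f hy).range := by
  ext p
  constructor
  · rintro ⟨p, hp, rfl⟩
    have h := FundamentalGroup.inv_mul_mul_mem_range f hy hx δ.symm hp
    rw [FundamentalGroup.ofPath_symm f hx hy, inv_inv] at h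
    exact h
  · intro hp
    refine ⟨_, FundamentalGroup.inv_mul_mul_mem_range f hx hy δ hp, ?_⟩
    exact MulAut.conj_apply_inv_mul_mul _ p

/-- Path lifting realizes every loop as a path between two points of the fibre; hence every
conjugate subgroup occurs at some base point. -/
theorem IsCoveringMap.exists_ofPath_eq {f : C(E, M)} (hf : IsCoveringMap f) {x : E} {b : M}
    (hx : f x = b) (g : FundamentalGroup M b) :
    ∃ (y : E) (hy : f y = b) (δ : Path x y), FundamentalGroup.ofPath f hx hy δ = g := by
  induction g using Path.Homotopic.Quotient.ind with
  | mk γ =>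
    have h0 : γ.toContinuousMap 0 = f x := by simp [hx]
    have hl := hf.liftPath_lifts γ x h0
    have hl0 := hf.liftPath_zero γ x h0
    have hy : f (hf.liftPath γ x h0 1) = b := by simpa using congrFun hl 1
    refine ⟨_, hy, ⟨hf.liftPath γ x h0, hl0, rfl⟩, ?_⟩
    exact congrArg Path.Homotopic.Quotient.mk (Path.ext hl)

end

/-! ### The classification. -/

variable {X : Type u} [TopologicalSpace X] [StructureSheaf X] {b : smoothLocus X}

namespace PointedOrbifoldCovering

/-- The lifting criterion over the connected preimage of X* gives a continuous map there, and
`exists_extension` carries it across the rest. -/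
theorem exists_map (hX : IsPureOrbifold X) {P P' : PointedOrbifoldCovering X b}
    (h : P.subgroup ≤ P'.subgroup) : ∃ F : P.space → P'.space, IsHolomorphicMap F ∧
      F P.point = P'.point ∧ ∀ y, P'.proj (F y) = P.proj y := by
  classical
  have hr := P.isCovering
  have hr' := P'.isCovering
  have := hr.pathConnectedSpace hX P.smoothPoint
  have := hr.locallyPathConnectedSpace
  obtain ⟨f, hf, hfr⟩ := hr'.isCoveringMap.exists_continuousMap_lift_of_range_le
    P.restr_smoothPoint P'.restr_smoothPoint h
  obtain ⟨f', hf'⟩ : ∃ f' : P.space → P'.space,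
      ∀ y (hy : y ∈ P.proj ⁻¹' smoothLocus X), f' y = f ⟨y, hy⟩ :=
    ⟨fun y => if hy : y ∈ P.proj ⁻¹' smoothLocus X then f ⟨y, hy⟩ else P'.point,
      fun y hy => dif_pos hy⟩
  have hf'c : ContinuousOn f' (P.proj ⁻¹' smoothLocus X) := by
    rw [continuousOn_iff_continuous_domRestrict]
    exact (continuous_subtype_val.comp f.continuous).congr fun y => (hf' y y.2).symm
  obtain ⟨F, hF, hFf, hFr⟩ := hr.exists_extension hX hr' hf'c fun y hy => by
    rw [hf' y hy]
    exact congrArg Subtype.val (hfr ⟨y, hy⟩)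
  refine ⟨F, hF, ?_, hFr⟩
  exact (hFf P.smoothPoint.2).trans ((hf' _ P.smoothPoint.2).trans (congrArg Subtype.val hf))

theorem eq_id (hX : IsPureOrbifold X) (P : PointedOrbifoldCovering X b) {F : P.space → P.space}
    (hF : Continuous F) (hP : F P.point = P.point) (hFr : ∀ y, P.proj (F y) = P.proj y) (y) :
    F y = y := by
  have hr := P.isCovering
  have := hr.isPureOrbifold.t2
  have h : Set.EqOn F id (P.proj ⁻¹' smoothLocus X) :=
    hr.eqOn_of_comp_eqOn (hr.isPreconnected_preimage hX) hF.continuousOn continuousOn_id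
      (fun y _ => hFr y) (fun y hy => by rw [hFr]; exact hy) P.smoothPoint.2 hP
  exact congrFun (Continuous.ext_on (hr.dense_preimage hX) hF continuous_id h) y

theorem equiv_of_subgroup_eq (hX : IsPureOrbifold X) {P P' : PointedOrbifoldCovering X b}
    (h : P.subgroup = P'.subgroup) : P ≈ P' := by
  obtain ⟨F, hF, hFP, hFr⟩ := exists_map hX h.le
  obtain ⟨F', hF', hFP', hFr'⟩ := exists_map hX h.ge
  have h1 := P.eq_id hX (F := F' ∘ F) (hF'.continuous.comp hF.continuous)
    (by rw [Function.comp_apply, hFP, hFP']) fun y => by rw [Function.comp_apply, hFr', hFr]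
  have h2 := P'.eq_id hX (F := F ∘ F') (hF.continuous.comp hF'.continuous)
    (by rw [Function.comp_apply, hFP', hFP]) fun y => by rw [Function.comp_apply, hFr, hFr']
  exact ⟨⟨⟨⟨F, F', h1, h2⟩, hF.continuous, hF'.continuous⟩, hF, hF', hFr⟩, hFP⟩

/-- Moving the base point. -/
abbrev withPoint (P : PointedOrbifoldCovering X b) (y : P.space) (hy : P.proj y = b) :
    PointedOrbifoldCovering X b :=
  { P.toOrbifoldCovering with point := y, proj_point := hy }

theorem exists_map_conj_subgroup (hX : IsPureOrbifold X) (P : PointedOrbifoldCovering X b)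
    (y : P.space) (hy : P.proj y = b) :
    ∃ g, P.subgroup.map (MulAut.conj g).toMonoidHom = (P.withPoint y hy).subgroup := by
  have := P.isCovering.pathConnectedSpace hX P.smoothPoint
  obtain ⟨δ⟩ := PathConnectedSpace.joined P.smoothPoint (P.withPoint y hy).smoothPoint
  exact ⟨_, FundamentalGroup.map_conj_range_mapOfEq P.restr P.restr_smoothPoint
    (P.withPoint y hy).restr_smoothPoint δ⟩

theorem exists_subgroup_withPoint_eq (P : PointedOrbifoldCovering X b)
    (g : OrbifoldFundamentalGroup X b) : ∃ y hy,
      (P.withPoint y hy).subgroup = P.subgroup.map (MulAut.conj g).toMonoidHom := by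
  obtain ⟨y, hy, δ, rfl⟩ := IsCoveringMap.exists_ofPath_eq (f := P.restr)
    P.isCovering.isCoveringMap P.restr_smoothPoint g
  exact ⟨y, congrArg Subtype.val hy, (FundamentalGroup.map_conj_range_mapOfEq P.restr
    P.restr_smoothPoint hy δ).symm⟩

/-- An isomorphism moves one base point to another of the same fibre, which conjugates the subgroup.
Conversely, a conjugation is undone by a new base point, after which the pointed classification
applies. -/
theorem nonempty_iso_iff (hX : IsPureOrbifold X) (P P' : PointedOrbifoldCovering X b) :
    Nonempty (OrbifoldCovering.Iso P.toOrbifoldCovering P'.toOrbifoldCovering) ↔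
      (conjugateSetoid (OrbifoldFundamentalGroup X b)).r P.subgroup P'.subgroup := by
  constructor
  · rintro ⟨e⟩
    have hy : P.proj (e.symm.toHomeomorph P'.point) = b := by
      rw [e.symm.proj_comp, P'.proj_point]
    obtain ⟨g, hg⟩ := P.exists_map_conj_subgroup hX _ hy
    refine ⟨g, hg.trans (subgroup_eq_of_iso ⟨e, ?_⟩)⟩
    exact e.toHomeomorph.apply_symm_apply _
  · rintro ⟨g, hg⟩
    obtain ⟨y, hy, h⟩ := P.exists_subgroup_withPoint_eq g
    obtain ⟨e, -⟩ := equiv_of_subgroup_eq hX (h.trans hg)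
    exact ⟨e⟩

end PointedOrbifoldCovering

theorem OrbifoldCovering.exists_pointed (C : OrbifoldCovering X) (b : smoothLocus X) :
    ∃ P : PointedOrbifoldCovering X b, P.toOrbifoldCovering = C := by
  obtain ⟨y, hy⟩ := C.isCovering.surjective b
  exact ⟨{ C with point := y, proj_point := congrArg Subtype.val hy }, rfl⟩

theorem mainTheorem7 {X : Type u} [TopologicalSpace X] [StructureSheaf X]
    (hX : IsPureOrbifold X) [ConnectedSpace X] (b : smoothLocus X) :
    Function.Bijective (PointedOrbifoldCoveringClass.subgroup (X := X) (b := b)) ∧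
    ∃ Φ : OrbifoldCoveringClass X → Quotient (conjugateSetoid (OrbifoldFundamentalGroup X b)),
      Function.Bijective Φ ∧
      ∀ P : PointedOrbifoldCovering X b,
        Φ (Quotient.mk _ P.toOrbifoldCovering) = Quotient.mk _ P.subgroup := by
  refine ⟨⟨?_, fun H => ?_⟩, ?_⟩
  · rintro ⟨P⟩ ⟨P'⟩ h
    exact Quotient.sound (PointedOrbifoldCovering.equiv_of_subgroup_eq hX h)
  · obtain ⟨P, hP⟩ := PointedOrbifoldCovering.exists_subgroup_eq hX b H
    exact ⟨Quotient.mk _ P, hP⟩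
  -- An arbitrary base point in every covering defines the map on classes; `hiff` makes it
  -- independent of the choice and, read backwards, gives injectivity.
  choose pointed hpointed using fun C : OrbifoldCovering X => C.exists_pointed b
  have hiff : ∀ C (P : PointedOrbifoldCovering X b), C ≈ P.toOrbifoldCovering ↔
      (conjugateSetoid (OrbifoldFundamentalGroup X b)).r (pointed C).subgroup P.subgroup := by
    intro C P
    rw [← PointedOrbifoldCovering.nonempty_iso_iff hX, hpointed]
    rfl
  let Φ : OrbifoldCoveringClass X → Quotient (conjugateSetoid (OrbifoldFundamentalGroup X b)) :=
    Quotient.lift (fun C => Quotient.mk _ (pointed C).subgroup) fun C C' h =>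
      Quotient.sound ((hiff C (pointed C')).1 (by rwa [hpointed]))
  have hΦ : ∀ P : PointedOrbifoldCovering X b,
      Φ (Quotient.mk _ P.toOrbifoldCovering) = Quotient.mk _ P.subgroup := fun P =>
    Quotient.sound ((hiff _ P).1 (Setoid.refl _))
  refine ⟨Φ, ⟨?_, ?_⟩, hΦ⟩
  · rintro ⟨C⟩ ⟨C'⟩ h
    have := (hiff C (pointed C')).2 (Quotient.exact h)
    rw [hpointed] at this
    exact Quotient.sound this
  · rintro ⟨H⟩
    obtain ⟨P, rfl⟩ := PointedOrbifoldCovering.exists_subgroup_eq hX b H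
    exact ⟨_, hΦ P⟩
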